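/- Let $k$ be a field and $R=k[x,y]$ with the lexicographic order induced by $x>y$. Let $L\subset R$ be a lex-segment ideal with $\dim_k R/L<\infty$, and put $t=\min\{n: x^n\in L\}$, $m_i=\min\{n : x^{t-i}y^n\in L\}$ for $0\le i\le t$, and $d_i=m_i-m_{i-1}$, $a_i=t+1-i+m_{i-1}$, $b_i=a_{i+1}+1$. Let $V(L)$ be the set of homogeneous ideals $I$ with $\operatorname{Lt}(I)=L$. For $j\in\mathbb Z$ and an integer $u\ge 0$ let $V(L,j,u)$ (resp. $V(L,j,\ge u)$) be the set of $I\in V(L)$ with $\beta_{0,j}(I)=u$ (resp. $\beta_{0,j}(I)\ge u$), where $\beta_{i,j}$ denotes the graded Betti numbers of an ideal. Let $u_{ij}=m_j-m_{i-1}+i-j$ and $S=\{(i,j): 1\le j<i\le t+1,\ 0\le u_{ij}<d_j\}$. For a point $p=(p_{ij})_{(i,j)\in S}$ of the affine space $\mathbf A^{S}$, let $M(p)$ be the $(t+1)\times t$ matrix $M_0+N$, where $M_0$ has entries $y^{d_i}$ at $(i,i)$, $-x$ at $(i+1,i)$ and $0$ elsewhere, and $N$ has entries $p_{ij}y^{u_{ij}}$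 at $(i,j)\in S$ and $0$ elsewhere. Let $M(p)_j$ be the submatrix of $M(p)$ modulo $(x,y)$ with rows $\{i:a_i=j\}$ and columns $\{i: b_i=j\}$. Sending $p$ to the ideal of maximal minors of $M(p)$ is a bijection from $\mathbf A^{S}(k)=k^S$ onto $V(L)$, and this is used to regard $V(L)$ as the affine space $\mathbf A^S$. Then $M(p)_j$ is a $\beta_{0,j}(L)\times\beta_{1,j}(L)$ matrix whose entries are distinct coordinates $p_{i i'}$ of $\mathbf A^S$, and $V(L,j,\ge u)$ is defined in $\mathbf A^S$ by the condition $\operatorname{rank} M(p)_j\le \beta_{0,j}(L)-u$. Moreover: (1) $V(L,j,\ge u)$ is nonempty if and only if $u\le\beta_{0,j}(L)$, and it is then irreducible. $V(L,j,u)$ is nonempty if and only if $\beta_{0,j}(L)-\beta_{1,j}(L)\le u\le\beta_{0,j}(L)$, and then $V(L,j,\ge u)$ is the closure of $V(L,j,u)$. (2) If $\beta_{0,j}(L)-\beta_{1,j}(L)\le u\le \beta_{0,j}(L)$, then the codimension of $V(L,j,\ge u)$ in $\mathbf A^S$ is $(\beta_{1,j}(L)-\beta_{0,j}(L)+u)\,u$.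 The rank description and the nonemptiness criteria hold both for the sets of ideals of $k[x,y]$ and for the corresponding subsets of $\operatorname{Spec} k[p_s:s\in S]$, where the ideal at a point is taken over the residue field of that point. Irreducibility, closure and codimension (the height of the vanishing ideal) hold in $\operatorname{Spec} k[p_s : s\in S]$ for every field $k$, and also in the space of rational points $k^S$ with its Zariski topology when $k$ is infinite. -/

import Mathlib

noncomputable section

open MvPolynomial

/-! ## Graded Betti numbers of ideals of `K[x,y]`, with `x = X 0` and `y = X 1` -/

section Betti

variable {K : Type*} [Field K]

/-- The `K`-vector space `I_d` of the elements of `I` that are homogeneous of degree `d`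
(for an integer `d`; it is zero when `d < 0`). -/
def gradedPart (I : Ideal (MvPolynomial (Fin 2) K)) (d : ℤ) :
    Submodule K (MvPolynomial (Fin 2) K) where
  carrier := {f | f ∈ I ∧ ∀ n ∈ f.support, ((n.degree : ℕ) : ℤ) = d}
  zero_mem' := ⟨I.zero_mem, by simp⟩
  add_mem' := by
    rintro f g ⟨hf, hf'⟩ ⟨hg, hg'⟩
    refine ⟨I.add_mem hf hg, fun n hn => ?_⟩
    rcases Finset.mem_union.1 (support_add hn) with h | h
    exacts [hf' n h, hg' n h]
  smul_mem' := by
    rintro c f ⟨hf, hf'⟩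
    refine ⟨?_, fun n hn => hf' n (support_smul hn)⟩
    rw [smul_eq_C_mul]
    exact I.mul_mem_left _ hf

/-- `β_{0,j}(I)`, the number of minimal generators of degree `j` of the homogeneous ideal `I`,
that is, the dimension of `(I / 𝔪 I)_j`, where `𝔪 = (x, y)`. -/
def betti0 (I : Ideal (MvPolynomial (Fin 2) K)) (j : ℤ) : ℕ :=
  Module.finrank K (gradedPart I j ⧸
    (gradedPart (Ideal.span {X 0, X 1} * I) j).submoduleOf (gradedPart I j))

/-- The cycles of degree `j` in the middle of the Koszul complex
`0 → I(-2) → I(-1) ⊕ I(-1) → I → 0` of `x, y` with coefficients in `I`: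
the pairs `(a, b)` of elements of `I_{j-1}` with `x a + y b = 0`. -/
def koszulCycles (I : Ideal (MvPolynomial (Fin 2) K)) (j : ℤ) :
    Submodule K (MvPolynomial (Fin 2) K × MvPolynomial (Fin 2) K) :=
  (gradedPart I (j - 1)).prod (gradedPart I (j - 1)) ⊓
    LinearMap.ker ((LinearMap.mulLeft K (X 0 : MvPolynomial (Fin 2) K)).coprod
      (LinearMap.mulLeft K (X 1)))

/-- The boundaries `(-y c, x c)`, `c ∈ I_{j-2}`, of the same Koszul complex in degree `j`. -/
def koszulBoundaries (I : Ideal (MvPolynomial (Fin 2) K)) (j : ℤ) :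
    Submodule K (MvPolynomial (Fin 2) K × MvPolynomial (Fin 2) K) :=
  (gradedPart I (j - 2)).map
    ((LinearMap.mulLeft K (-X 1 : MvPolynomial (Fin 2) K)).prod (LinearMap.mulLeft K (X 0)))

/-- `β_{1,j}(I) = dim Tor_1(I, K)_j`, the number of minimal first syzygies of degree `j` of the
homogeneous ideal `I`, computed by the Koszul resolution of `K` over `K[x,y]`. -/
def betti1 (I : Ideal (MvPolynomial (Fin 2) K)) (j : ℤ) : ℕ :=
  Module.finrank K (koszulCycles I j ⧸ (koszulBoundaries I j).submoduleOf (koszulCycles I j))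

end Betti

/-! ## Monomial ideals, Gröbner cells and Betti strata -/

section Cells

variable {K : Type*} [Field K]

/-- A monomial ideal such that, with a monomial, it contains all monomials of the same degree
which are larger in the lexicographic order with `x > y`. -/
def IsLexSegment (L : Ideal (MvPolynomial (Fin 2) K)) : Prop :=
  (∃ A : Set (Fin 2 →₀ ℕ), L = Ideal.span ((fun n => monomial n (1 : K)) '' A)) ∧
    ∀ n n' : Fin 2 →₀ ℕ, n.degree = n'.degree →
      MonomialOrder.lex.toSyn n ≤ MonomialOrder.lex.toSyn n' →
      monomial n (1 : K) ∈ L → monomial n' (1 : K) ∈ L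

/-- `Lt(I)`: the ideal generated by the leading terms of the nonzero elements of `I`, for the
lexicographic order with `x > y`. -/
def initialIdeal (I : Ideal (MvPolynomial (Fin 2) K)) : Ideal (MvPolynomial (Fin 2) K) :=
  Ideal.span {g | ∃ f ∈ I, f ≠ 0 ∧ g = monomial (MonomialOrder.lex.degree f) (1 : K)}

/-- `V(E)`: the homogeneous ideals `I` with `Lt(I) = E`. -/
def groebnerCell (E : Ideal (MvPolynomial (Fin 2) K)) : Set (Ideal (MvPolynomial (Fin 2) K)) :=
  {I | (∀ f ∈ I, ∀ d : ℕ, homogeneousComponent d f ∈ I) ∧ initialIdeal I = E}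

/-- `V(E, j, u)` -/
def bettiStratum (E : Ideal (MvPolynomial (Fin 2) K)) (j : ℤ) (u : ℕ) :
    Set (Ideal (MvPolynomial (Fin 2) K)) :=
  {I | I ∈ groebnerCell E ∧ betti0 I j = u}

/-- `V(E, j, ≥ u)` -/
def bettiStratumGE (E : Ideal (MvPolynomial (Fin 2) K)) (j : ℤ) (u : ℕ) :
    Set (Ideal (MvPolynomial (Fin 2) K)) :=
  {I | I ∈ groebnerCell E ∧ u ≤ betti0 I j}

end Cells

/-! ## The parametrization of `V(E)` by Hilbert-Burch matrices -/

section Parametrization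

variable {k : Type*} [Field k] (E : Ideal (MvPolynomial (Fin 2) k))

/-- `t = min {n : x ^ n ∈ E}` -/
def expT : ℕ := sInf {n | (X 0 : MvPolynomial (Fin 2) k) ^ n ∈ E}

/-- `m_i = min {n : x ^ (t - i) * y ^ n ∈ E}`, used for `0 ≤ i ≤ t` -/
def expM (i : ℕ) : ℕ := sInf {n | (X 0 : MvPolynomial (Fin 2) k) ^ (expT E - i) * X 1 ^ n ∈ E}

/-- `d_{c+1} = m_{c+1} - m_c` for `0 ≤ c < t` (the sequence `m_0, …, m_t` is nondecreasing) -/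
def expD (c : ℕ) : ℕ := expM E (c + 1) - expM E c

/-- The degree of the entry in row `r` and column `c` of a Hilbert-Burch matrix. Rows and columns
are numbered from `0`, so this is `u_{r+1,c+1} = m_{c+1} - m_r + r - c`. -/
def entryDegree (r c : ℕ) : ℤ := (expM E (c + 1) : ℤ) - expM E r + r - c

/-- The set `S(E)` of the positions `(r, c)` below the diagonal with `0 ≤ u_{r+1,c+1} < d_{c+1}`;
the affine space that parametrizes `V(E)` has one coordinate for each of them. -/
abbrev ParamIndex : Type :=
  {s : Fin (expT E + 1) × Fin (expT E) // (s.2 : ℕ) < s.1 ∧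
    0 ≤ entryDegree E s.1 s.2 ∧ entryDegree E s.1 s.2 < expD E s.2}

/-- The matrix `M(p) = M_0(E) + N` over `A[x,y]`, for a point `p` with coordinates in `A`. Here
`M_0(E)` has the entries `y ^ d_{c+1}` on the diagonal and `-x` just below it, and `N` has the
entries `p_s y ^ u_s` at the positions `s ∈ S(E)`. -/
def hilbertBurch {A : Type*} [CommRing A] (p : ParamIndex E → A) :
    Matrix (Fin (expT E + 1)) (Fin (expT E)) (MvPolynomial (Fin 2) A) :=
  fun r c =>
    (if (r : ℕ) = c then X 1 ^ expD E c else if (r : ℕ) = c + 1 then -X 0 else 0) +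
    (if h : (c : ℕ) < r ∧ 0 ≤ entryDegree E r c ∧ entryDegree E r c < expD E c then
      C (p ⟨(r, c), h⟩) * X 1 ^ (entryDegree E r c).toNat else 0)

/-- The ideal of maximal minors of `M(p)`. -/
def paramIdeal {A : Type*} [CommRing A] (p : ParamIndex E → A) :
    Ideal (MvPolynomial (Fin 2) A) :=
  Ideal.span (Set.range fun r : Fin (expT E + 1) =>
    ((hilbertBurch E p).submatrix r.succAbove id).det)

/-- The degree `t - r + m_r` of the generator that belongs to row `r`. -/
def genDegree (r : Fin (expT E + 1)) : ℤ := (expT E : ℤ) - (r : ℕ) + expM E r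

/-- The degree of the syzygy that belongs to column `c`. -/
def relDegree (c : Fin (expT E)) : ℤ := genDegree E c.succ + 1

/-- The set `w_j` of the rows of degree `j` -/
abbrev RowIndex (j : ℤ) : Type := {r : Fin (expT E + 1) // genDegree E r = j}

/-- The set `v_j` of the columns of degree `j` -/
abbrev ColIndex (j : ℤ) : Type := {c : Fin (expT E) // relDegree E c = j}

/-- `M(p)_j`: the submatrix of `M(p)` with rows `w_j` and columns `v_j`, as a matrix over `A`
(it represents the degree `j` component of `M(p)` modulo `(x, y)`). -/
def strandMatrix {A : Type*} [CommRing A] (p : ParamIndex E → A) (j : ℤ) :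
    Matrix (RowIndex E j) (ColIndex E j) A :=
  fun r c => constantCoeff (hilbertBurch E p r.1 c.1)

end Parametrization

/-! ## The strata as subsets of affine space -/

section AffineSpace

variable {k : Type*} [Field k]

/-- The Zariski topology on the affine space of `k`-rational points `σ → k`. -/
@[reducible]
def zariskiTopology (k σ : Type*) [Field k] : TopologicalSpace (σ → k) :=
  TopologicalSpace.induced (pointToPoint (k := k)) inferInstance

/-- The closed sets are the zero loci of ideals of polynomials. -/
theorem isClosed_zariskiTopology_iff {σ : Type*} (Z : Set (σ → k)) :
    @IsClosed _ (zariskiTopology k σ) Z ↔ ∃ I : Ideal (MvPolynomial σ k), Z = zeroLocus k I := by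
  have key : ∀ I : Ideal (MvPolynomial σ k),
      pointToPoint (k := k) ⁻¹' PrimeSpectrum.zeroLocus (I : Set (MvPolynomial σ k)) =
        zeroLocus k I := by
    intro I
    ext x
    refine ⟨fun h p hp => (mem_vanishingIdeal_singleton_iff x p).1 (h hp),
      fun h p hp => (mem_vanishingIdeal_singleton_iff x p).2 (h p hp)⟩
  rw [zariskiTopology, isClosed_induced_iff]
  constructor
  · rintro ⟨T, hT, rfl⟩
    obtain ⟨I, rfl⟩ := (PrimeSpectrum.isClosed_iff_zeroLocus_ideal T).1 hT
    exact ⟨I, key I⟩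
  · rintro ⟨I, rfl⟩
    exact ⟨_, PrimeSpectrum.isClosed_zeroLocus _, key I⟩

variable (E : Ideal (MvPolynomial (Fin 2) k))

/-- The coordinates of a point `q` of the affine space `Spec k[p_s : s ∈ S(E)]`, in the residue
field of `q`. -/
def coordsAt (q : PrimeSpectrum (MvPolynomial (ParamIndex E) k)) :
    ParamIndex E → q.asIdeal.ResidueField :=
  fun s => algebraMap (MvPolynomial (ParamIndex E) k) q.asIdeal.ResidueField (X s)

/-- The ideal generated by `E` over the residue field of the point `q`. -/
def baseChangeAt (q : PrimeSpectrum (MvPolynomial (ParamIndex E) k)) :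
    Ideal (MvPolynomial (Fin 2) q.asIdeal.ResidueField) :=
  E.map (MvPolynomial.map
    ((algebraMap (MvPolynomial (ParamIndex E) k) q.asIdeal.ResidueField).comp C))

/-- `V(E, j, u)` as a subset of the affine space `Spec k[p_s : s ∈ S(E)]`. -/
def specStratum (j : ℤ) (u : ℕ) : Set (PrimeSpectrum (MvPolynomial (ParamIndex E) k)) :=
  {q | paramIdeal E (coordsAt E q) ∈ bettiStratum (baseChangeAt E q) j u}

/-- `V(E, j, ≥ u)` as a subset of the affine space `Spec k[p_s : s ∈ S(E)]`. -/
def specStratumGE (j : ℤ) (u : ℕ) : Set (PrimeSpectrum (MvPolynomial (ParamIndex E) k)) :=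
  {q | paramIdeal E (coordsAt E q) ∈ bettiStratumGE (baseChangeAt E q) j u}

/-- `V(E, j, u)` as a subset of the affine space `ParamIndex E → k` of rational points. -/
def pointStratum (j : ℤ) (u : ℕ) : Set (ParamIndex E → k) :=
  {p | paramIdeal E p ∈ bettiStratum E j u}

/-- `V(E, j, ≥ u)` as a subset of the affine space `ParamIndex E → k` of rational points. -/
def pointStratumGE (j : ℤ) (u : ℕ) : Set (ParamIndex E → k) :=
  {p | paramIdeal E p ∈ bettiStratumGE E j u}

end AffineSpace

end

/-! ### Rank of matrices over a field: minors and factorizations. -/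

section

open MvPolynomial

namespace Matrix

variable {K m n : Type*} [Field K] [Fintype n]

/-! Setting `y = 1` turns a homogeneous ideal `I` into an increasing filtration of `K[X]` by the
spaces `dehomPiece I D`, on which `X` raises the level by one, and the lex leading term of a
homogeneous element becomes the degree of a one-variable polynomial. Let `δ a = cornerDegree L a` be
the least degree of a monomial of `L` with `x`-exponent `a`; the lex-segment property makes `δ`
weakly decreasing up to `t`. Then `Lt(I) = L` says that the degrees of nonzero elements at level `D`
are exactly the `a` with `δ a ≤ D`.

Such a filtration is spanned by monic polynomials `η_a = hessSeq P a` with `X η_a = η_{a+1} + ∑ P a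
b η_b`, where `P a b ≠ 0` only if `δ (a+1) < δ b ≤ δ a + 1`. The upper bound reflects that `X`
raises the level by one; the lower bound is a normalization, since terms with `δ b ≤ δ (a+1)` can be
absorbed into `η_{a+1}`. The array `P` exists (`exists_cellArray`) and is unique
(`cellArray_unique`). Its possible positions are those of `S`, and the syzygies of the maximal
minors of `M(p)` are the homogenized recursion (`signedMinor_eq_rehom`). Hence the bijection
`paramIdeal_bijOn`, over every coefficient field, in particular over residue fields of points.

In the basis `η_a`, coordinates at the rows of degree `j` identify `I_j / (𝔪 I)_j` with the cokernel
of `M(p)_j` (`betti0_add_rank`). The point `p = 0` gives the number of rows, and the Euler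
characteristic of the Koszul complex the number of columns. Every position of the strand lies in
`S`, so its entries are distinct coordinates and the Betti strata are loci of generic matrices of
bounded rank.

The ideal of the locus of rank at most `r` is taken to be `rankIdeal`, the kernel of the map to a
universal product of two matrices through `r`; it is visibly prime, and `rankIdeal_le_ker_iff` shows
that it cuts out the rank condition. Where an `r × r` block is invertible, that condition is the
vanishing of the Schur complement, whose entries can be solved for one at a time. This gives a chain
of primes bounding the height below, while Krull's height theorem bounds it above
(`height_rankIdeal`). A nonvanishing minor at the generic point gives the closure statements. -/

theorem exists_submatrix_linearIndependent_rows [Fintype m] (M : Matrix m n K) {r : ℕ}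
    (h : r ≤ M.rank) : ∃ e : Fin r → m, LinearIndependent K (M.submatrix e id).row := by
  rw [rank_eq_finrank_span_row] at h
  obtain ⟨f, hf, -, hli⟩ := Submodule.exists_fun_fin_finrank_span_eq K (Set.range M.row)
  choose e he using hf
  refine ⟨fun i => e (Fin.castLE h i), ?_⟩
  have : (M.submatrix (fun i => e (Fin.castLE h i)) id).row = f ∘ Fin.castLE h :=
    funext fun i => he (Fin.castLE h i)
  rw [this]
  exact hli.comp (Fin.castLE h) (Fin.castLE_injective h)

/-- Independent rows are selected first, then independent columns of the resulting matrix, whose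
rank is still `r`. -/
theorem exists_submatrix_det_ne_zero [Fintype m] (M : Matrix m n K) {r : ℕ} (h : r ≤ M.rank) :
    ∃ (e : Fin r → m) (f : Fin r → n), (M.submatrix e f).det ≠ 0 := by
  obtain ⟨e, he⟩ := M.exists_submatrix_linearIndependent_rows h
  have h1 : r ≤ (M.submatrix e id)ᵀ.rank := by
    rw [rank_transpose, he.rank_matrix, Fintype.card_fin]
  obtain ⟨f, hf⟩ := exists_submatrix_linearIndependent_rows _ h1
  refine ⟨e, f, ?_⟩
  rw [linearIndependent_rows_iff_isUnit, isUnit_iff_isUnit_det] at hf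
  rw [← det_transpose]
  exact hf.ne_zero

theorem le_rank_of_submatrix_det_ne_zero (M : Matrix m n K) {ρ : Type*} [Fintype ρ] [DecidableEq ρ]
    (e : ρ → m) (f : ρ → n) (h : (M.submatrix e f).det ≠ 0) : Fintype.card ρ ≤ M.rank := by
  rw [← rank_of_det_ne_zero h]
  exact M.rank_submatrix_le e f

/-- A basis of the column space, padded by zero vectors up to the size of `ρ`, gives the columns of
`P`; the coordinates of the columns of `M` give `Q`. -/
theorem exists_eq_mul_of_rank_le (M : Matrix m n K) {ρ : Type*} [Fintype ρ]
    (h : M.rank ≤ Fintype.card ρ) : ∃ (P : Matrix m ρ K) (Q : Matrix ρ n K), M = P * Q := by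
  rw [rank_eq_finrank_span_cols] at h
  have : Module.Finite K (Submodule.span K (Set.range M.col)) :=
    Module.Finite.span_of_finite K (Set.finite_range _)
  obtain ⟨f, -, hs, -⟩ := Submodule.exists_fun_fin_finrank_span_eq K (Set.range M.col)
  obtain ⟨ε⟩ : Nonempty (Fin (Module.finrank K (Submodule.span K (Set.range M.col))) ↪ ρ) :=
    Function.Embedding.nonempty_of_card_le (by simpa using h)
  let g : ρ → m → K := Function.extend ε f 0
  have hg : ∀ j, M.col j ∈ Submodule.span K (Set.range g) := by
    intro j
    have h1 : M.col j ∈ Submodule.span K (Set.range f) :=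
      hs.symm ▸ Submodule.subset_span (Set.mem_range_self (f := M.col) j)
    refine Submodule.span_mono ?_ h1
    rintro _ ⟨i, rfl⟩
    exact ⟨ε i, ε.injective.extend_apply _ _ _⟩
  choose c hc using fun j => (Submodule.mem_span_range_iff_exists_fun K).1 (hg j)
  refine ⟨of fun i l => g l i, of fun l j => c j l, ?_⟩
  ext i j
  have := congrFun (hc j) i
  simp only [Finset.sum_apply, Pi.smul_apply, smul_eq_mul, col_apply] at this
  rw [mul_apply, ← this]
  exact Finset.sum_congr rfl fun _ _ => mul_comm _ _

theorem rank_mul_le_card {ρ : Type*} [Fintype ρ] (P : Matrix m ρ K) (Q : Matrix ρ n K) :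
    (P * Q).rank ≤ Fintype.card ρ :=
  (rank_mul_le_left P Q).trans (rank_le_card_width P)

end Matrix

end

/-! ### Fraction-free Schur complements over a commutative ring. -/

noncomputable section
open MvPolynomial

namespace Matrix

section Schur

variable {A ρ w v : Type*} [CommRing A] [Fintype ρ] [DecidableEq ρ]

/-- The Schur complement of the upper left block of `N`, multiplied by the determinant of
that block. -/
def schurDefect (N : Matrix (ρ ⊕ w) (ρ ⊕ v) A) : Matrix w v A :=
  N.toBlocks₁₁.det • N.toBlocks₂₂ - N.toBlocks₂₁ * N.toBlocks₁₁.adjugate * N.toBlocks₁₂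

theorem schurDefect_map {B : Type*} [CommRing B] (N : Matrix (ρ ⊕ w) (ρ ⊕ v) A) (g : A →+* B) :
    (N.map g).schurDefect = N.schurDefect.map g := by
  have h11 : (N.map g).toBlocks₁₁ = g.mapMatrix N.toBlocks₁₁ := rfl
  have h12 : (N.map g).toBlocks₁₂ = N.toBlocks₁₂.map g := rfl
  have h21 : (N.map g).toBlocks₂₁ = N.toBlocks₂₁.map g := rfl
  have h22 : (N.map g).toBlocks₂₂ = N.toBlocks₂₂.map g := rfl
  rw [schurDefect, schurDefect, h11, h12, h21, h22, ← RingHom.map_det, ← RingHom.map_adjugate,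
    RingHom.mapMatrix_apply, ← Matrix.map_mul, ← Matrix.map_mul]
  ext i j
  rw [Matrix.map_apply, sub_apply, sub_apply, smul_apply, smul_apply, map_sub, smul_eq_mul,
    smul_eq_mul, map_mul, Matrix.map_apply, Matrix.map_apply]

/-- Since `adj (P₁ Q₁) = adj Q₁ * adj P₁`, each adjugate meets its own matrix and both terms become
`det P₁ * det Q₁` times `P₂ Q₂`. -/
theorem schurDefect_mul (P : Matrix (ρ ⊕ w) ρ A) (Q : Matrix ρ (ρ ⊕ v) A) :
    (P * Q).schurDefect = 0 := by
  have h : P * Q = fromBlocks (P.toRows₁ * Q.toCols₁) (P.toRows₁ * Q.toCols₂)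
      (P.toRows₂ * Q.toCols₁) (P.toRows₂ * Q.toCols₂) := by
    rw [← fromRows_mul_fromCols, fromRows_toRows, fromCols_toCols]
  rw [h, schurDefect, toBlocks_fromBlocks₁₁, toBlocks_fromBlocks₁₂, toBlocks_fromBlocks₂₁,
    toBlocks_fromBlocks₂₂, adjugate_mul_distrib, det_mul, sub_eq_zero]
  calc _ = (Q.toCols₁.det * P.toRows₁.det) • (P.toRows₂ * Q.toCols₂) := by rw [mul_comm Q.toCols₁.det]
    _ = P.toRows₂ * (Q.toCols₁ * Q.toCols₁.adjugate) * (P.toRows₁.adjugate * P.toRows₁) *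
        Q.toCols₂ := by
      rw [mul_adjugate, adjugate_mul]
      simp [smul_smul, mul_comm]
    _ = _ := by simp only [Matrix.mul_assoc]

/-- Block elimination: the left block column serves as `P`, and the vanishing defect makes the lower
right corner agree. A unit determinant suffices, so this applies over the localization at the pivot.
-/
theorem exists_eq_mul_of_schurDefect_eq_zero (N : Matrix (ρ ⊕ w) (ρ ⊕ v) A)
    (hN : IsUnit N.toBlocks₁₁.det) (h : N.schurDefect = 0) :
    ∃ (P : Matrix (ρ ⊕ w) ρ A) (Q : Matrix ρ (ρ ⊕ v) A), N = P * Q := by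
  refine ⟨fromRows N.toBlocks₁₁ N.toBlocks₂₁, fromCols 1 (N.toBlocks₁₁⁻¹ * N.toBlocks₁₂), ?_⟩
  rw [fromRows_mul_fromCols]
  conv_lhs => rw [← fromBlocks_toBlocks N]
  rw [Matrix.mul_one, Matrix.mul_one, ← Matrix.mul_assoc, mul_nonsing_inv _ hN, Matrix.one_mul]
  congr 1
  rw [schurDefect, sub_eq_zero] at h
  obtain ⟨δ, hδ⟩ := hN
  rw [inv_def, ← hδ, Ring.inverse_unit, smul_mul, Matrix.mul_smul, ← Matrix.mul_assoc, ← h, ← hδ,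
    smul_smul, Units.inv_mul, one_smul]

end Schur

end Matrix

/-! ### The prime ideal of matrices of bounded rank. -/

namespace MvPolynomial

variable {k σ : Type*} [Field k]

section Rank

variable {W V : Type*}

/-- The matrix of the variables `X (ι (i, j))`. -/
def variableMatrix (k : Type*) [Field k] (ι : W × V → σ) : Matrix W V (MvPolynomial σ k) :=
  Matrix.of fun i j => X (ι (i, j))

/-- The point of affine space whose matrix is the product of two matrices of variables, and
whose other coordinates are variables. -/
def productPoint (k : Type*) [Field k] (ι : W × V → σ) (ρ : Type*) [Fintype ρ] :
    σ → MvPolynomial ((W × ρ) ⊕ (ρ × V) ⊕ σ) k :=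
  Function.extend ι (fun ij => ∑ l, X (.inl (ij.1, l)) * X (.inr (.inl (l, ij.2))))
    fun s => X (.inr (.inr s))

/-- The ideal of the polynomials that vanish on the matrices of rank at most `|ρ|`. -/
def rankIdeal (k : Type*) [Field k] (ι : W × V → σ) (ρ : Type*) [Fintype ρ] :
    Ideal (MvPolynomial σ k) :=
  RingHom.ker (aeval (productPoint k ι ρ))

variable (ι : W × V → σ) (ρ : Type*) [Fintype ρ]

instance : (rankIdeal k ι ρ).IsPrime := RingHom.ker_isPrime _

variable {ι}

theorem variableMatrix_map_productPoint (hι : ι.Injective) :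
    (variableMatrix k ι).map (aeval (productPoint k ι ρ)) =
      (Matrix.of fun i l => X (Sum.inl (i, l)) :
        Matrix W ρ (MvPolynomial ((W × ρ) ⊕ (ρ × V) ⊕ σ) k)) *
      (Matrix.of fun l j => X (Sum.inr (Sum.inl (l, j))) :
        Matrix ρ V (MvPolynomial ((W × ρ) ⊕ (ρ × V) ⊕ σ) k)) := by
  ext1 i j
  rw [Matrix.mul_apply]
  simp [variableMatrix, productPoint, hι.extend_apply]

variable {ρ}

/-- Universality of `productPoint`: a ring map under which the matrix of variables factors through
`ρ` is a specialization of the universal product. -/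
theorem eval₂Hom_productPoint (hι : ι.Injective) {A : Type*} [CommRing A]
    (g : MvPolynomial σ k →+* A) (P : Matrix W ρ A) (Q : Matrix ρ V A)
    (h : (variableMatrix k ι).map g = P * Q) (f : MvPolynomial σ k) :
    eval₂Hom (g.comp C) (Sum.elim (fun il => P il.1 il.2) (Sum.elim (fun lj => Q lj.1 lj.2)
      fun s => g (X s))) (aeval (productPoint k ι ρ) f) = g f := by
  induction f using MvPolynomial.induction_on with
  | C a => simp
  | add p q hp hq => rw [map_add, map_add, hp, hq, map_add]
  | mul_X p s hp =>
    rw [map_mul, map_mul, hp, map_mul, aeval_X]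
    congr 1
    by_cases hs : ∃ ij, ι ij = s
    · obtain ⟨ij, rfl⟩ := hs
      have := congrFun₂ h ij.1 ij.2
      rw [Matrix.mul_apply] at this
      simp only [Matrix.map_apply, variableMatrix, Matrix.of_apply] at this
      rw [this, productPoint, hι.extend_apply, map_sum]
      simp
    · rw [productPoint, Function.extend_apply' _ _ _ hs]
      simp

theorem rankIdeal_le_ker (hι : ι.Injective) {A : Type*} [CommRing A]
    (g : MvPolynomial σ k →+* A) (P : Matrix W ρ A) (Q : Matrix ρ V A)
    (h : (variableMatrix k ι).map g = P * Q) : rankIdeal k ι ρ ≤ RingHom.ker g := by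
  intro f hf
  have h0 : aeval (productPoint k ι ρ) f = 0 := hf
  rw [RingHom.mem_ker, ← eval₂Hom_productPoint hι g P Q h, h0, map_zero]

/-- A matrix of small rank factors, hence is a specialization of the universal product. Conversely,
all minors of size `|ρ| + 1` vanish on the universal product, as one sees over the fraction field,
so they lie in `rankIdeal` and must vanish at the point. -/
theorem rankIdeal_le_ker_iff [Fintype W] [Fintype V] (hι : ι.Injective) {F : Type*} [Field F]
    (g : MvPolynomial σ k →+* F) :
    rankIdeal k ι ρ ≤ RingHom.ker g ↔ ((variableMatrix k ι).map g).rank ≤ Fintype.card ρ := by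
  constructor
  · intro h
    by_contra! hr
    obtain ⟨e, f, hd⟩ := ((variableMatrix k ι).map g).exists_submatrix_det_ne_zero hr
    rw [Matrix.submatrix_map, ← RingHom.mapMatrix_apply, ← RingHom.map_det] at hd
    refine hd (h ?_)
    let H := MvPolynomial ((W × ρ) ⊕ (ρ × V) ⊕ σ) k
    have hinj := IsFractionRing.injective H (FractionRing H)
    rw [rankIdeal, RingHom.mem_ker]
    by_contra h0
    set φ : MvPolynomial σ k →+* FractionRing H :=
      (algebraMap H (FractionRing H)).comp (aeval (productPoint k ι ρ) : _ →ₐ[k] H).toRingHom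
    have h1 : φ ((variableMatrix k ι).submatrix e f).det ≠ 0 := fun h => h0 (hinj (by
      rw [map_zero]; exact h))
    rw [RingHom.map_det, RingHom.mapMatrix_apply, ← Matrix.submatrix_map] at h1
    have h2 := Matrix.le_rank_of_submatrix_det_ne_zero _ _ _ h1
    have h3 : (variableMatrix k ι).map φ = ((variableMatrix k ι).map
        (aeval (productPoint k ι ρ))).map (algebraMap H (FractionRing H)) := by
      rw [Matrix.map_map]; rfl
    rw [h3, variableMatrix_map_productPoint ρ hι, Matrix.map_mul, Fintype.card_fin] at h2
    exact absurd (h2.trans (Matrix.rank_mul_le_card _ _)) (by simp)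
  · intro h
    obtain ⟨P, Q, hPQ⟩ := Matrix.exists_eq_mul_of_rank_le _ h
    exact rankIdeal_le_ker hι g P Q hPQ

/-- Each rational choice of the two factors gives a rational matrix of rank at most `|ρ|`, and over
an infinite field a polynomial in the entries of the factors that vanishes at all rational points is
zero. -/
theorem mem_rankIdeal_of_forall_eval [Fintype W] [Fintype V] [Infinite k] (hι : ι.Injective)
    (f : MvPolynomial σ k)
    (h : ∀ x : σ → k, ((variableMatrix k ι).map (eval x)).rank ≤ Fintype.card ρ → eval x f = 0) :
    f ∈ rankIdeal k ι ρ := by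
  refine MvPolynomial.funext fun z => ?_
  rw [map_zero]
  have h1 : ∀ f, eval z (aeval (productPoint k ι ρ) f) =
      eval (fun s => eval z (productPoint k ι ρ s)) f := by
    intro f
    have := RingHom.congr_fun (MvPolynomial.ringHom_ext (f := (eval z).comp
      (aeval (productPoint k ι ρ) : MvPolynomial σ k →ₐ[k] _).toRingHom)
      (g := eval (fun s => eval z (productPoint k ι ρ s))) (by simp) (by simp)) f
    exact this
  change eval z (aeval (productPoint k ι ρ) f) = 0
  rw [h1]
  apply h
  have h2 : (variableMatrix k ι).map (eval (fun s => eval z (productPoint k ι ρ s))) =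
      ((variableMatrix k ι).map (aeval (productPoint k ι ρ))).map (eval z) := by
    ext i j
    exact (h1 _).symm
  rw [h2, variableMatrix_map_productPoint ρ hι, Matrix.map_mul]
  exact Matrix.rank_mul_le_card _ _

end Rank
end MvPolynomial

end

/-! ### Height of the rank ideal, by solving the Schur equations. -/

noncomputable section
open MvPolynomial

namespace MvPolynomial

theorem exists_eval_variableMatrix {k σ W V : Type*} [Field k] {ι : W × V → σ} (hι : ι.Injective)
    (N : Matrix W V k) : ∃ x : σ → k, (variableMatrix k ι).map (eval x) = N := by
  refine ⟨Function.extend ι (fun ij => N ij.1 ij.2) 0, ?_⟩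
  ext i j
  simp [variableMatrix, hι.extend_apply]

section Height

variable {k σ ρ w v : Type*} [Field k] [Fintype ρ] [DecidableEq ρ]
variable (ι : (ρ ⊕ w) × (ρ ⊕ v) → σ)

/-- The determinant of the upper left block of the matrix of variables. -/
def pivotDet (k : Type*) [Field k] (ι : (ρ ⊕ w) × (ρ ⊕ v) → σ) : MvPolynomial σ k :=
  (variableMatrix k ι).toBlocks₁₁.det

variable {ι}

theorem map_pivotDet {A : Type*} [CommRing A] (g : MvPolynomial σ k →+* A) :
    g (pivotDet k ι) = ((variableMatrix k ι).map g).toBlocks₁₁.det := by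
  rw [pivotDet, RingHom.map_det]
  rfl

theorem pivotDet_ne_zero (hι : ι.Injective) : pivotDet k ι ≠ 0 := by
  intro h
  obtain ⟨x, hx⟩ := exists_eval_variableMatrix hι (Matrix.fromBlocks 1 0 0 0 : Matrix _ _ k)
  have := map_pivotDet (ι := ι) (eval x)
  rw [hx, h] at this
  simp at this

theorem pivotDet_notMem_rankIdeal (hι : ι.Injective) : pivotDet k ι ∉ rankIdeal k ι ρ := by
  intro h
  obtain ⟨x, hx⟩ := exists_eval_variableMatrix hι (Matrix.fromBlocks 1 0 0 0 : Matrix _ _ k)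
  have h1 : (variableMatrix k ι).map (eval x) =
      Matrix.fromRows (1 : Matrix ρ ρ k) 0 * Matrix.fromCols (1 : Matrix ρ ρ k) 0 := by
    rw [hx, Matrix.fromRows_mul_fromCols]
    simp
  have h2 := rankIdeal_le_ker hι (eval x) _ _ h1 h
  rw [RingHom.mem_ker, map_pivotDet, hx] at h2
  simp at h2

/-- The point with coordinates in the localization at `pivotDet` that has the entries of the lower
right block in the positions `T` replaced by those which make the matrix have rank `|ρ|`. -/
def schurPoint (k : Type*) [Field k] (ι : (ρ ⊕ w) × (ρ ⊕ v) → σ) (T : Set (w × v)) :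
    σ → Localization.Away (pivotDet k ι) := by
  classical
  exact fun s => if h : ∃ ij ∈ T, ι (.inr ij.1, .inr ij.2) = s then
    algebraMap (MvPolynomial σ k) (Localization.Away (pivotDet k ι)) (X s) -
      IsLocalization.Away.invSelf (pivotDet k ι) *
      algebraMap (MvPolynomial σ k) (Localization.Away (pivotDet k ι))
        ((variableMatrix k ι).schurDefect h.choose.1 h.choose.2)
  else algebraMap (MvPolynomial σ k) (Localization.Away (pivotDet k ι)) (X s)

theorem schurPoint_of_mem (hι : ι.Injective) {T : Set (w × v)} {i : w} {j : v} (h : (i, j) ∈ T) :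
    schurPoint k ι T (ι (.inr i, .inr j)) =
      algebraMap (MvPolynomial σ k) (Localization.Away (pivotDet k ι)) (X (ι (.inr i, .inr j))) -
        IsLocalization.Away.invSelf (pivotDet k ι) *
        algebraMap (MvPolynomial σ k) (Localization.Away (pivotDet k ι)) ((variableMatrix k ι).schurDefect i j) := by
  have h1 : ∃ ij ∈ T, ι (.inr ij.1, .inr ij.2) = ι (.inr i, .inr j) := ⟨(i, j), h, rfl⟩
  have h2 := hι h1.choose_spec.2
  simp only [Prod.mk.injEq, Sum.inr.injEq] at h2
  rw [schurPoint, dif_pos h1, h2.1, h2.2]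

theorem schurPoint_of_notMem {T : Set (w × v)} {s : σ}
    (h : ¬ ∃ ij ∈ T, ι (.inr ij.1, .inr ij.2) = s) :
    schurPoint k ι T s = algebraMap (MvPolynomial σ k) (Localization.Away (pivotDet k ι)) (X s) := by
  rw [schurPoint, dif_neg h]

/-- The ideal of the polynomials that vanish at `schurPoint`. -/
def schurIdeal (k : Type*) [Field k] (ι : (ρ ⊕ w) × (ρ ⊕ v) → σ) (T : Set (w × v)) :
    Ideal (MvPolynomial σ k) :=
  RingHom.ker (aeval (schurPoint k ι T))

theorem schurIdeal_isPrime (hι : ι.Injective) (T : Set (w × v)) : (schurIdeal k ι T).IsPrime := by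
  have : IsDomain (Localization.Away (pivotDet k ι)) :=
    IsLocalization.isDomain_localization
      (powers_le_nonZeroDivisors_of_noZeroDivisors (pivotDet_ne_zero hι))
  exact RingHom.ker_isPrime _

/-- `schurPoint` is generic for the conditions that the pivot is invertible and the defects in `T`
vanish: where these hold, the corrections to the entries in `T` are zero and `g` factors through
`schurPoint`. -/
theorem schurIdeal_le_ker (hι : ι.Injective) (T : Set (w × v)) {A : Type*} [CommRing A]
    (g : MvPolynomial σ k →+* A) (hg : IsUnit (g (pivotDet k ι)))
    (h : ∀ i j, (i, j) ∈ T → g ((variableMatrix k ι).schurDefect i j) = 0) :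
    schurIdeal k ι T ≤ RingHom.ker g := by
  let ψ : Localization.Away (pivotDet k ι) →+* A := IsLocalization.Away.lift (pivotDet k ι) hg
  have hψ : ∀ f, ψ (algebraMap _ _ f) = g f := IsLocalization.Away.lift_eq _ hg
  have key : ψ.comp (aeval (schurPoint k ι T) : _ →ₐ[k] _).toRingHom = g := by
    refine MvPolynomial.ringHom_ext (fun a => ?_) fun s => ?_
    · rw [← hψ]
      simp only [AlgHom.toRingHom_eq_coe, RingHom.coe_comp, RingHom.coe_coe, Function.comp_apply,
        algHom_C]
      rw [IsScalarTower.algebraMap_apply k (MvPolynomial σ k)]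
      rfl
    · simp only [AlgHom.toRingHom_eq_coe, RingHom.coe_comp, RingHom.coe_coe, Function.comp_apply,
        aeval_X]
      by_cases hs : ∃ ij ∈ T, ι (.inr ij.1, .inr ij.2) = s
      · obtain ⟨⟨i, j⟩, hij, rfl⟩ := hs
        rw [schurPoint_of_mem hι hij, map_sub, map_mul, hψ, hψ, h i j hij, mul_zero, sub_zero]
      · rw [schurPoint_of_notMem hs, hψ]
  intro f hf
  have h0 : aeval (schurPoint k ι T) f = 0 := hf
  rw [RingHom.mem_ker, ← key]
  simp [h0]

theorem aeval_schurPoint_eq (hι : ι.Injective) (T : Set (w × v)) (i : ρ ⊕ w) (j : ρ ⊕ v)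
    (h : ∀ i' j', (i', j') ∈ T → ¬ (i = .inr i' ∧ j = .inr j')) :
    aeval (schurPoint k ι T) (variableMatrix k ι i j) =
      algebraMap _ (Localization.Away (pivotDet k ι)) (variableMatrix k ι i j) := by
  simp only [variableMatrix, Matrix.of_apply, aeval_X]
  apply schurPoint_of_notMem
  rintro ⟨⟨i', j'⟩, hT, he⟩
  have := hι he
  simp only [Prod.mk.injEq] at this
  exact h i' j' hT ⟨this.1.symm, this.2.symm⟩

theorem aeval_schurPoint_pivotDet (hι : ι.Injective) (T : Set (w × v)) :
    aeval (schurPoint k ι T) (pivotDet k ι) =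
      algebraMap _ (Localization.Away (pivotDet k ι)) (pivotDet k ι) := by
  have := map_pivotDet (ι := ι) (aeval (schurPoint k ι T) : _ →ₐ[k] _).toRingHom
  refine this.trans ?_
  rw [map_pivotDet]
  congr 1
  ext i j
  exact aeval_schurPoint_eq hι T _ _ (by simp)

/-- The defect at `(i, j)` is affine in the lower right entry with the pivot as coefficient, and it
involves no other entry of that block. Subtracting the defect divided by the pivot therefore makes
it vanish. -/
theorem schurDefect_mem_schurIdeal (hι : ι.Injective) {T : Set (w × v)} {i : w} {j : v}
    (h : (i, j) ∈ T) : (variableMatrix k ι).schurDefect i j ∈ schurIdeal k ι T := by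
  set φ := (aeval (schurPoint k ι T) : MvPolynomial σ k →ₐ[k] _).toRingHom with hφ
  set α := algebraMap (MvPolynomial σ k) (Localization.Away (pivotDet k ι)) with hα
  change φ _ = 0
  have h0 : φ ((variableMatrix k ι).schurDefect i j) =
      ((variableMatrix k ι).map φ).schurDefect i j := by
    rw [Matrix.schurDefect_map]; rfl
  have h0' : α ((variableMatrix k ι).schurDefect i j) =
      ((variableMatrix k ι).map α).schurDefect i j := by
    rw [Matrix.schurDefect_map]; rfl
  have h11 : ((variableMatrix k ι).map φ).toBlocks₁₁ = ((variableMatrix k ι).map α).toBlocks₁₁ := by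
    ext a b
    exact aeval_schurPoint_eq hι T _ _ (by simp)
  have h12 : ((variableMatrix k ι).map φ).toBlocks₁₂ = ((variableMatrix k ι).map α).toBlocks₁₂ := by
    ext a b
    exact aeval_schurPoint_eq hι T _ _ (by simp)
  have h21 : ((variableMatrix k ι).map φ).toBlocks₂₁ = ((variableMatrix k ι).map α).toBlocks₂₁ := by
    ext a b
    exact aeval_schurPoint_eq hι T _ _ (by simp)
  have h22 : ((variableMatrix k ι).map φ).toBlocks₂₂ i j = ((variableMatrix k ι).map α).toBlocks₂₂ i j
      - IsLocalization.Away.invSelf (pivotDet k ι) * α ((variableMatrix k ι).schurDefect i j) := by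
    change φ (X (ι (.inr i, .inr j))) = _
    rw [hφ]
    simp only [AlgHom.toRingHom_eq_coe, RingHom.coe_coe, aeval_X]
    rw [schurPoint_of_mem hι h]
    rfl
  have hd : ((variableMatrix k ι).map α).toBlocks₁₁.det *
      IsLocalization.Away.invSelf (pivotDet k ι) = 1 := by
    rw [← map_pivotDet]
    exact IsLocalization.Away.mul_invSelf _
  rw [h0, Matrix.schurDefect, h11, h12, h21, Matrix.sub_apply, Matrix.smul_apply, h22, smul_sub,
    smul_eq_mul, smul_eq_mul, ← mul_assoc, hd, one_mul, h0', Matrix.schurDefect, Matrix.sub_apply,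
    Matrix.smul_apply, smul_eq_mul]
  ring

theorem schurIdeal_mono (hι : ι.Injective) {T T' : Set (w × v)} (h : T ⊆ T') :
    schurIdeal k ι T ≤ schurIdeal k ι T' := by
  refine schurIdeal_le_ker hι T (aeval (schurPoint k ι T') : _ →ₐ[k] _).toRingHom ?_
    fun i j hij => schurDefect_mem_schurIdeal hι (h hij)
  change IsUnit (aeval (schurPoint k ι T') (pivotDet k ι))
  rw [aeval_schurPoint_pivotDet hι]
  exact IsLocalization.Away.algebraMap_isUnit _

/-- A separating point: the identity as pivot block and a single further entry `1`, at `(i, j)`.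
There the defect matrix is the lower right block itself. -/
theorem schurDefect_notMem_schurIdeal [DecidableEq w] [DecidableEq v] (hι : ι.Injective)
    {T : Set (w × v)} {i : w} {j : v} (h : (i, j) ∉ T) :
    (variableMatrix k ι).schurDefect i j ∉ schurIdeal k ι T := by
  obtain ⟨x, hx⟩ := exists_eval_variableMatrix hι
    (Matrix.fromBlocks 1 0 0 (Matrix.single i j 1) : Matrix _ _ k)
  have h0 : ∀ i' j', eval x ((variableMatrix k ι).schurDefect i' j') =
      Matrix.single i j (1 : k) i' j' := by
    intro i' j'
    have : eval x ((variableMatrix k ι).schurDefect i' j') =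
      ((variableMatrix k ι).map (eval x)).schurDefect i' j' := by
      rw [Matrix.schurDefect_map]; rfl
    rw [this, hx]
    simp [Matrix.schurDefect]
  intro hmem
  have h1 := schurIdeal_le_ker hι T (eval x) (by rw [map_pivotDet, hx]; simp) (by
    intro i' j' hij
    rw [h0]
    apply Matrix.single_apply_of_ne
    rintro ⟨rfl, rfl⟩
    exact h hij) hmem
  rw [RingHom.mem_ker, h0] at h1
  simp at h1

/-- Imposing one more Schur equation gives a strictly larger prime, so the height grows by at least
one at each step. -/
theorem card_le_height_schurIdeal (hι : ι.Injective) (T : Finset (w × v)) :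
    (T.card : ℕ∞) ≤ (schurIdeal k ι T).height := by
  classical
  induction T using Finset.induction_on with
  | empty => simp
  | insert a T ha ih =>
    have := schurIdeal_isPrime (k := k) hι (T : Set (w × v))
    have := schurIdeal_isPrime (k := k) hι ((insert a T : Finset _) : Set (w × v))
    have hlt : schurIdeal k ι (T : Set (w × v)) < schurIdeal k ι ((insert a T : Finset _)) := by
      refine lt_of_le_of_ne (schurIdeal_mono hι (by simp)) fun he => ?_
      refine schurDefect_notMem_schurIdeal (k := k) hι (T := T) (i := a.1) (j := a.2)
        (by simpa using ha) ?_
      rw [he]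
      exact schurDefect_mem_schurIdeal hι (by simp)
    rw [Finset.card_insert_of_notMem ha, Nat.cast_add, Nat.cast_one]
    exact (add_le_add_left ih 1).trans (Ideal.height_add_one_le_of_lt_of_isPrime hlt)

/-- Two generic points of the same locus: with all defects zero the matrix of `schurPoint` factors
through `ρ`, while the universal product has zero defects and a pivot that is invertible in the
fraction field. -/
theorem rankIdeal_eq_schurIdeal (hι : ι.Injective) :
    rankIdeal k ι ρ = schurIdeal k ι Set.univ := by
  apply le_antisymm
  · set φ := (aeval (schurPoint k ι Set.univ) : MvPolynomial σ k →ₐ[k] _).toRingHom with hφ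
    obtain ⟨P, Q, h⟩ := Matrix.exists_eq_mul_of_schurDefect_eq_zero ((variableMatrix k ι).map φ)
      (by
        rw [← map_pivotDet]
        change IsUnit (aeval (schurPoint k ι Set.univ) (pivotDet k ι))
        rw [aeval_schurPoint_pivotDet hι]
        exact IsLocalization.Away.algebraMap_isUnit _)
      (by
        rw [Matrix.schurDefect_map]
        ext i j
        exact schurDefect_mem_schurIdeal hι (Set.mem_univ (i, j)))
    exact rankIdeal_le_ker hι φ P Q h
  · let H := MvPolynomial (((ρ ⊕ w) × ρ) ⊕ (ρ × (ρ ⊕ v)) ⊕ σ) k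
    have hinj := IsFractionRing.injective H (FractionRing H)
    have h2 := schurIdeal_le_ker (k := k) hι Set.univ ((algebraMap H (FractionRing H)).comp
      (aeval (productPoint k ι ρ) : _ →ₐ[k] H).toRingHom) (by
        rw [isUnit_iff_ne_zero]
        intro h
        refine pivotDet_notMem_rankIdeal (k := k) hι (hinj ?_)
        rw [map_zero]
        exact h) (by
        intro i j _
        change algebraMap H (FractionRing H) (aeval (productPoint k ι ρ) _) = 0
        have : aeval (productPoint k ι ρ) ((variableMatrix k ι).schurDefect i j) =
            ((variableMatrix k ι).map (aeval (productPoint k ι ρ) : _ →ₐ[k] H)).schurDefect i j :=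
          (congrFun₂ (Matrix.schurDefect_map (variableMatrix k ι)
            (aeval (productPoint k ι ρ) : _ →ₐ[k] H).toRingHom) i j).symm
        rw [this, variableMatrix_map_productPoint ρ hι, Matrix.schurDefect_mul]
        simp)
    refine h2.trans fun f hf => hinj ?_
    rw [map_zero]
    exact hf

/-- A prime contained in `rankIdeal` omits the pivot. If it also contains the defects, its residue
field satisfies the conditions for which `schurPoint` is generic, so it contains `rankIdeal`.
Krull's theorem then bounds the height by the number of defects. -/
theorem rankIdeal_mem_minimalPrimes (hι : ι.Injective) : rankIdeal k ι ρ ∈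
    (Ideal.span (Set.range fun ij : w × v =>
      (variableMatrix k ι).schurDefect ij.1 ij.2)).minimalPrimes := by
  refine ⟨⟨inferInstance, ?_⟩, ?_⟩
  · rw [Ideal.span_le, rankIdeal_eq_schurIdeal hι]
    rintro _ ⟨ij, rfl⟩
    exact schurDefect_mem_schurIdeal hι (Set.mem_univ ij)
  · rintro Q ⟨hQ, hsQ⟩ hle
    have h0 : ∀ i j, (variableMatrix k ι).schurDefect i j ∈ Q := fun i j =>
      hsQ (Ideal.subset_span (Set.mem_range_self (i, j)))
    have h1 := schurIdeal_le_ker (k := k) hι Set.univ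
      (algebraMap (MvPolynomial σ k) Q.ResidueField) (by
        rw [isUnit_iff_ne_zero, Ne, Ideal.algebraMap_residueField_eq_zero]
        exact fun h => pivotDet_notMem_rankIdeal hι (hle h))
      fun i j _ => Ideal.algebraMap_residueField_eq_zero.2 (h0 i j)
    rw [rankIdeal_eq_schurIdeal hι]
    exact fun f hf => Ideal.algebraMap_residueField_eq_zero.1 (h1 hf)

theorem height_rankIdeal_sum [Finite σ] [Fintype w] [Fintype v] (hι : ι.Injective) :
    (rankIdeal k ι ρ).height = (Fintype.card w * Fintype.card v : ℕ) := by
  apply le_antisymm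
  · refine (Ideal.height_le_card_of_mem_minimalPrimes_span (Set.finite_range _)
      (rankIdeal_mem_minimalPrimes hι)).trans ?_
    rw [← Fintype.card_prod, ← Nat.card_eq_fintype_card, ← Set.ncard_univ, ← Set.image_univ]
    exact_mod_cast Set.ncard_image_le Set.finite_univ
  · rw [rankIdeal_eq_schurIdeal hι, ← Fintype.card_prod, ← Finset.card_univ, ← Finset.coe_univ]
    exact card_le_height_schurIdeal hι Finset.univ

end Height

/-! ### Rank loci in the spectrum and among rational points. -/

section Strata

variable {k σ W V : Type*} [Field k] [Fintype W] [Fintype V] {ι : W × V → σ} {r : ℕ}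

theorem exists_equiv_fin_sum (W : Type*) [Fintype W] {r : ℕ} (h : r ≤ Fintype.card W) :
    Nonempty (Fin r ⊕ Fin (Fintype.card W - r) ≃ W) :=
  ⟨Fintype.equivOfCardEq (by simp; omega)⟩

/-- Rank is unchanged by reindexing, so the two ideals lie in the same kernels of maps to fields;
testing on the residue fields of the two primes gives equality. -/
theorem rankIdeal_comp_equiv {W' V' : Type*} [Fintype W'] [Fintype V'] (hι : ι.Injective)
    (e : W' ≃ W) (f : V' ≃ V) (ρ : Type*) [Fintype ρ] :
    rankIdeal k (ι ∘ Prod.map e f) ρ = rankIdeal k ι ρ := by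
  have hι' : (ι ∘ Prod.map e f).Injective :=
    hι.comp (e.injective.prodMap f.injective)
  have key : ∀ {F : Type _} [Field F] (g : MvPolynomial σ k →+* F),
      rankIdeal k (ι ∘ Prod.map e f) ρ ≤ RingHom.ker g ↔ rankIdeal k ι ρ ≤ RingHom.ker g := by
    intro F _ g
    rw [rankIdeal_le_ker_iff hι', rankIdeal_le_ker_iff hι,
      ← Matrix.rank_submatrix ((variableMatrix k ι).map g) e f]
    rfl
  have hker : ∀ (P : Ideal (MvPolynomial σ k)) [P.IsPrime],
      RingHom.ker (algebraMap (MvPolynomial σ k) P.ResidueField) = P := fun P _ =>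
    Ideal.ext fun f => Ideal.algebraMap_residueField_eq_zero
  apply le_antisymm
  · have := (key (algebraMap (MvPolynomial σ k) (rankIdeal k ι ρ).ResidueField)).2
    rw [hker] at this
    exact this le_rfl
  · have := (key (algebraMap (MvPolynomial σ k)
      (rankIdeal k (ι ∘ Prod.map e f) ρ).ResidueField)).1
    rw [hker] at this
    exact this le_rfl

theorem height_rankIdeal [Finite σ] (hι : ι.Injective) (hW : r ≤ Fintype.card W)
    (hV : r ≤ Fintype.card V) :
    (rankIdeal k ι (Fin r)).height = ((Fintype.card W - r) * (Fintype.card V - r) : ℕ) := by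
  obtain ⟨e⟩ := exists_equiv_fin_sum W hW
  obtain ⟨f⟩ := exists_equiv_fin_sum V hV
  rw [← rankIdeal_comp_equiv hι e f, height_rankIdeal_sum]
  · simp
  · exact hι.comp (e.injective.prodMap f.injective)

/-- A single `r × r` minor cuts out a nonempty open part of the locus on which the rank is exactly
`r`. -/
theorem exists_notMem_rankIdeal_le_rank (hι : ι.Injective) (hW : r ≤ Fintype.card W)
    (hV : r ≤ Fintype.card V) : ∃ δ ∉ rankIdeal k ι (Fin r), ∀ {F : Type*} [Field F]
      (g : MvPolynomial σ k →+* F), g δ ≠ 0 → r ≤ ((variableMatrix k ι).map g).rank := by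
  obtain ⟨e⟩ := exists_equiv_fin_sum W hW
  obtain ⟨f⟩ := exists_equiv_fin_sum V hV
  refine ⟨pivotDet k (ι ∘ Prod.map e f), ?_, fun g hg => ?_⟩
  · rw [← rankIdeal_comp_equiv hι e f]
    exact pivotDet_notMem_rankIdeal (hι.comp (e.injective.prodMap f.injective))
  · rw [map_pivotDet] at hg
    simpa using Matrix.le_rank_of_submatrix_det_ne_zero ((variableMatrix k ι).map g)
      (e ∘ Sum.inl) (f ∘ Sum.inl) hg

/-- The points of the affine space where the matrix has rank at most `r`. -/
def specRankLE (k : Type*) [Field k] (ι : W × V → σ) (r : ℕ) :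
    Set (PrimeSpectrum (MvPolynomial σ k)) :=
  {q | ((variableMatrix k ι).map (algebraMap _ q.asIdeal.ResidueField)).rank ≤ r}

/-- The points of the affine space where the matrix has rank `r`. -/
def specRankEQ (k : Type*) [Field k] (ι : W × V → σ) (r : ℕ) :
    Set (PrimeSpectrum (MvPolynomial σ k)) :=
  {q | ((variableMatrix k ι).map (algebraMap _ q.asIdeal.ResidueField)).rank = r}

theorem specRankLE_eq_zeroLocus (hι : ι.Injective) :
    specRankLE k ι r = PrimeSpectrum.zeroLocus (rankIdeal k ι (Fin r)) := by
  ext q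
  have h := rankIdeal_le_ker_iff (ρ := Fin r) hι (algebraMap (MvPolynomial σ k) q.asIdeal.ResidueField)
  rw [Fintype.card_fin] at h
  rw [specRankLE, Set.mem_ofPred_eq, ← h]
  exact ⟨fun h f hf => Ideal.algebraMap_residueField_eq_zero.1 (h hf),
    fun h f hf => Ideal.algebraMap_residueField_eq_zero.2 (h hf)⟩

theorem vanishingIdeal_specRankLE (hι : ι.Injective) :
    PrimeSpectrum.vanishingIdeal (specRankLE k ι r) = rankIdeal k ι (Fin r) := by
  rw [specRankLE_eq_zeroLocus hι, PrimeSpectrum.vanishingIdeal_zeroLocus_eq_radical]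
  exact Ideal.IsPrime.radical inferInstance

theorem isIrreducible_specRankLE (hι : ι.Injective) : IsIrreducible (specRankLE k ι r) := by
  rw [PrimeSpectrum.isIrreducible_iff_vanishingIdeal_isPrime, vanishingIdeal_specRankLE hι]
  infer_instance

theorem genericPoint_mem_specRankEQ (hι : ι.Injective) (hW : r ≤ Fintype.card W)
    (hV : r ≤ Fintype.card V) :
    (⟨rankIdeal k ι (Fin r), inferInstance⟩ : PrimeSpectrum _) ∈ specRankEQ k ι r := by
  have h1 : (⟨rankIdeal k ι (Fin r), inferInstance⟩ : PrimeSpectrum _) ∈ specRankLE k ι r := by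
    rw [specRankLE_eq_zeroLocus hι]
    exact (PrimeSpectrum.mem_zeroLocus _ _).2 subset_rfl
  obtain ⟨δ, hδ, h⟩ := exists_notMem_rankIdeal_le_rank (k := k) hι hW hV
  exact le_antisymm h1 (h _ fun h0 => hδ (Ideal.algebraMap_residueField_eq_zero.1 h0))

theorem closure_specRankEQ (hι : ι.Injective) (hW : r ≤ Fintype.card W)
    (hV : r ≤ Fintype.card V) : closure (specRankEQ k ι r) = specRankLE k ι r := by
  apply subset_antisymm
  · refine closure_minimal (fun q (hq : Matrix.rank _ = r) => hq.le) ?_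
    rw [specRankLE_eq_zeroLocus hι]
    exact PrimeSpectrum.isClosed_zeroLocus _
  · refine Eq.trans_subset ?_ (closure_mono (Set.singleton_subset_iff.2
      (genericPoint_mem_specRankEQ hι hW hV)))
    rw [PrimeSpectrum.closure_singleton, specRankLE_eq_zeroLocus hι]

/-- The rational points where the matrix has rank at most `r`. -/
def pointRankLE (k : Type*) [Field k] (ι : W × V → σ) (r : ℕ) : Set (σ → k) :=
  {x | ((variableMatrix k ι).map (eval x)).rank ≤ r}

/-- The rational points where the matrix has rank `r`. -/
def pointRankEQ (k : Type*) [Field k] (ι : W × V → σ) (r : ℕ) : Set (σ → k) :=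
  {x | ((variableMatrix k ι).map (eval x)).rank = r}

theorem pointRankLE_eq_zeroLocus (hι : ι.Injective) :
    pointRankLE k ι r = zeroLocus k (rankIdeal k ι (Fin r)) := by
  ext x
  have h := rankIdeal_le_ker_iff (ρ := Fin r) hι (eval x)
  rw [Fintype.card_fin] at h
  rw [pointRankLE, Set.mem_ofPred_eq, ← h]
  exact ⟨fun h f hf => h hf, fun h f hf => h f hf⟩

theorem vanishingIdeal_pointRankLE [Infinite k] (hι : ι.Injective) :
    vanishingIdeal k (pointRankLE k ι r) = rankIdeal k ι (Fin r) := by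
  apply le_antisymm
  · intro f hf
    refine mem_rankIdeal_of_forall_eval hι f fun x hx => hf x ?_
    simpa [pointRankLE] using hx
  · rw [pointRankLE_eq_zeroLocus hι]
    exact le_vanishingIdeal_zeroLocus _

/-- If `f` vanishes where the rank is `r`, then `f * δ` vanishes where it is at most `r`, because a
point with `δ ≠ 0` has rank at least `r`. Primality removes `δ`. -/
theorem vanishingIdeal_pointRankEQ [Infinite k] (hι : ι.Injective) (hW : r ≤ Fintype.card W)
    (hV : r ≤ Fintype.card V) :
    vanishingIdeal k (pointRankEQ k ι r) = rankIdeal k ι (Fin r) := by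
  apply le_antisymm
  · intro f hf
    obtain ⟨δ, hδ, h⟩ := exists_notMem_rankIdeal_le_rank (k := k) hι hW hV
    have h1 : f * δ ∈ rankIdeal k ι (Fin r) := by
      rw [← vanishingIdeal_pointRankLE hι]
      intro x hx
      rw [map_mul]
      by_cases h0 : aeval x δ = 0
      · rw [h0, mul_zero]
      · have := hf x (le_antisymm hx (h (eval x) h0))
        rw [this, zero_mul]
    exact (Ideal.IsPrime.mem_or_mem inferInstance h1).resolve_right hδ
  · rw [← vanishingIdeal_pointRankLE hι]
    exact vanishingIdeal_anti_mono fun x hx => le_of_eq hx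

theorem isIrreducible_zariskiTopology_of_isPrime {Y : Set (σ → k)}
    (h : (vanishingIdeal k Y).IsPrime) : @IsIrreducible _ (zariskiTopology k σ) Y := by
  let _ := zariskiTopology k σ
  have hi : Topology.IsInducing (pointToPoint (k := k) : (σ → k) → _) := ⟨rfl⟩
  rw [← vanishingIdeal_pointToPoint, ← PrimeSpectrum.isIrreducible_iff_vanishingIdeal_isPrime] at h
  refine ⟨Set.image_nonempty.1 h.1, fun s t hs ht hYs hYt => ?_⟩
  obtain ⟨s', hs', rfl⟩ := hi.isOpen_iff.1 hs
  obtain ⟨t', ht', rfl⟩ := hi.isOpen_iff.1 ht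
  obtain ⟨_, ⟨x, hx, rfl⟩, hxs, hxt⟩ := h.2 s' t' hs' ht'
    (hYs.elim fun x hx => ⟨_, ⟨x, hx.1, rfl⟩, hx.2⟩)
    (hYt.elim fun x hx => ⟨_, ⟨x, hx.1, rfl⟩, hx.2⟩)
  exact ⟨x, hx, hxs, hxt⟩

theorem closure_zariskiTopology (Y : Set (σ → k)) :
    @closure _ (zariskiTopology k σ) Y = zeroLocus k (vanishingIdeal k Y) := by
  let _ := zariskiTopology k σ
  apply subset_antisymm
  · exact closure_minimal (zeroLocus_vanishingIdeal_le Y)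
      ((isClosed_zariskiTopology_iff _).2 ⟨_, rfl⟩)
  · obtain ⟨I, hI⟩ := (isClosed_zariskiTopology_iff (closure Y)).1 isClosed_closure
    rw [hI]
    refine zeroLocus_anti_mono ((le_zeroLocus_iff_le_vanishingIdeal).1 ?_)
    exact subset_closure.trans hI.subset

end Strata

end MvPolynomial

end

/-! ### Monic sequences with a Hessenberg recursion in one variable. -/

noncomputable section

namespace Polynomial

variable {K : Type*} [Field K]

/-- Division with remainder inside `W`: the degree of each remainder lies in `A`, so the monic
polynomial that removes its leading term is again in `W`. -/
theorem exists_sum_of_degree_lt {W : Submodule K K[X]} {A : Set ℕ} {η : ℕ → K[X]}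
    (hη : ∀ a, (η a).Monic ∧ (η a).natDegree = a)
    (hdeg : ∀ g ∈ W, g ≠ 0 → g.natDegree ∈ A) (n : ℕ) (hmem : ∀ b < n, b ∈ A → η b ∈ W) :
    ∀ g ∈ W, g.degree < n → ∃ c : ℕ → K, (∀ b, c b ≠ 0 → b < n ∧ b ∈ A) ∧
      g = ∑ b ∈ Finset.range n, c b • η b := by
  induction n with
  | zero =>
    intro g hg hd
    refine ⟨0, by simp, ?_⟩
    have : g = 0 := by simpa using hd
    simp [this]
  | succ n ih =>
    intro g hg hd
    by_cases hn : g.degree < n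
    · obtain ⟨c, hc, rfl⟩ := ih (fun b hb => hmem b (hb.trans n.lt_succ_self)) g hg hn
      refine ⟨c, fun b hb => ⟨(hc b hb).1.trans n.lt_succ_self, (hc b hb).2⟩, ?_⟩
      have h0 : c n = 0 := by
        by_contra h
        exact (hc n h).1.false
      rw [Finset.sum_range_succ, h0, zero_smul, add_zero]
    · have hdn : g.degree = n := by
        refine le_antisymm ?_ (not_lt.1 hn)
        rw [degree_lt_iff_coeff_zero] at hd
        rw [degree_le_iff_coeff_zero]
        exact fun m hm => hd m (by exact_mod_cast hm)
      have hnd : g.natDegree = n := natDegree_eq_of_degree_eq_some hdn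
      have hg0 : g ≠ 0 := by
        rintro rfl
        simp at hdn
      have hnA : n ∈ A := hnd ▸ hdeg g hg hg0
      have hηn := hmem n n.lt_succ_self hnA
      have hdeg' : (g - g.leadingCoeff • η n).degree < n := by
        rw [← hdn]
        refine degree_sub_lt_left ?_ hg0 ?_
        · rw [degree_smul_of_smul_regular _
            (IsSMulRegular.of_ne_zero (leadingCoeff_ne_zero.2 hg0)), hdn,
            degree_eq_natDegree (hη n).1.ne_zero, (hη n).2]
        · rw [leadingCoeff_smul_of_smul_regular _
            (IsSMulRegular.of_ne_zero (leadingCoeff_ne_zero.2 hg0)), (hη n).1.leadingCoeff,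
            smul_eq_mul, mul_one]
      obtain ⟨c, hc, he⟩ := ih (fun b hb => hmem b (hb.trans n.lt_succ_self)) _
        (W.sub_mem hg (W.smul_mem g.leadingCoeff hηn)) hdeg'
      have h0 : c n = 0 := by
        by_contra h
        exact (hc n h).1.false
      refine ⟨c + Pi.single n g.leadingCoeff, fun b hb => ?_, ?_⟩
      · by_cases hbn : b = n
        · exact ⟨by omega, hbn ▸ hnA⟩
        · have := hc b (by simpa [hbn] using hb)
          exact ⟨by omega, this.2⟩
      · rw [Finset.sum_range_succ]
        rw [sub_eq_iff_eq_add] at he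
        conv_lhs => rw [he]
        congr 1
        · refine Finset.sum_congr rfl fun b hb => ?_
          have : b ≠ n := (Finset.mem_range.1 hb).ne
          simp [this]
        · simp [h0]

/-- The monic polynomials given by the recursion `η₀ = 1`,
`η_{a+1} = X η_a - ∑_{b ≤ a} P a b η_b`. -/
def hessSeq (P : ℕ → ℕ → K) : ℕ → K[X]
  | 0 => 1
  | a + 1 => X * hessSeq P a - ∑ b : Fin (a + 1), P a b • hessSeq P b

theorem hessSeq_zero (P : ℕ → ℕ → K) : hessSeq P 0 = 1 := by rw [hessSeq]

theorem hessSeq_succ (P : ℕ → ℕ → K) (a : ℕ) : hessSeq P (a + 1) =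
    X * hessSeq P a - ∑ b ∈ Finset.range (a + 1), P a b • hessSeq P b := by
  rw [hessSeq, Finset.sum_range]

theorem X_mul_hessSeq (P : ℕ → ℕ → K) (a : ℕ) : X * hessSeq P a =
    hessSeq P (a + 1) + ∑ b ∈ Finset.range (a + 1), P a b • hessSeq P b := by
  rw [hessSeq_succ, sub_add_cancel]

theorem hessSeq_congr {P P' : ℕ → ℕ → K} {n : ℕ} (h : ∀ a < n, ∀ b ≤ a, P a b = P' a b) :
    ∀ a ≤ n, hessSeq P a = hessSeq P' a := by
  intro a
  induction a using Nat.strong_induction_on with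
  | _ a ih =>
    intro ha
    cases a with
    | zero => rw [hessSeq_zero, hessSeq_zero]
    | succ a =>
      rw [hessSeq_succ, hessSeq_succ, ih a a.lt_succ_self (by omega)]
      congr 1
      refine Finset.sum_congr rfl fun b hb => ?_
      rw [Finset.mem_range] at hb
      rw [h a (by omega) b (by omega), ih b hb (by omega)]

theorem hessSeq_monic_natDegree (P : ℕ → ℕ → K) (a : ℕ) :
    (hessSeq P a).Monic ∧ (hessSeq P a).natDegree = a := by
  induction a using Nat.strong_induction_on with
  | _ a ih =>
    cases a with
    | zero => simp [hessSeq_zero]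
    | succ a =>
      obtain ⟨hm, hd⟩ := ih a a.lt_succ_self
      have h1 : (X * hessSeq P a).Monic := monic_X.mul hm
      have h2 : (X * hessSeq P a).degree = ((a + 1 : ℕ) : WithBot ℕ) := by
        rw [degree_eq_natDegree h1.ne_zero, natDegree_X_mul hm.ne_zero, hd]
      have h3 : (∑ b ∈ Finset.range (a + 1), P a b • hessSeq P b).degree <
          (X * hessSeq P a).degree := by
        rw [h2]
        refine (degree_sum_le _ _).trans_lt ?_
        rw [Finset.sup_lt_iff (by exact WithBot.bot_lt_coe _)]
        intro b hb
        rw [Finset.mem_range] at hb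
        refine (degree_smul_le _ _).trans_lt (degree_le_natDegree.trans_lt ?_)
        rw [(ih b hb).2]
        exact_mod_cast hb
      rw [hessSeq_succ]
      refine ⟨h1.sub_of_left h3, natDegree_eq_of_degree_eq_some ?_⟩
      rw [degree_sub_eq_left_of_degree_lt h3, h2]

theorem hessSeq_monic (P : ℕ → ℕ → K) (a : ℕ) : (hessSeq P a).Monic :=
  (hessSeq_monic_natDegree P a).1

theorem natDegree_hessSeq (P : ℕ → ℕ → K) (a : ℕ) : (hessSeq P a).natDegree = a :=
  (hessSeq_monic_natDegree P a).2

theorem degree_hessSeq (P : ℕ → ℕ → K) (a : ℕ) : (hessSeq P a).degree = a := by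
  rw [degree_eq_natDegree (hessSeq_monic P a).ne_zero, natDegree_hessSeq]

/-- The basis of `K[X]` formed by the polynomials `hessSeq P a`. -/
def hessBasis (P : ℕ → ℕ → K) : Module.Basis ℕ K K[X] :=
  Polynomial.Sequence.basis ⟨hessSeq P, degree_hessSeq P⟩ fun a => by
    change IsUnit (hessSeq P a).leadingCoeff
    rw [(hessSeq_monic P a).leadingCoeff]
    exact isUnit_one

theorem hessBasis_apply (P : ℕ → ℕ → K) (a : ℕ) : hessBasis P a = hessSeq P a :=
  Polynomial.Sequence.basis_eq_self (S := ⟨hessSeq P, degree_hessSeq P⟩) _ a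

theorem hessBasis_repr_hessSeq (P : ℕ → ℕ → K) (a : ℕ) :
    (hessBasis P).repr (hessSeq P a) = Finsupp.single a 1 := by
  rw [← hessBasis_apply, Module.Basis.repr_self]

/-- The span of the polynomials `hessSeq P a` with `δ a ≤ D`. -/
def cellPiece (δ : ℕ → ℕ) (P : ℕ → ℕ → K) (D : ℤ) : Submodule K K[X] :=
  Submodule.span K (hessBasis P '' {a | (δ a : ℤ) ≤ D})

theorem mem_cellPiece_iff {δ : ℕ → ℕ} {P : ℕ → ℕ → K} {D : ℤ} {g : K[X]} :
    g ∈ cellPiece δ P D ↔ ∀ a, (hessBasis P).repr g a ≠ 0 → (δ a : ℤ) ≤ D := by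
  rw [cellPiece, Module.Basis.mem_span_image]
  exact ⟨fun h a ha => h (Finsupp.mem_support_iff.2 ha),
    fun h a ha => h a (Finsupp.mem_support_iff.1 ha)⟩

theorem hessSeq_mem_cellPiece {δ : ℕ → ℕ} (P : ℕ → ℕ → K) {D : ℤ} {a : ℕ} (h : (δ a : ℤ) ≤ D) :
    hessSeq P a ∈ cellPiece δ P D :=
  hessBasis_apply P a ▸ Submodule.subset_span (Set.mem_image_of_mem _ h)

theorem cellPiece_mono (δ : ℕ → ℕ) (P : ℕ → ℕ → K) : Monotone (cellPiece δ P) := fun _ _ h =>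
  Submodule.span_mono (Set.image_mono fun _ ha => le_trans ha h)

/-- The basis is triangular for the degree, so the coordinate of `g` at the index `g.natDegree` is
nonzero. -/
theorem natDegree_of_mem_cellPiece {δ : ℕ → ℕ} {P : ℕ → ℕ → K} {D : ℤ} {g : K[X]}
    (hg : g ∈ cellPiece δ P D) (h0 : g ≠ 0) : (δ g.natDegree : ℤ) ≤ D := by
  refine mem_cellPiece_iff.1 hg _ fun h => ?_
  obtain ⟨c, hc, he⟩ := exists_sum_of_degree_lt (W := ⊤) (A := Set.univ)
    (hessSeq_monic_natDegree P) (by simp) (g.natDegree + 1) (by simp) g trivial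
    (by rw [degree_eq_natDegree h0]; exact_mod_cast Nat.lt_succ_self _)
  have h1 : ∀ a, (hessBasis P).repr g a = c a := by
    intro a
    rw [he, map_sum, Finsupp.finsetSum_apply]
    simp only [map_smul, hessBasis_repr_hessSeq, Finsupp.smul_apply, Finsupp.single_apply,
      smul_eq_mul, mul_ite, mul_one, mul_zero]
    rw [Finset.sum_ite_eq']
    split_ifs with h
    · rfl
    · by_contra h2
      exact h (Finset.mem_range.2 (hc a (Ne.symm h2)).1)
  rw [h1] at h
  rw [Finset.sum_range_succ, h, zero_smul, add_zero] at he
  have h2 : g.degree < g.natDegree := by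
    conv_lhs => rw [he]
    refine (degree_sum_le _ _).trans_lt ?_
    rw [Finset.sup_lt_iff (by exact WithBot.bot_lt_coe _)]
    intro b hb
    refine (degree_smul_le _ _).trans_lt ?_
    rw [degree_hessSeq]
    exact_mod_cast Finset.mem_range.1 hb
  rw [degree_eq_natDegree h0] at h2
  exact h2.false

/-- The conditions on the positions of the nonzero entries of `P`. -/
def IsCellArray (δ : ℕ → ℕ) (t : ℕ) (P : ℕ → ℕ → K) : Prop :=
  ∀ a b, P a b ≠ 0 → b ≤ a ∧ a < t ∧ δ (a + 1) < δ b ∧ δ b ≤ δ a + 1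

/-! ### Normal forms of filtrations with prescribed degrees. -/

section Cell

variable {δ : ℕ → ℕ} {t : ℕ} (hδ : ∀ a, t ≤ a → δ a = a) (hδ' : ∀ a < t, δ (a + 1) ≤ δ a)
include hδ hδ'

theorem le_of_corner (a : ℕ) : a ≤ δ a := by
  by_cases h : t ≤ a
  · exact (hδ a h).ge
  · have : ∀ i, a + i ≤ t → δ (a + i) ≤ δ a := by
      intro i
      induction i with
      | zero => intro; rfl
      | succ i ih => exact fun hi => (hδ' (a + i) (by omega)).trans (ih (by omega))
    have h1 := this (t - a) (by omega)
    rw [show a + (t - a) = t by omega, hδ t le_rfl] at h1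
    omega

theorem corner_succ_le (a : ℕ) : δ (a + 1) ≤ δ a + 1 := by
  by_cases h : a < t
  · exact (hδ' a h).trans (Nat.le_succ _)
  · rw [hδ a (by omega), hδ (a + 1) (by omega)]

/-- This is the role of the bound `δ b ≤ δ a + 1`: every term of `X η_a` has level at most `δ a +
1`. -/
theorem X_mul_mem_cellPiece {P : ℕ → ℕ → K} (hP : IsCellArray δ t P) {D : ℤ} {g : K[X]}
    (hg : g ∈ cellPiece δ P D) : X * g ∈ cellPiece δ P (D + 1) := by
  induction hg using Submodule.span_induction with
  | zero => simp
  | add f g _ _ hf hg => rw [mul_add]; exact add_mem hf hg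
  | smul c g _ hg => rw [mul_smul_comm]; exact Submodule.smul_mem _ _ hg
  | mem g hg =>
    obtain ⟨a, ha, rfl⟩ := hg
    have ha' : (δ a : ℤ) ≤ D := ha
    rw [hessBasis_apply, X_mul_hessSeq]
    refine add_mem (hessSeq_mem_cellPiece P ?_) (Submodule.sum_mem _ fun b _ => ?_)
    · have := corner_succ_le hδ hδ' a
      omega
    · by_cases h0 : P a b = 0
      · rw [h0, zero_smul]; exact zero_mem _
      · refine Submodule.smul_mem _ _ (hessSeq_mem_cellPiece P ?_)
        have := (hP a b h0).2.2.2
        omega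

/-- The array is built one row at a time. For a monic `h` of degree `n + 1` in `W (δ (n+1))`, the
difference `X η_n - h` lies at level `δ n + 1` and expands in `η_0, …, η_n`. Terms of level at most
`δ (n+1)` are moved into `h`; the others form row `n`. Beyond `t` the sequence continues by
multiplication by `X`. -/
theorem exists_cellArray {W : ℤ → Submodule K K[X]} (hmono : Monotone W)
    (hX : ∀ D, ∀ g ∈ W D, X * g ∈ W (D + 1))
    (hdeg : ∀ D, ∀ g ∈ W D, g ≠ 0 → (δ g.natDegree : ℤ) ≤ D)
    (hex : ∀ a, ∃ g ∈ W (δ a), g ≠ 0 ∧ g.natDegree = a) :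
    ∃ P : ℕ → ℕ → K, IsCellArray δ t P ∧ ∀ a, hessSeq P a ∈ W (δ a) := by
  have hmonic : ∀ a, ∃ g ∈ W (δ a), g.Monic ∧ g.natDegree = a := by
    intro a
    obtain ⟨g, hg, h0, hd⟩ := hex a
    have hl := leadingCoeff_ne_zero.2 h0
    refine ⟨g.leadingCoeff⁻¹ • g, Submodule.smul_mem _ _ hg, ?_, ?_⟩
    · rw [Monic, leadingCoeff_smul_of_smul_regular _ (IsSMulRegular.of_ne_zero (inv_ne_zero hl)),
        smul_eq_mul, inv_mul_cancel₀ hl]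
    · rw [natDegree_smul _ (inv_ne_zero hl), hd]
  have key : ∀ n ≤ t, ∃ P : ℕ → ℕ → K, IsCellArray δ t P ∧ ∀ a ≤ n, hessSeq P a ∈ W (δ a) := by
    intro n
    induction n with
    | zero =>
      intro _
      refine ⟨0, fun a b h => absurd rfl h, fun a ha => ?_⟩
      obtain ⟨g, hg, hm, hd⟩ := hmonic 0
      rw [Nat.le_zero.1 ha, hessSeq_zero, ← hm.natDegree_eq_zero.1 hd]
      exact hg
    | succ n ih =>
      intro hn
      obtain ⟨P, hP, hW⟩ := ih (by omega)
      obtain ⟨h, hh, hhm, hhd⟩ := hmonic (n + 1)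
      have hδn := hδ' n (by omega)
      have hmem : X * hessSeq P n - h ∈ W (δ n + 1) :=
        sub_mem (hX _ _ (hW n le_rfl)) (hmono (by omega) hh)
      have hmonX : (X * hessSeq P n).Monic := monic_X.mul (hessSeq_monic P n)
      have hdegX : (X * hessSeq P n).degree = ((n + 1 : ℕ) : WithBot ℕ) := by
        rw [degree_eq_natDegree hmonX.ne_zero, natDegree_X_mul (hessSeq_monic P n).ne_zero,
          natDegree_hessSeq]
      have hlt : (X * hessSeq P n - h).degree < ((n + 1 : ℕ) : WithBot ℕ) := by
        rw [← hdegX]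
        refine degree_sub_lt_left ?_ hmonX.ne_zero ?_
        · rw [hdegX, degree_eq_natDegree hhm.ne_zero, hhd]
        · rw [hmonX.leadingCoeff, hhm.leadingCoeff]
      obtain ⟨c, hc, he⟩ := exists_sum_of_degree_lt (A := {a | (δ a : ℤ) ≤ δ n + 1})
        (hessSeq_monic_natDegree P) (hdeg (δ n + 1)) (n + 1)
        (fun b hb hbA => hmono hbA (hW b (by omega))) _ hmem hlt
      -- Only the coefficients that cannot be absorbed into an element of `W (δ (n+1))` are kept.
      let q : ℕ → K := fun b => if δ (n + 1) < δ b then c b else 0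
      have hq : ∀ b, q b ≠ 0 → δ (n + 1) < δ b ∧ c b ≠ 0 := by
        intro b hb
        simp only [q, ne_eq, ite_eq_right_iff, Classical.not_imp] at hb
        exact hb
      have hcongr : ∀ a ≤ n, hessSeq (Function.update P n q) a = hessSeq P a :=
        hessSeq_congr fun a ha b _ => by rw [Function.update_of_ne ha.ne]
      refine ⟨Function.update P n q, fun a b hab => ?_, fun a ha => ?_⟩
      · by_cases han : a = n
        · subst han
          rw [Function.update_self] at hab
          obtain ⟨h1, h2⟩ := hq b hab
          obtain ⟨h3, h4⟩ := hc b h2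
          have h5 : (δ b : ℤ) ≤ δ a + 1 := h4
          exact ⟨by omega, by omega, h1, by omega⟩
        · rw [Function.update_of_ne han] at hab
          exact hP a b hab
      · rcases Nat.lt_or_eq_of_le ha with ha | rfl
        · rw [hcongr a (Nat.lt_succ_iff.1 ha)]
          exact hW a (Nat.lt_succ_iff.1 ha)
        · have h1 : hessSeq (Function.update P n q) (n + 1) =
              h + ∑ b ∈ Finset.range (n + 1), (c b - q b) • hessSeq P b := by
            rw [hessSeq_succ, hcongr n le_rfl, Function.update_self]
            have : ∑ b ∈ Finset.range (n + 1), q b • hessSeq (Function.update P n q) b =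
                ∑ b ∈ Finset.range (n + 1), q b • hessSeq P b :=
              Finset.sum_congr rfl fun b hb => by
                rw [hcongr b (by rw [Finset.mem_range] at hb; omega)]
            rw [this, sub_eq_iff_eq_add.1 he]
            simp only [sub_smul, Finset.sum_sub_distrib]
            ring
          rw [h1]
          refine add_mem hh (Submodule.sum_mem _ fun b hb => ?_)
          by_cases hb0 : δ (n + 1) < δ b
          · simp only [q, if_pos hb0, sub_self, zero_smul]
            exact zero_mem _
          · rw [Finset.mem_range] at hb
            exact Submodule.smul_mem _ _ (hmono (by omega) (hW b (by omega)))
  obtain ⟨P, hP, hW⟩ := key t le_rfl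
  refine ⟨P, hP, fun a => ?_⟩
  induction a with
  | zero => exact hW 0 (Nat.zero_le _)
  | succ a ih =>
    by_cases ha : a < t
    · exact hW _ ha
    · have h1 : hessSeq P (a + 1) = X * hessSeq P a := by
        rw [hessSeq_succ, Finset.sum_eq_zero, sub_zero]
        intro b _
        have : P a b = 0 := by
          by_contra h
          exact ha (hP a b h).2.1
        rw [this, zero_smul]
      rw [h1]
      have := hX _ _ ih
      rwa [hδ a (by omega), ← Nat.cast_succ, Nat.succ_eq_add_one, ← hδ (a + 1) (by omega)] at this

omit hδ hδ' in
theorem eq_cellPiece_of_hessSeq_mem {W : ℤ → Submodule K K[X]} (hmono : Monotone W)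
    (hdeg : ∀ D, ∀ g ∈ W D, g ≠ 0 → (δ g.natDegree : ℤ) ≤ D) {P : ℕ → ℕ → K}
    (h : ∀ a, hessSeq P a ∈ W (δ a)) (D : ℤ) : W D = cellPiece δ P D := by
  apply le_antisymm
  · intro g hg
    obtain ⟨c, hc, he⟩ := exists_sum_of_degree_lt (A := {a | (δ a : ℤ) ≤ D})
      (hessSeq_monic_natDegree P) (hdeg D) (g.natDegree + 1)
      (fun b _ hbA => hmono hbA (h b)) g hg
      (degree_le_natDegree.trans_lt (by exact_mod_cast Nat.lt_succ_self _))
    rw [he]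
    refine Submodule.sum_mem _ fun b _ => ?_
    by_cases h0 : c b = 0
    · rw [h0, zero_smul]; exact zero_mem _
    · exact Submodule.smul_mem _ _ (hessSeq_mem_cellPiece P (hc b h0).2)
  · rw [cellPiece, Submodule.span_le]
    rintro _ ⟨a, ha, rfl⟩
    rw [hessBasis_apply]
    exact hmono ha (h a)

omit hδ hδ' in
-- If the rows before `a` agree, then `η'_{a+1} - η_{a+1} = ∑ (P a b - P' a b) η_b` has level at
-- most `δ (a+1)`. The entries in both rows sit only where `δ b > δ (a+1)`, so all coefficients
-- vanish.
theorem cellArray_unique {P P' : ℕ → ℕ → K} (hP : IsCellArray δ t P) (hP' : IsCellArray δ t P')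
    (h : ∀ a, hessSeq P' a ∈ cellPiece δ P (δ a)) : P = P' := by
  have key : ∀ n, ∀ a < n, ∀ b ≤ a, P a b = P' a b := by
    intro n
    induction n with
    | zero => intro a ha; omega
    | succ n ih =>
      intro a ha b hb
      rcases Nat.lt_succ_iff_lt_or_eq.1 ha with ha | rfl
      · exact ih a ha b hb
      · have hcongr := hessSeq_congr ih
        have h1 : hessSeq P' (a + 1) - hessSeq P (a + 1) =
            ∑ b ∈ Finset.range (a + 1), (P a b - P' a b) • hessSeq P b := by
          rw [hessSeq_succ, hessSeq_succ, hcongr a le_rfl]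
          have : ∑ b ∈ Finset.range (a + 1), P' a b • hessSeq P' b =
              ∑ b ∈ Finset.range (a + 1), P' a b • hessSeq P b :=
            Finset.sum_congr rfl fun b hb => by
              rw [hcongr b (by rw [Finset.mem_range] at hb; omega)]
          rw [this]
          simp only [sub_smul, Finset.sum_sub_distrib]
          ring
        have h2 : hessSeq P' (a + 1) - hessSeq P (a + 1) ∈ cellPiece δ P (δ (a + 1)) :=
          sub_mem (h _) (hessSeq_mem_cellPiece P le_rfl)
        rw [h1, mem_cellPiece_iff] at h2
        have h3 : (hessBasis P).repr (∑ b ∈ Finset.range (a + 1),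
            (P a b - P' a b) • hessSeq P b) b = P a b - P' a b := by
          rw [map_sum, Finsupp.finsetSum_apply]
          simp only [map_smul, hessBasis_repr_hessSeq, Finsupp.smul_apply, Finsupp.single_apply,
            smul_eq_mul, mul_ite, mul_one, mul_zero]
          rw [Finset.sum_ite_eq', if_pos (Finset.mem_range.2 (by omega))]
        by_contra hne
        have h4 := h2 b (by rw [h3]; exact sub_ne_zero.2 hne)
        have h5 : δ (a + 1) < δ b := by
          by_cases h0 : P a b = 0
          · exact (hP' a b fun h => hne (h0.trans h.symm)).2.2.1
          · exact (hP a b h0).2.2.1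
        omega
  funext a b
  by_cases hb : b ≤ a
  · exact key (a + 1) a a.lt_succ_self b hb
  · have h1 : P a b = 0 := by
      by_contra h
      exact hb (hP a b h).1
    have h2 : P' a b = 0 := by
      by_contra h
      exact hb (hP' a b h).1
    rw [h1, h2]

end Cell

end Polynomial

end

/-! ### Lex order in two variables and dehomogenization at `y = 1`. -/

noncomputable section
open MvPolynomial

section Exponents

/-- The exponent vector of `x ^ a * y ^ b`. -/
def biexp (a b : ℕ) : Fin 2 →₀ ℕ := Finsupp.single 0 a + Finsupp.single 1 b

@[simp] theorem biexp_zero (a b : ℕ) : biexp a b 0 = a := by simp [biexp]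

@[simp] theorem biexp_one (a b : ℕ) : biexp a b 1 = b := by simp [biexp]

theorem biexp_ext {n n' : Fin 2 →₀ ℕ} (h0 : n 0 = n' 0) (h1 : n 1 = n' 1) : n = n' :=
  Finsupp.ext (by simp [Fin.forall_fin_two, h0, h1])

theorem degree_fin_two (n : Fin 2 →₀ ℕ) : n.degree = n 0 + n 1 := by
  rw [Finsupp.degree_eq_sum, Fin.sum_univ_two]

theorem biexp_eq_of_degree {n : Fin 2 →₀ ℕ} {D : ℕ} (h : n.degree = D) :
    n = biexp (n 0) (D - n 0) := by
  rw [degree_fin_two] at h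
  exact biexp_ext (by simp) (by simp; omega)

theorem lex_lt_fin_two {n n' : Fin 2 →₀ ℕ} :
    MonomialOrder.lex.toSyn n < MonomialOrder.lex.toSyn n' ↔
      n 0 < n' 0 ∨ n 0 = n' 0 ∧ n 1 < n' 1 := by
  rw [MonomialOrder.lex_lt_iff, Finsupp.Lex.lt_iff]
  simp only [Fin.exists_fin_two, Fin.forall_fin_two, ofLex_toLex]
  simp

theorem lex_le_fin_two {n n' : Fin 2 →₀ ℕ} (h : n.degree = n'.degree) :
    MonomialOrder.lex.toSyn n ≤ MonomialOrder.lex.toSyn n' ↔ n 0 ≤ n' 0 := by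
  rw [← not_lt, lex_lt_fin_two]
  rw [degree_fin_two, degree_fin_two] at h
  omega

end Exponents

theorem homogeneousComponent_zero_X_mul {σ R : Type*} [CommSemiring R] (i : σ)
    (a : MvPolynomial σ R) : homogeneousComponent 0 (X i * a) = 0 := by
  classical
  rw [homogeneousComponent_zero, coeff_X_mul']
  simp

theorem homogeneousComponent_succ_X_mul {σ R : Type*} [CommSemiring R] (i : σ)
    (a : MvPolynomial σ R) (n : ℕ) :
    homogeneousComponent (n + 1) (X i * a) = X i * homogeneousComponent n a := by
  classical
  ext m
  rw [coeff_homogeneousComponent, coeff_X_mul', coeff_X_mul', coeff_homogeneousComponent]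
  by_cases hi : i ∈ m.support
  · have h1 : Finsupp.single i 1 ≤ m := by
      rw [Finsupp.single_le_iff]
      exact Nat.one_le_iff_ne_zero.2 (Finsupp.mem_support_iff.1 hi)
    have h2 : (m - Finsupp.single i 1).degree + 1 = m.degree := by
      conv_rhs => rw [← tsub_add_cancel_of_le h1, map_add, Finsupp.degree_single]
    rw [if_pos hi, if_pos hi, ← h2]
    simp
  · simp [hi]

section Dehomogenize

variable {K : Type*} [Field K]

/-- The substitution `x = X`, `y = 1`. -/
def dehom : MvPolynomial (Fin 2) K →ₐ[K] Polynomial K := aeval ![Polynomial.X, 1]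

theorem dehom_X_zero : dehom (X 0 : MvPolynomial (Fin 2) K) = Polynomial.X := by simp [dehom]

theorem dehom_X_one : dehom (X 1 : MvPolynomial (Fin 2) K) = 1 := by simp [dehom]

theorem dehom_monomial (n : Fin 2 →₀ ℕ) (c : K) :
    dehom (monomial n c) = Polynomial.monomial (n 0) c := by
  rw [monomial_fin_two, map_mul, map_mul, map_pow, map_pow, dehom_X_zero, dehom_X_one, one_pow,
    mul_one, ← Polynomial.C_mul_X_pow_eq_monomial]
  simp [dehom]

/-- The homogenization of degree `D` of a polynomial of degree at most `D`. -/
def rehom (D : ℕ) : Polynomial K →ₗ[K] MvPolynomial (Fin 2) K :=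
  Polynomial.lsum fun a => monomial (biexp a (D - a))

theorem rehom_monomial (D a : ℕ) (c : K) :
    rehom D (Polynomial.monomial a c) = monomial (biexp a (D - a)) c := by
  exact Polynomial.sum_monomial_index _ _ (map_zero _)

theorem dehom_rehom (D : ℕ) (g : Polynomial K) : dehom (rehom D g) = g := by
  induction g using Polynomial.induction_on' with
  | add p q hp hq => rw [map_add, map_add, hp, hq]
  | monomial a c => rw [rehom_monomial, dehom_monomial, biexp_zero]

theorem rehom_dehom {D : ℕ} {f : MvPolynomial (Fin 2) K} (hf : f.IsHomogeneous D) :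
    rehom D (dehom f) = f := by
  conv_rhs => rw [f.as_sum]
  conv_lhs => rw [f.as_sum]
  rw [map_sum, map_sum]
  refine Finset.sum_congr rfl fun n hn => ?_
  have hD : n.degree = D := by
    by_contra h
    exact mem_support_iff.1 hn (hf.coeff_eq_zero h)
  rw [dehom_monomial, rehom_monomial, ← biexp_eq_of_degree hD]

theorem dehom_injOn_homogeneous {D : ℕ} {f f' : MvPolynomial (Fin 2) K} (hf : f.IsHomogeneous D)
    (hf' : f'.IsHomogeneous D) (h : dehom f = dehom f') : f = f' := by
  rw [← rehom_dehom hf, h, rehom_dehom hf']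

theorem rehom_isHomogeneous {D : ℕ} {g : Polynomial K} (hg : g.natDegree ≤ D) :
    (rehom D g).IsHomogeneous D := by
  rw [g.as_sum_range, map_sum]
  refine IsHomogeneous.sum _ _ _ fun a ha => ?_
  rw [rehom_monomial]
  rw [Finset.mem_range] at ha
  refine isHomogeneous_monomial _ ?_
  rw [degree_fin_two, biexp_zero, biexp_one]
  omega

theorem coeff_rehom {D : ℕ} {n : Fin 2 →₀ ℕ} (hn : n.degree = D) (g : Polynomial K) :
    coeff n (rehom D g) = g.coeff (n 0) := by
  classical
  induction g using Polynomial.induction_on' with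
  | add p q hp hq => rw [map_add, coeff_add, hp, hq, Polynomial.coeff_add]
  | monomial a c =>
    rw [rehom_monomial, coeff_monomial, Polynomial.coeff_monomial]
    refine if_congr ⟨fun h => ?_, fun h => ?_⟩ rfl rfl
    · rw [← h, biexp_zero]
    · rw [h, ← biexp_eq_of_degree hn]

theorem coeff_eq_coeff_dehom {D : ℕ} {f : MvPolynomial (Fin 2) K} (hf : f.IsHomogeneous D)
    {n : Fin 2 →₀ ℕ} (hn : n.degree = D) : coeff n f = (dehom f).coeff (n 0) := by
  rw [← coeff_rehom hn, rehom_dehom hf]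

theorem natDegree_dehom_le {D : ℕ} {f : MvPolynomial (Fin 2) K} (hf : f.IsHomogeneous D) :
    (dehom f).natDegree ≤ D := by
  rw [f.as_sum, map_sum]
  refine Polynomial.natDegree_sum_le_of_forall_le _ _ fun n hn => ?_
  have hD : n.degree = D := by
    by_contra h
    exact mem_support_iff.1 hn (hf.coeff_eq_zero h)
  rw [dehom_monomial]
  refine (Polynomial.natDegree_monomial_le _).trans ?_
  rw [degree_fin_two] at hD
  omega

theorem dehom_eq_zero_iff {D : ℕ} {f : MvPolynomial (Fin 2) K} (hf : f.IsHomogeneous D) :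
    dehom f = 0 ↔ f = 0 :=
  ⟨fun h => dehom_injOn_homogeneous hf (isHomogeneous_zero _ _ _) (h.trans (map_zero _).symm),
    fun h => h ▸ map_zero _⟩

theorem X_zero_mul_rehom {D : ℕ} {g : Polynomial K} (hg : g.natDegree ≤ D) :
    X 0 * rehom D g = rehom (D + 1) (Polynomial.X * g) := by
  refine dehom_injOn_homogeneous (D := D + 1) ?_ (rehom_isHomogeneous ?_) ?_
  · rw [add_comm]
    exact (isHomogeneous_X _ _).mul (rehom_isHomogeneous hg)
  · exact Polynomial.natDegree_mul_le.trans (by rw [Polynomial.natDegree_X]; omega)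
  · rw [map_mul, dehom_X_zero, dehom_rehom, dehom_rehom]

theorem X_one_pow_mul_rehom {D : ℕ} {g : Polynomial K} (hg : g.natDegree ≤ D) (e : ℕ) :
    X 1 ^ e * rehom D g = rehom (D + e) g := by
  refine dehom_injOn_homogeneous (D := D + e) ?_ (rehom_isHomogeneous (by omega)) ?_
  · rw [add_comm]
    exact (by simpa using (isHomogeneous_X K (1 : Fin 2)).pow e :
      IsHomogeneous ((X 1 : MvPolynomial (Fin 2) K) ^ e) e).mul
      (rehom_isHomogeneous hg)
  · rw [map_mul, map_pow, dehom_X_one, one_pow, one_mul, dehom_rehom, dehom_rehom]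

/-- In a fixed total degree the lex order compares only the exponents of `x`, which are the
exponents that survive at `y = 1`. -/
theorem lex_degree_of_isHomogeneous {D : ℕ} {f : MvPolynomial (Fin 2) K} (hf : f.IsHomogeneous D)
    (h0 : f ≠ 0) : MonomialOrder.lex.degree f =
      biexp (dehom f).natDegree (D - (dehom f).natDegree) := by
  have hg : dehom f ≠ 0 := fun h => h0 ((dehom_eq_zero_iff hf).1 h)
  have hle := natDegree_dehom_le hf
  have hmem := MonomialOrder.lex.degree_mem_support h0
  have hD : (MonomialOrder.lex.degree f).degree = D := by
    by_contra h
    exact mem_support_iff.1 hmem (hf.coeff_eq_zero h)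
  have hD' : (biexp (dehom f).natDegree (D - (dehom f).natDegree)).degree = D := by
    rw [degree_fin_two, biexp_zero, biexp_one]
    omega
  have h1 : biexp (dehom f).natDegree (D - (dehom f).natDegree) ∈ f.support := by
    rw [mem_support_iff, coeff_eq_coeff_dehom hf hD', biexp_zero]
    exact Polynomial.leadingCoeff_ne_zero.2 hg
  have h2 := (lex_le_fin_two (hD'.trans hD.symm)).1 (MonomialOrder.lex.le_degree h1)
  rw [biexp_zero] at h2
  have h3 : MonomialOrder.lex.degree f 0 ≤ (dehom f).natDegree := by
    apply Polynomial.le_natDegree_of_ne_zero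
    rw [← coeff_eq_coeff_dehom hf hD]
    exact mem_support_iff.1 hmem
  rw [biexp_eq_of_degree hD, le_antisymm h3 h2]

/-- Lex is not graded, so leading terms may come from inhomogeneous elements; this replaces such an
element by a homogeneous component, which a homogeneous ideal also contains. -/
theorem lex_degree_homogeneousComponent {f : MvPolynomial (Fin 2) K} (h0 : f ≠ 0) :
    homogeneousComponent (MonomialOrder.lex.degree f).degree f ≠ 0 ∧
    MonomialOrder.lex.degree (homogeneousComponent (MonomialOrder.lex.degree f).degree f) =
      MonomialOrder.lex.degree f := by
  classical
  have h1 : MonomialOrder.lex.degree f ∈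
      (homogeneousComponent (MonomialOrder.lex.degree f).degree f).support := by
    rw [mem_support_iff, coeff_homogeneousComponent, if_pos rfl]
    exact mem_support_iff.1 (MonomialOrder.lex.degree_mem_support h0)
  refine ⟨fun h => by simp [h] at h1, ?_⟩
  apply MonomialOrder.lex.toSyn.injective
  apply le_antisymm
  · rw [MonomialOrder.degree_le_iff]
    intro n hn
    refine MonomialOrder.lex.le_degree ?_
    rw [mem_support_iff, coeff_homogeneousComponent] at hn
    rw [mem_support_iff]
    intro h
    simp [h] at hn
  · exact MonomialOrder.lex.le_degree h1

end Dehomogenize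

/-! ### The filtration of `K[X]` attached to an ideal. -/

section Pieces

variable {K : Type*} [Field K] {I J : Ideal (MvPolynomial (Fin 2) K)}

theorem mem_gradedPart_natCast {n : ℕ} {f : MvPolynomial (Fin 2) K} :
    f ∈ gradedPart I (n : ℤ) ↔ f ∈ I ∧ f.IsHomogeneous n := by
  refine and_congr_right fun _ => ⟨fun h => ?_, fun h m hm => ?_⟩
  · rw [← mem_homogeneousSubmodule, homogeneousSubmodule_eq_finsupp_supported]
    intro m hm
    exact_mod_cast h m hm
  · by_contra hne
    exact mem_support_iff.1 hm (h.coeff_eq_zero fun h => hne (by exact_mod_cast h))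

theorem gradedPart_of_neg {D : ℤ} (hD : D < 0) : gradedPart I D = ⊥ := by
  rw [eq_bot_iff]
  rintro f ⟨_, hf⟩
  rw [Submodule.mem_bot, ← support_eq_empty, Finset.eq_empty_iff_forall_notMem]
  intro n hn
  have := hf n hn
  omega

theorem dehom_injOn_gradedPart {D : ℤ} {f f' : MvPolynomial (Fin 2) K} (hf : f ∈ gradedPart I D)
    (hf' : f' ∈ gradedPart J D) (h : dehom f = dehom f') : f = f' := by
  rcases lt_or_ge D 0 with hD | hD
  · rw [gradedPart_of_neg hD, Submodule.mem_bot] at hf hf'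
    rw [hf, hf']
  · lift D to ℕ using hD
    exact dehom_injOn_homogeneous (mem_gradedPart_natCast.1 hf).2 (mem_gradedPart_natCast.1 hf').2 h

theorem mul_X_mem_gradedPart {D : ℤ} {f : MvPolynomial (Fin 2) K} (hf : f ∈ gradedPart I D)
    (i : Fin 2) : X i * f ∈ gradedPart I (D + 1) := by
  rcases lt_or_ge D 0 with hD | hD
  · rw [gradedPart_of_neg hD, Submodule.mem_bot] at hf
    rw [hf, mul_zero]
    exact zero_mem _
  · lift D to ℕ using hD
    rw [mem_gradedPart_natCast] at hf
    rw [← Nat.cast_succ, mem_gradedPart_natCast]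
    refine ⟨I.mul_mem_left _ hf.1, ?_⟩
    rw [Nat.succ_eq_add_one, add_comm]
    exact (isHomogeneous_X _ _).mul hf.2

/-- The polynomials `g` such that the homogenization of degree `D` of `g` belongs to `I`. -/
def dehomPiece (I : Ideal (MvPolynomial (Fin 2) K)) (D : ℤ) : Submodule K (Polynomial K) :=
  (gradedPart I D).map dehom.toLinearMap

theorem dehomPiece_of_neg {D : ℤ} (hD : D < 0) : dehomPiece I D = ⊥ := by
  rw [dehomPiece, gradedPart_of_neg hD, Submodule.map_bot]

/-- Multiplication by `y` becomes the inclusion of one level in the next. -/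
theorem dehomPiece_mono (I : Ideal (MvPolynomial (Fin 2) K)) : Monotone (dehomPiece I) := by
  refine monotone_int_of_le_succ fun D => ?_
  rintro _ ⟨f, hf, rfl⟩
  refine ⟨X 1 * f, mul_X_mem_gradedPart hf 1, ?_⟩
  simp [dehom_X_one]

theorem X_mul_mem_dehomPiece (D : ℤ) (g : Polynomial K) (hg : g ∈ dehomPiece I D) :
    Polynomial.X * g ∈ dehomPiece I (D + 1) := by
  obtain ⟨f, hf, rfl⟩ := hg
  refine ⟨X 0 * f, mul_X_mem_gradedPart hf 0, ?_⟩
  simp [dehom_X_zero]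

theorem dehom_mem_dehomPiece_iff {n : ℕ} {f : MvPolynomial (Fin 2) K} (hf : f.IsHomogeneous n) :
    dehom f ∈ dehomPiece I n ↔ f ∈ I := by
  refine ⟨fun h => ?_, fun h => ⟨f, mem_gradedPart_natCast.2 ⟨h, hf⟩, rfl⟩⟩
  obtain ⟨f', hf', he⟩ := h
  replace hf' := mem_gradedPart_natCast.1 hf'
  rw [← dehom_injOn_homogeneous hf'.2 hf he]
  exact hf'.1

theorem natDegree_of_mem_dehomPiece {D : ℤ} {g : Polynomial K} (hg : g ∈ dehomPiece I D)
    (h0 : g ≠ 0) : (g.natDegree : ℤ) ≤ D := by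
  rcases lt_or_ge D 0 with hD | hD
  · rw [dehomPiece_of_neg hD] at hg
    exact absurd hg h0
  · lift D to ℕ using hD
    obtain ⟨f, hf, rfl⟩ := hg
    exact_mod_cast natDegree_dehom_le (mem_gradedPart_natCast.1 hf).2

theorem le_of_dehomPiece_le (hI : ∀ f ∈ I, ∀ d : ℕ, homogeneousComponent d f ∈ I)
    (h : ∀ D, dehomPiece I D ≤ dehomPiece J D) : I ≤ J := by
  intro f hf
  rw [← sum_homogeneousComponent f]
  refine J.sum_mem fun n _ => ?_
  have hn := homogeneousComponent_isHomogeneous n f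
  exact (dehom_mem_dehomPiece_iff hn).1 (h n ((dehom_mem_dehomPiece_iff hn).2 (hI f hf n)))

theorem monomial_mem_initialIdeal_iff (hI : ∀ f ∈ I, ∀ d : ℕ, homogeneousComponent d f ∈ I)
    (n : Fin 2 →₀ ℕ) : monomial n (1 : K) ∈ initialIdeal I ↔
      ∃ g ∈ dehomPiece I n.degree, g ≠ 0 ∧ g.natDegree = n 0 := by
  have hrw : initialIdeal I = Ideal.span ((fun m => monomial m (1 : K)) ''
      {m | ∃ f ∈ I, f ≠ 0 ∧ m = MonomialOrder.lex.degree f}) := by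
    rw [initialIdeal]
    congr 1
    ext g
    constructor
    · rintro ⟨f, hf, h0, rfl⟩
      exact ⟨_, ⟨f, hf, h0, rfl⟩, rfl⟩
    · rintro ⟨_, ⟨f, hf, h0, rfl⟩, rfl⟩
      exact ⟨f, hf, h0, rfl⟩
  constructor
  · intro h
    rw [hrw, mem_ideal_span_monomial_image] at h
    obtain ⟨_, ⟨f, hf, h0, rfl⟩, hle⟩ := h n (by simp [mem_support_iff])
    obtain ⟨h1, h2⟩ := lex_degree_homogeneousComponent h0
    set m := MonomialOrder.lex.degree f with hm
    set f' := homogeneousComponent m.degree f with hf'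
    have hhom : f'.IsHomogeneous m.degree := homogeneousComponent_isHomogeneous _ _
    have hdeg := lex_degree_of_isHomogeneous hhom h1
    have hd0 : m 0 = (dehom f').natDegree := by rw [← h2, hdeg, biexp_zero]
    have hne : dehom f' ≠ 0 := fun h => h1 ((dehom_eq_zero_iff hhom).1 h)
    have hnm : (n - m).degree + m.degree = n.degree := by
      rw [← map_add, tsub_add_cancel_of_le hle]
    refine ⟨dehom (monomial (n - m) 1 * f'), (dehom_mem_dehomPiece_iff ?_).2
      (I.mul_mem_left _ (hI f hf _)), ?_, ?_⟩
    · rw [← hnm]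
      exact (isHomogeneous_monomial _ rfl).mul hhom
    · rw [map_mul, dehom_monomial]
      exact mul_ne_zero (by simp) hne
    · rw [map_mul, dehom_monomial, Polynomial.natDegree_mul (by simp) hne,
        Polynomial.natDegree_monomial_eq _ one_ne_zero, ← hd0]
      have := hle 0
      rw [Finsupp.tsub_apply]
      omega
  · rintro ⟨g, ⟨f, hf, hg⟩, h0, hd⟩
    replace hf := mem_gradedPart_natCast.1 hf
    have hg : dehom f = g := hg
    have hf0 : f ≠ 0 := fun h => h0 (by rw [← hg, h, map_zero])
    refine Ideal.subset_span ⟨f, hf.1, hf0, ?_⟩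
    rw [lex_degree_of_isHomogeneous hf.2 hf0, hg, hd, ← biexp_eq_of_degree rfl]

/-- In `f = x a + y b` both `a` and `b` may be replaced by their components of degree `D - 1`, which
remain in `I`. -/
theorem mem_mul_iff (hI : ∀ f ∈ I, ∀ d : ℕ, homogeneousComponent d f ∈ I) {D : ℤ}
    {f : MvPolynomial (Fin 2) K} (hf : f ∈ gradedPart I D) :
    f ∈ Ideal.span {X 0, X 1} * I ↔
      ∃ g ∈ dehomPiece I (D - 1), ∃ h ∈ dehomPiece I (D - 1), dehom f = Polynomial.X * g + h := by
  constructor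
  · intro h
    rcases lt_or_ge D 0 with hD | hD
    · rw [gradedPart_of_neg hD, Submodule.mem_bot] at hf
      exact ⟨0, zero_mem _, 0, zero_mem _, by simp [hf]⟩
    lift D to ℕ using hD
    rw [mem_gradedPart_natCast] at hf
    rw [Ideal.span_insert, Ideal.sup_mul, Submodule.mem_sup] at h
    obtain ⟨p, hp, q, hq, rfl⟩ := h
    obtain ⟨a, ha, rfl⟩ := Ideal.mem_span_singleton_mul.1 hp
    obtain ⟨b, hb, rfl⟩ := Ideal.mem_span_singleton_mul.1 hq
    have hcomp := homogeneousComponent_eq_self hf.2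
    cases D with
    | zero =>
      rw [map_add, homogeneousComponent_zero_X_mul, homogeneousComponent_zero_X_mul,
        add_zero] at hcomp
      exact ⟨0, zero_mem _, 0, zero_mem _, by simp [← hcomp]⟩
    | succ n =>
      rw [map_add, homogeneousComponent_succ_X_mul, homogeneousComponent_succ_X_mul] at hcomp
      have hn : ((n + 1 : ℕ) : ℤ) - 1 = n := by push_cast; ring
      rw [hn]
      refine ⟨_, (dehom_mem_dehomPiece_iff (homogeneousComponent_isHomogeneous n a)).2 (hI a ha n),
        _, (dehom_mem_dehomPiece_iff (homogeneousComponent_isHomogeneous n b)).2 (hI b hb n), ?_⟩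
      rw [← hcomp, map_add, map_mul, map_mul, dehom_X_zero, dehom_X_one, one_mul]
  · rintro ⟨_, ⟨a, ha, rfl⟩, _, ⟨b, hb, rfl⟩, he⟩
    have h1 : f = X 0 * a + X 1 * b := by
      refine dehom_injOn_gradedPart hf (J := I) ?_ (by
        simpa [dehom_X_zero, dehom_X_one] using he)
      have h1 := mul_X_mem_gradedPart ha 0
      have h2 := mul_X_mem_gradedPart hb 1
      rw [sub_add_cancel] at h1 h2
      exact add_mem h1 h2
    rw [h1]
    exact add_mem (Ideal.mul_mem_mul (Ideal.subset_span (by simp)) ha.1)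
      (Ideal.mul_mem_mul (Ideal.subset_span (by simp)) hb.1)

end Pieces

end

/-! ### Ideals of a Gröbner cell and Hessenberg arrays. -/

noncomputable section
open MvPolynomial
open Polynomial (hessSeq cellPiece hessBasis IsCellArray)

section CellIdeal

variable {K : Type*} [Field K] {δ : ℕ → ℕ} {t : ℕ}

/-- The monomial ideal with the monomials `x ^ a * y ^ b`, `δ a ≤ a + b`. -/
def cornerIdeal (K : Type*) [Field K] (δ : ℕ → ℕ) : Ideal (MvPolynomial (Fin 2) K) :=
  Ideal.span ((fun n => monomial n (1 : K)) '' {n | δ (n 0) ≤ n.degree})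

/-- The ideal generated by the homogenizations of degree `δ a` of `hessSeq P a`, `a ≤ t`. -/
def cellIdeal (δ : ℕ → ℕ) (t : ℕ) (P : ℕ → ℕ → K) : Ideal (MvPolynomial (Fin 2) K) :=
  Ideal.span ((fun a => rehom (δ a) (hessSeq P a)) '' Set.Iic t)

theorem eq_zero_of_isCellArray {P : ℕ → ℕ → K} (hP : IsCellArray δ t P) {a : ℕ} (ha : t ≤ a)
    (b : ℕ) : P a b = 0 := by
  by_contra h
  exact absurd (hP a b h).2.1 (by omega)

variable (hδ : ∀ a, t ≤ a → δ a = a) (hδ' : ∀ a < t, δ (a + 1) ≤ δ a)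
include hδ hδ'

theorem monomial_mem_cornerIdeal_iff (n : Fin 2 →₀ ℕ) :
    monomial n (1 : K) ∈ cornerIdeal K δ ↔ δ (n 0) ≤ n.degree := by
  refine ⟨fun h => ?_, fun h => Ideal.subset_span ⟨n, h, rfl⟩⟩
  rw [cornerIdeal, mem_ideal_span_monomial_image] at h
  obtain ⟨m, hm, hle⟩ := h n (by simp [mem_support_iff])
  have h0 := hle 0
  have h1 := hle 1
  have hm' : δ (m 0) ≤ m.degree := hm
  have key : ∀ i, δ (m 0 + i) ≤ δ (m 0) + i := by
    intro i
    induction i with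
    | zero => rfl
    | succ i ih =>
      have := Polynomial.corner_succ_le hδ hδ' (m 0 + i)
      rw [add_assoc] at this
      omega
  have h2 := key (n 0 - m 0)
  rw [show m 0 + (n 0 - m 0) = n 0 by omega] at h2
  rw [degree_fin_two] at hm' ⊢
  omega

/-- The degree bound is the inclusion of `Lt(I)` in the corner ideal; the existence of an element of
each degree `a` at level `δ a` is the reverse inclusion. These are the hypotheses of
`exists_cellArray`. -/
theorem mem_groebnerCell_cornerIdeal_iff (I : Ideal (MvPolynomial (Fin 2) K)) :
    I ∈ groebnerCell (cornerIdeal K δ) ↔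
      (∀ f ∈ I, ∀ d : ℕ, homogeneousComponent d f ∈ I) ∧
      (∀ D, ∀ g ∈ dehomPiece I D, g ≠ 0 → (δ g.natDegree : ℤ) ≤ D) ∧
      ∀ a, ∃ g ∈ dehomPiece I (δ a), g ≠ 0 ∧ g.natDegree = a := by
  refine and_congr_right fun hI => ?_
  have hle := Polynomial.le_of_corner hδ hδ'
  have hdeg : ∀ a b : ℕ, (biexp a b).degree = a + b := fun a b => by simp [degree_fin_two]
  constructor
  · intro h
    refine ⟨fun D g hg h0 => ?_, fun a => ?_⟩
    · have h1 := natDegree_of_mem_dehomPiece hg h0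
      lift D to ℕ using by omega
      have h2 : monomial (biexp g.natDegree (D - g.natDegree)) (1 : K) ∈ initialIdeal I := by
        rw [monomial_mem_initialIdeal_iff hI, hdeg, biexp_zero]
        rw [show g.natDegree + (D - g.natDegree) = D by omega]
        exact ⟨g, hg, h0, rfl⟩
      rw [h, monomial_mem_cornerIdeal_iff hδ hδ', hdeg, biexp_zero] at h2
      omega
    · have h2 : monomial (biexp a (δ a - a)) (1 : K) ∈ initialIdeal I := by
        rw [h, monomial_mem_cornerIdeal_iff hδ hδ', hdeg, biexp_zero]
        have := hle a
        omega
      rw [monomial_mem_initialIdeal_iff hI, hdeg, biexp_zero,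
        show a + (δ a - a) = δ a by have := hle a; omega] at h2
      exact h2
  · rintro ⟨h1, h2⟩
    apply le_antisymm
    · rw [initialIdeal, Ideal.span_le]
      rintro _ ⟨f, hf, h0, rfl⟩
      rw [SetLike.mem_coe, monomial_mem_cornerIdeal_iff hδ hδ']
      have h3 : monomial (MonomialOrder.lex.degree f) (1 : K) ∈ initialIdeal I :=
        Ideal.subset_span ⟨f, hf, h0, rfl⟩
      rw [monomial_mem_initialIdeal_iff hI] at h3
      obtain ⟨g, hg, hg0, hd⟩ := h3
      rw [← hd]
      exact_mod_cast h1 _ g hg hg0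
    · rw [cornerIdeal, Ideal.span_le]
      rintro _ ⟨n, hn, rfl⟩
      rw [SetLike.mem_coe, monomial_mem_initialIdeal_iff hI]
      obtain ⟨g, hg, hg0, hd⟩ := h2 (n 0)
      exact ⟨g, dehomPiece_mono I (by exact_mod_cast hn) hg, hg0, hd⟩

theorem hessSeq_mem_dehomPiece_cellIdeal {P : ℕ → ℕ → K} (hP : IsCellArray δ t P) (a : ℕ) :
    hessSeq P a ∈ dehomPiece (cellIdeal δ t P) (δ a) := by
  have hlow : ∀ a ≤ t, hessSeq P a ∈ dehomPiece (cellIdeal δ t P) (δ a) := by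
    intro a ha
    have h1 : (rehom (δ a) (hessSeq P a)).IsHomogeneous (δ a) := rehom_isHomogeneous
      ((Polynomial.natDegree_hessSeq P a).le.trans (Polynomial.le_of_corner hδ hδ' a))
    have h2 := (dehom_mem_dehomPiece_iff h1).2
      (Ideal.subset_span (Set.mem_image_of_mem _ ha) : _ ∈ cellIdeal δ t P)
    rwa [dehom_rehom] at h2
  induction a with
  | zero => exact hlow 0 (Nat.zero_le _)
  | succ a ih =>
    by_cases ha : a < t
    · exact hlow _ ha
    · have h1 : hessSeq P (a + 1) = Polynomial.X * hessSeq P a := by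
        rw [Polynomial.hessSeq_succ, Finset.sum_eq_zero, sub_zero]
        intro b _
        rw [eq_zero_of_isCellArray hP (by omega), zero_smul]
      rw [h1, hδ (a + 1) (by omega), Nat.cast_succ]
      apply X_mul_mem_dehomPiece
      rwa [hδ a (by omega)] at ih

/-- Treating all components at once lets arbitrary coefficients be built from variables: `x` acts as
`X` and raises the level by one, while `y` acts as the inclusion of levels. -/
theorem homogeneousComponent_of_mem_cellIdeal {P : ℕ → ℕ → K} (hP : IsCellArray δ t P)
    {f : MvPolynomial (Fin 2) K} (hf : f ∈ cellIdeal δ t P) (n : ℕ) :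
    dehom (homogeneousComponent n f) ∈ cellPiece δ P n := by
  induction hf using Submodule.span_induction generalizing n with
  | zero => simp
  | add p q _ _ hp hq => rw [map_add, map_add]; exact add_mem (hp n) (hq n)
  | mem p hp =>
    obtain ⟨a, -, rfl⟩ := hp
    have h1 : (rehom (δ a) (hessSeq P a)).IsHomogeneous (δ a) := rehom_isHomogeneous
      ((Polynomial.natDegree_hessSeq P a).le.trans (Polynomial.le_of_corner hδ hδ' a))
    change dehom (homogeneousComponent n (rehom (δ a) (hessSeq P a))) ∈ _
    rw [homogeneousComponent_of_mem h1]
    split_ifs with h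
    · rw [dehom_rehom]
      exact Polynomial.hessSeq_mem_cellPiece P (by exact_mod_cast h.ge)
    · rw [map_zero]
      exact zero_mem _
  | smul r p _ hp =>
    rw [smul_eq_mul]
    clear * - hp hδ hδ' hP
    induction r using MvPolynomial.induction_on generalizing p n with
    | C c =>
      rw [homogeneousComponent_C_mul, ← smul_eq_C_mul, map_smul]
      exact Submodule.smul_mem _ _ (hp n)
    | add r s hr hs => rw [add_mul, map_add, map_add]; exact add_mem (hr p hp n) (hs p hp n)
    | mul_X r i hr =>
      rw [mul_assoc]
      refine hr _ (fun m => ?_) n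
      cases m with
      | zero => rw [homogeneousComponent_zero_X_mul, map_zero]; exact zero_mem _
      | succ m =>
        rw [homogeneousComponent_succ_X_mul, map_mul]
        fin_cases i
        · simp only [Fin.zero_eta, dehom_X_zero]
          rw [Nat.cast_succ]
          exact Polynomial.X_mul_mem_cellPiece hδ hδ' hP (hp m)
        · simp only [Fin.mk_one, dehom_X_one, one_mul]
          exact Polynomial.cellPiece_mono δ P (by push_cast; omega) (hp m)

theorem dehomPiece_cellIdeal {P : ℕ → ℕ → K} (hP : IsCellArray δ t P) (D : ℤ) :
    dehomPiece (cellIdeal δ t P) D = cellPiece δ P D := by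
  apply le_antisymm
  · intro g hg
    rcases lt_or_ge D 0 with hD | hD
    · rw [dehomPiece_of_neg hD, Submodule.mem_bot] at hg
      rw [hg]
      exact zero_mem _
    lift D to ℕ using hD
    obtain ⟨f, hf, rfl⟩ := hg
    replace hf := mem_gradedPart_natCast.1 hf
    have := homogeneousComponent_of_mem_cellIdeal hδ hδ' hP hf.1 D
    rwa [homogeneousComponent_eq_self hf.2] at this
  · rw [cellPiece, Submodule.span_le]
    rintro _ ⟨a, ha, rfl⟩
    rw [Polynomial.hessBasis_apply]
    exact dehomPiece_mono _ ha (hessSeq_mem_dehomPiece_cellIdeal hδ hδ' hP a)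

theorem cellIdeal_homogeneous {P : ℕ → ℕ → K} (hP : IsCellArray δ t P) :
    ∀ f ∈ cellIdeal δ t P, ∀ d : ℕ, homogeneousComponent d f ∈ cellIdeal δ t P := by
  intro f hf d
  rw [← dehom_mem_dehomPiece_iff (homogeneousComponent_isHomogeneous d f),
    dehomPiece_cellIdeal hδ hδ' hP]
  exact homogeneousComponent_of_mem_cellIdeal hδ hδ' hP hf d

theorem cellIdeal_mem_groebnerCell {P : ℕ → ℕ → K} (hP : IsCellArray δ t P) :
    cellIdeal δ t P ∈ groebnerCell (cornerIdeal K δ) := by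
  rw [mem_groebnerCell_cornerIdeal_iff hδ hδ']
  refine ⟨cellIdeal_homogeneous hδ hδ' hP, fun D g hg h0 => ?_, fun a => ?_⟩
  · rw [dehomPiece_cellIdeal hδ hδ' hP] at hg
    exact Polynomial.natDegree_of_mem_cellPiece hg h0
  · exact ⟨_, hessSeq_mem_dehomPiece_cellIdeal hδ hδ' hP a, (Polynomial.hessSeq_monic P a).ne_zero,
      Polynomial.natDegree_hessSeq P a⟩

theorem exists_eq_cellIdeal {I : Ideal (MvPolynomial (Fin 2) K)}
    (hI : I ∈ groebnerCell (cornerIdeal K δ)) :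
    ∃ P : ℕ → ℕ → K, IsCellArray δ t P ∧ cellIdeal δ t P = I := by
  rw [mem_groebnerCell_cornerIdeal_iff hδ hδ'] at hI
  obtain ⟨hhom, hdeg, hex⟩ := hI
  obtain ⟨P, hP, hW⟩ := Polynomial.exists_cellArray hδ hδ' (dehomPiece_mono I)
    X_mul_mem_dehomPiece hdeg hex
  refine ⟨P, hP, ?_⟩
  have h := Polynomial.eq_cellPiece_of_hessSeq_mem (dehomPiece_mono I) hdeg hW
  apply le_antisymm
  · exact le_of_dehomPiece_le (cellIdeal_homogeneous hδ hδ' hP) fun D => by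
      rw [h, dehomPiece_cellIdeal hδ hδ' hP]
  · exact le_of_dehomPiece_le hhom fun D => by
      rw [h, dehomPiece_cellIdeal hδ hδ' hP]

theorem cellIdeal_injective {P P' : ℕ → ℕ → K} (hP : IsCellArray δ t P)
    (hP' : IsCellArray δ t P') (h : cellIdeal δ t P = cellIdeal δ t P') : P = P' := by
  refine Polynomial.cellArray_unique hP hP' fun a => ?_
  rw [← dehomPiece_cellIdeal hδ hδ' hP, h]
  exact hessSeq_mem_dehomPiece_cellIdeal hδ hδ' hP' a

theorem cellIdeal_zero : cellIdeal δ t (0 : ℕ → ℕ → K) = cornerIdeal K δ := by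
  have hP : IsCellArray δ t (0 : ℕ → ℕ → K) := fun _ _ h => absurd rfl h
  have hX : ∀ a, hessSeq (0 : ℕ → ℕ → K) a = Polynomial.X ^ a := by
    intro a
    induction a with
    | zero => rw [Polynomial.hessSeq_zero, pow_zero]
    | succ a ih => rw [Polynomial.hessSeq_succ, ih]; simp [pow_succ']
  apply le_antisymm
  · rw [cellIdeal, Ideal.span_le]
    rintro _ ⟨a, -, rfl⟩
    simp only [hX, SetLike.mem_coe]
    rw [← Polynomial.monomial_one_right_eq_X_pow, rehom_monomial,
      monomial_mem_cornerIdeal_iff hδ hδ', degree_fin_two, biexp_zero, biexp_one]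
    omega
  · rw [cornerIdeal, Ideal.span_le]
    rintro _ ⟨n, hn, rfl⟩
    rw [SetLike.mem_coe, ← dehom_mem_dehomPiece_iff (n := n.degree) (isHomogeneous_monomial _ rfl),
      dehom_monomial, Polynomial.monomial_one_right_eq_X_pow, ← hX]
    exact dehomPiece_mono _ (by exact_mod_cast hn) (hessSeq_mem_dehomPiece_cellIdeal hδ hδ' hP _)

end CellIdeal

end

/-! ### Corner degrees of a lex-segment ideal. -/

noncomputable section
open MvPolynomial
open Polynomial (hessSeq cellPiece hessBasis IsCellArray)

/-- Expansion along the first column of the square matrix obtained by repeating column `c` in front.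
-/
theorem Matrix.sum_mul_det_submatrix_succAbove {A : Type*} [CommRing A] {t : ℕ}
    (M : Matrix (Fin (t + 1)) (Fin t) A) (c : Fin t) :
    ∑ r : Fin (t + 1), (-1) ^ (r : ℕ) * M r c * (M.submatrix r.succAbove id).det = 0 := by
  let N : Matrix (Fin (t + 1)) (Fin (t + 1)) A := fun r => Fin.cons (M r c) (M r)
  have h0 : N.det = 0 := Matrix.det_zero_of_column_eq (i := 0) (j := c.succ)
    (Fin.succ_ne_zero c).symm fun r => by simp [N]
  rw [Matrix.det_succ_column_zero] at h0
  exact h0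

section Corners

variable {k : Type*} [Field k] (L : Ideal (MvPolynomial (Fin 2) k))

/-- The least degree of a monomial `x ^ a * y ^ b` in the monomial ideal `L`. -/
def cornerDegree (a : ℕ) : ℕ := a + expM L (expT L - a)

variable {L}

theorem monomial_biexp (a b : ℕ) :
    monomial (biexp a b) (1 : k) = X 0 ^ a * X 1 ^ b := by
  rw [monomial_fin_two, biexp_zero, biexp_one, C_1, one_mul]

theorem IsLexSegment.mem_iff (hL : IsLexSegment L) {f : MvPolynomial (Fin 2) k} :
    f ∈ L ↔ ∀ n ∈ f.support, monomial n (1 : k) ∈ L := by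
  obtain ⟨⟨A, rfl⟩, -⟩ := hL
  simp only [mem_ideal_span_monomial_image]
  refine forall₂_congr fun n _ => ?_
  simp [mem_support_iff]

/-- In the finite-dimensional quotient the variable satisfies a monic equation, and a monomial ideal
contains each monomial occurring in a member, in particular the top power. -/
theorem IsLexSegment.exists_pow_mem (hL : IsLexSegment L)
    (hfin : Module.Finite k (MvPolynomial (Fin 2) k ⧸ L)) (i : Fin 2) :
    ∃ n, (X i : MvPolynomial (Fin 2) k) ^ n ∈ L := by
  obtain ⟨p, hp, h0⟩ := Algebra.IsIntegral.isIntegral (R := k) (Ideal.Quotient.mk L (X i))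
  have h1 : Polynomial.aeval (X i : MvPolynomial (Fin 2) k) p ∈ L := by
    rw [← Ideal.Quotient.eq_zero_iff_mem]
    have := Polynomial.hom_eval₂ p (algebraMap k (MvPolynomial (Fin 2) k)) (Ideal.Quotient.mk L) (X i)
    rw [Polynomial.aeval_def, this]
    exact h0
  refine ⟨p.natDegree, ?_⟩
  have h2 := hL.mem_iff.1 h1 (Finsupp.single i p.natDegree) ?_
  · rwa [X_pow_eq_monomial]
  · rw [mem_support_iff, Polynomial.aeval_eq_sum_range, coeff_sum, Finset.sum_eq_single p.natDegree]
    · simp [X_pow_eq_monomial, hp]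
    · intro b _ hb
      rw [coeff_smul, X_pow_eq_monomial, coeff_monomial, if_neg, smul_zero]
      intro h
      exact hb (Finsupp.single_injective i h)
    · intro h
      simp at h

section

variable (hL : IsLexSegment L) (hfin : Module.Finite k (MvPolynomial (Fin 2) k ⧸ L))
include hL hfin

theorem X_pow_expT_mem : (X 0 : MvPolynomial (Fin 2) k) ^ expT L ∈ L :=
  Nat.sInf_mem (s := {n | (X 0 : MvPolynomial (Fin 2) k) ^ n ∈ L}) (hL.exists_pow_mem hfin 0)

theorem monomial_expM_mem (i : ℕ) :
    (X 0 : MvPolynomial (Fin 2) k) ^ (expT L - i) * X 1 ^ expM L i ∈ L := by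
  refine Nat.sInf_mem (s := {n | (X 0 : MvPolynomial (Fin 2) k) ^ (expT L - i) * X 1 ^ n ∈ L}) ?_
  obtain ⟨n, hn⟩ := hL.exists_pow_mem hfin 1
  exact ⟨n, L.mul_mem_left _ hn⟩

theorem expM_zero : expM L 0 = 0 := by
  refine Nat.sInf_eq_zero.2 (Or.inl ?_)
  simpa using X_pow_expT_mem hL hfin

theorem cornerDegree_of_le (a : ℕ) (ha : expT L ≤ a) : cornerDegree L a = a := by
  rw [cornerDegree, Nat.sub_eq_zero_of_le ha, expM_zero hL hfin, add_zero]

theorem monomial_mem_iff_cornerDegree_le (n : Fin 2 →₀ ℕ) :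
    monomial n (1 : k) ∈ L ↔ cornerDegree L (n 0) ≤ n.degree := by
  have hn : n = biexp (n 0) (n 1) := biexp_ext (by simp) (by simp)
  rw [hn, monomial_biexp, ← hn, degree_fin_two]
  rcases le_or_gt (expT L) (n 0) with h | h
  · rw [cornerDegree_of_le hL hfin _ h]
    refine iff_of_true (L.mul_mem_right _ ?_) (by omega)
    rw [show n 0 = expT L + (n 0 - expT L) by omega, pow_add]
    exact L.mul_mem_right _ (X_pow_expT_mem hL hfin)
  · rw [cornerDegree, add_le_add_iff_left]
    have h0 : expT L - (expT L - n 0) = n 0 := by omega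
    constructor
    · intro hm
      refine Nat.sInf_le ?_
      change _ ∈ L
      rwa [h0]
    · intro hle
      have := monomial_expM_mem hL hfin (expT L - n 0)
      rw [h0] at this
      rw [show n 1 = expM L (expT L - n 0) + (n 1 - expM L (expT L - n 0)) by omega, pow_add,
        ← mul_assoc]
      exact L.mul_mem_right _ this

theorem eq_cornerIdeal : L = cornerIdeal k (cornerDegree L) := by
  apply le_antisymm
  · intro f hf
    rw [f.as_sum]
    refine Ideal.sum_mem _ fun n hn => ?_
    rw [← mul_one (coeff n f), ← C_mul_monomial]
    refine Ideal.mul_mem_left _ _ (Ideal.subset_span ⟨n, ?_, rfl⟩)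
    exact (monomial_mem_iff_cornerDegree_le hL hfin n).1 (hL.mem_iff.1 hf n hn)
  · rw [cornerIdeal, Ideal.span_le]
    rintro _ ⟨n, hn, rfl⟩
    exact (monomial_mem_iff_cornerDegree_le hL hfin n).2 hn

/-- This is where lex-segment exchange enters: a factor `y` of the least monomial with `x`-exponent
`a` is traded for `x` in the same degree. -/
theorem cornerDegree_succ_le (a : ℕ) (ha : a < expT L) :
    cornerDegree L (a + 1) ≤ cornerDegree L a := by
  -- By minimality of `t` the ideal does not contain `x ^ a`, so a factor `y` is available.
  have h1 : 1 ≤ expM L (expT L - a) := by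
    by_contra h
    have := monomial_expM_mem hL hfin (expT L - a)
    rw [show expM L (expT L - a) = 0 by omega, pow_zero, mul_one,
      show expT L - (expT L - a) = a by omega] at this
    exact absurd (Nat.sInf_le this) (not_le.2 ha)
  have h2 : cornerDegree L a = a + expM L (expT L - a) := rfl
  have h3 : monomial (biexp a (expM L (expT L - a))) (1 : k) ∈ L := by
    rw [monomial_mem_iff_cornerDegree_le hL hfin, degree_fin_two, biexp_zero, biexp_one, h2]
  have hdeg : (biexp a (expM L (expT L - a))).degree =
      (biexp (a + 1) (expM L (expT L - a) - 1)).degree := by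
    simp only [degree_fin_two, biexp_zero, biexp_one]
    omega
  have h4 := hL.2 _ (biexp (a + 1) (expM L (expT L - a) - 1)) hdeg
    ((lex_le_fin_two hdeg).2 (by simp)) h3
  rw [monomial_mem_iff_cornerDegree_le hL hfin, ← hdeg, degree_fin_two, biexp_zero,
    biexp_zero, biexp_one] at h4
  omega

end

end Corners

/-! ### Coordinates on affine space as Hessenberg arrays. -/

section Points

variable {k K : Type*} [Field k] [Field K] (L : Ideal (MvPolynomial (Fin 2) k))

open Classical in
/-- The coordinates of a point, as an array indexed by `a = t - c - 1` and `b = t - r`. -/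
def pointArray (p : ParamIndex L → K) (a b : ℕ) : K :=
  if h : ∃ s : ParamIndex L, (s.1.1 : ℕ) + b = expT L ∧ (s.1.2 : ℕ) + a + 1 = expT L
  then p h.choose else 0

variable {L}

theorem pointArray_apply (p : ParamIndex L → K) {a b : ℕ} {s : ParamIndex L}
    (h1 : (s.1.1 : ℕ) + b = expT L) (h2 : (s.1.2 : ℕ) + a + 1 = expT L) :
    pointArray L p a b = p s := by
  have h : ∃ s : ParamIndex L, (s.1.1 : ℕ) + b = expT L ∧ (s.1.2 : ℕ) + a + 1 = expT L :=
    ⟨s, h1, h2⟩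
  rw [pointArray, dif_pos h]
  congr 1
  have h3 := h.choose_spec
  exact Subtype.ext (Prod.ext (Fin.ext (by omega)) (Fin.ext (by omega)))

theorem pointArray_of_not (p : ParamIndex L → K) {a b : ℕ}
    (h : ¬ ∃ s : ParamIndex L, (s.1.1 : ℕ) + b = expT L ∧ (s.1.2 : ℕ) + a + 1 = expT L) :
    pointArray L p a b = 0 := dif_neg h

theorem entryDegree_eq {r c a b : ℕ} (hr : r + b = expT L) (hc : c + a + 1 = expT L) :
    entryDegree L r c = cornerDegree L a + 1 - cornerDegree L b := by
  rw [entryDegree, cornerDegree, cornerDegree, show expT L - a = c + 1 by omega,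
    show expT L - b = r by omega]
  push_cast
  omega

theorem genDegree_eq {r : Fin (expT L + 1)} {b : ℕ} (hr : r + b = expT L) :
    genDegree L r = cornerDegree L b := by
  rw [genDegree, cornerDegree, show expT L - b = r by omega]
  push_cast
  omega

theorem relDegree_eq {c : Fin (expT L)} {a : ℕ} (hc : c + a + 1 = expT L) :
    relDegree L c = cornerDegree L a + 1 := by
  rw [relDegree, genDegree_eq (b := a) (by rw [Fin.val_succ]; omega)]

variable (hL : IsLexSegment L) (hfin : Module.Finite k (MvPolynomial (Fin 2) k ⧸ L))
include hL hfin

theorem expD_eq {c a : ℕ} (hc : c + a + 1 = expT L) :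
    expD L c + cornerDegree L (a + 1) = cornerDegree L a + 1 := by
  have h := cornerDegree_succ_le hL hfin a (by omega)
  rw [cornerDegree, cornerDegree, show expT L - a = c + 1 by omega,
    show expT L - (a + 1) = c by omega] at *
  rw [expD]
  omega

/-- With `a = t - c - 1` and `b = t - r`, the entry degree is `δ a + 1 - δ b` and `d_{c+1} = δ a + 1
- δ (a+1)`, so `S` is exactly the support allowed by `IsCellArray`. -/
theorem paramIndex_iff {r c a b : ℕ} (hr : r + b = expT L) (hc : c + a + 1 = expT L) :
    (c < r ∧ 0 ≤ entryDegree L r c ∧ entryDegree L r c < expD L c) ↔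
      b ≤ a ∧ cornerDegree L (a + 1) < cornerDegree L b ∧
        cornerDegree L b ≤ cornerDegree L a + 1 := by
  have := expD_eq hL hfin hc
  rw [entryDegree_eq hr hc]
  omega

theorem isCellArray_pointArray (p : ParamIndex L → K) :
    IsCellArray (cornerDegree L) (expT L) (pointArray L p) := by
  intro a b h
  have : ∃ s : ParamIndex L, (s.1.1 : ℕ) + b = expT L ∧ (s.1.2 : ℕ) + a + 1 = expT L := by
    by_contra h'
    exact h (pointArray_of_not p h')
  obtain ⟨s, h1, h2⟩ := this
  have := (paramIndex_iff hL hfin h1 h2).1 s.2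
  exact ⟨this.1, by omega, this.2⟩

omit hL hfin in
theorem pointArray_injective : Function.Injective (pointArray L (K := K)) := by
  intro p p' h
  funext s
  have h1 : (s.1.1 : ℕ) + (expT L - s.1.1) = expT L := by omega
  have h2 : (s.1.2 : ℕ) + (expT L - 1 - s.1.2) + 1 = expT L := by omega
  rw [← pointArray_apply p h1 h2, h, pointArray_apply p' h1 h2]

theorem exists_pointArray_eq {P : ℕ → ℕ → K}
    (hP : IsCellArray (cornerDegree L) (expT L) P) :
    ∃ p : ParamIndex L → K, pointArray L p = P := by
  refine ⟨fun s => P (expT L - 1 - s.1.2) (expT L - s.1.1), ?_⟩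
  funext a b
  by_cases h : ∃ s : ParamIndex L, (s.1.1 : ℕ) + b = expT L ∧ (s.1.2 : ℕ) + a + 1 = expT L
  · obtain ⟨s, h1, h2⟩ := h
    rw [pointArray_apply _ h1 h2]
    congr 1 <;> omega
  · rw [pointArray_of_not _ h]
    by_contra hne
    obtain ⟨h1, h2, h3⟩ := hP a b (Ne.symm hne)
    have hr : (expT L - b) + b = expT L := by omega
    have hc : (expT L - 1 - a) + a + 1 = expT L := by omega
    exact h ⟨⟨(⟨expT L - b, by omega⟩, ⟨expT L - 1 - a, by omega⟩),
      (paramIndex_iff hL hfin hr hc).2 ⟨h1, h3⟩⟩, hr, hc⟩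

theorem hilbertBurch_apply (p : ParamIndex L → K) {r : Fin (expT L + 1)} {c : Fin (expT L)}
    {a b : ℕ} (hr : r + b = expT L) (hc : c + a + 1 = expT L) :
    hilbertBurch L p r c =
      (if b = a + 1 then X 1 ^ (cornerDegree L a + 1 - cornerDegree L (a + 1))
        else if b = a then -X 0 else 0) +
      C (pointArray L p a b) * X 1 ^ (cornerDegree L a + 1 - cornerDegree L b) := by
  rw [hilbertBurch]
  congr 1
  · have h1 := expD_eq hL hfin hc
    have h2 : expD L c = cornerDegree L a + 1 - cornerDegree L (a + 1) := by omega
    rw [h2]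
    exact if_congr (by omega) rfl (if_congr (by omega) rfl rfl)
  · split_ifs with h
    · rw [pointArray_apply p (s := ⟨(r, c), h⟩) hr hc, entryDegree_eq hr hc]
      congr 2
      omega
    · rw [pointArray_of_not, C_0, zero_mul]
      rintro ⟨⟨⟨r', c'⟩, hs⟩, h1, h2⟩
      obtain rfl : r' = r := Fin.ext (by simp at h1; omega)
      obtain rfl : c' = c := Fin.ext (by simp at h2; omega)
      exact h hs

end Points

end

/-! ### Maximal minors and the parametrization of the cell. -/

noncomputable section
open MvPolynomial
open Polynomial (hessSeq cellPiece hessBasis IsCellArray)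

section Minors

variable {k K : Type*} [Field k] [Field K] {L : Ideal (MvPolynomial (Fin 2) k)}

/-- The maximal minors of the Hilbert-Burch matrix with alternating signs, numbered from the
last one. -/
def signedMinor (p : ParamIndex L → K) (b : ℕ) : MvPolynomial (Fin 2) K :=
  if h : b < expT L + 1 then
    (-1) ^ b * ((hilbertBurch L p).submatrix (Fin.rev ⟨b, h⟩).succAbove id).det
  else 0

theorem paramIdeal_eq_span_signedMinor (p : ParamIndex L → K) :
    paramIdeal L p = Ideal.span (signedMinor p '' Set.Iic (expT L)) := by
  apply le_antisymm
  · rw [paramIdeal, Ideal.span_le]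
    rintro _ ⟨r, rfl⟩
    have h1 : signedMinor p (Fin.rev r : Fin (expT L + 1)) ∈
        Ideal.span (signedMinor p '' Set.Iic (expT L)) :=
      Ideal.subset_span (Set.mem_image_of_mem _ (Nat.lt_succ_iff.1 (Fin.rev r).2))
    rw [signedMinor, dif_pos (Fin.rev r).2, Fin.eta, Fin.rev_rev] at h1
    have h2 := Ideal.mul_mem_left _ ((-1) ^ ((Fin.rev r : Fin (expT L + 1)) : ℕ)) h1
    rwa [← mul_assoc, ← mul_pow, neg_one_mul, neg_neg, one_pow, one_mul] at h2
  · rw [Ideal.span_le]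
    rintro _ ⟨b, hb, rfl⟩
    rw [signedMinor, dif_pos (Nat.lt_succ_iff.2 hb)]
    exact Ideal.mul_mem_left _ _ (Ideal.subset_span ⟨_, rfl⟩)

variable (hL : IsLexSegment L) (hfin : Module.Finite k (MvPolynomial (Fin 2) k ⧸ L))
include hL hfin

theorem sum_expD (n : ℕ) (hn : n ≤ expT L) : ∑ c ∈ Finset.range n, expD L c = expM L n := by
  induction n with
  | zero => rw [Finset.sum_range_zero, expM_zero hL hfin]
  | succ n ih =>
    rw [Finset.sum_range_succ, ih (by omega), expD]
    have h := cornerDegree_succ_le hL hfin (expT L - n - 1) (by omega)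
    rw [cornerDegree, cornerDegree, show expT L - (expT L - n - 1 + 1) = n by omega,
      show expT L - (expT L - n - 1) = n + 1 by omega] at h
    omega

/-- Without its last row the matrix is lower triangular with diagonal `y ^ d`, and the exponents add
up to `m_t = δ 0`. -/
theorem signedMinor_zero (p : ParamIndex L → K) : signedMinor p 0 = X 1 ^ cornerDegree L 0 := by
  rw [signedMinor, dif_pos (Nat.succ_pos _), pow_zero, one_mul]
  have hrev : (Fin.rev ⟨0, Nat.succ_pos _⟩ : Fin (expT L + 1)) = Fin.last _ := by
    ext; simp
  have hval : ∀ r c : Fin (expT L), r ≤ c →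
      (hilbertBurch L p).submatrix (Fin.last _).succAbove id r c =
        if r = c then X 1 ^ expD L c else 0 := by
    intro r c hrc
    have hrc' : (r : ℕ) ≤ c := hrc
    have hr : ((Fin.castSucc r : Fin (expT L + 1)) : ℕ) + (expT L - r) = expT L := by
      simp
    have hc : (c : ℕ) + (expT L - 1 - c) + 1 = expT L := by omega
    have h0 : pointArray L p (expT L - 1 - c) (expT L - r) = 0 := by
      by_contra h
      have := (isCellArray_pointArray hL hfin p _ _ h).1
      omega
    have hd := expD_eq hL hfin hc
    rw [Matrix.submatrix_apply, Fin.succAbove_last, id, hilbertBurch_apply hL hfin p hr hc, h0,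
      C_0, zero_mul, add_zero]
    by_cases h : r = c
    · subst h
      rw [if_pos (by omega), if_pos rfl]
      congr 1
      omega
    · have : (r : ℕ) ≠ c := fun h' => h (Fin.ext h')
      rw [if_neg (by omega), if_neg (by omega), if_neg h]
  rw [hrev, Matrix.det_of_isLowerTriangular]
  · rw [Finset.prod_congr rfl fun c _ => (hval c c le_rfl).trans (if_pos rfl),
      Finset.prod_pow_eq_pow_sum, cornerDegree, zero_add, Nat.sub_zero, ← sum_expD hL hfin _ le_rfl,
      Finset.sum_range]
  · intro r c hrc
    have hrc' : r < c := hrc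
    rw [hval r c hrc'.le, if_neg hrc'.ne]

/-- The syzygy of the minors given by column `t - 1 - a`: the entry `-x` belongs to `b = a`, the
diagonal power of `y` to `b = a + 1`, and the parameters to `b ≤ a`. -/
theorem signedMinor_succ (p : ParamIndex L → K) {a : ℕ} (ha : a < expT L) :
    X 1 ^ (cornerDegree L a + 1 - cornerDegree L (a + 1)) * signedMinor p (a + 1) =
      X 0 * signedMinor p a - ∑ b ∈ Finset.range (a + 1), C (pointArray L p a b) *
        X 1 ^ (cornerDegree L a + 1 - cornerDegree L b) * signedMinor p b := by
  let c : Fin (expT L) := ⟨expT L - 1 - a, by omega⟩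
  have hc : (c : ℕ) + a + 1 = expT L := by simp only [c]; omega
  have h0 := Matrix.sum_mul_det_submatrix_succAbove (hilbertBurch L p) c
  rw [← Equiv.sum_comp Fin.revPerm] at h0
  have h1 : ∀ b : Fin (expT L + 1), (-1) ^ ((Fin.revPerm b : Fin (expT L + 1)) : ℕ) *
      hilbertBurch L p (Fin.revPerm b) c *
      ((hilbertBurch L p).submatrix (Fin.revPerm b).succAbove id).det =
      (-1) ^ expT L * (((if (b : ℕ) = a + 1 then
        X 1 ^ (cornerDegree L a + 1 - cornerDegree L (a + 1))
        else if (b : ℕ) = a then -X 0 else 0) + C (pointArray L p a b) *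
          X 1 ^ (cornerDegree L a + 1 - cornerDegree L b)) * signedMinor p b) := by
    intro b
    have hb : ((Fin.rev b : Fin (expT L + 1)) : ℕ) + b = expT L := by
      rw [Fin.val_rev]; omega
    -- Reversing the numbering of the rows changes the signs only by the common factor `(-1) ^ t`.
    have hs : (-1 : MvPolynomial (Fin 2) K) ^ expT L * (-1) ^ (b : ℕ) =
        (-1) ^ ((Fin.rev b : Fin (expT L + 1)) : ℕ) := by
      have := congrArg (fun n => (-1 : MvPolynomial (Fin 2) K) ^ n) hb
      simp only [pow_add] at this
      rw [← this, mul_assoc, ← mul_pow, neg_one_mul, neg_neg, one_pow, mul_one]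
    rw [Fin.revPerm_apply, hilbertBurch_apply hL hfin p hb hc, signedMinor, dif_pos b.2, Fin.eta,
      ← hs]
    ring
  rw [Finset.sum_congr rfl fun b _ => h1 b, ← Finset.mul_sum] at h0
  have h2 := (mul_eq_zero.1 h0).resolve_left (pow_ne_zero _ (neg_ne_zero.2 one_ne_zero))
  rw [Fin.sum_univ_eq_sum_range (fun b => ((if b = a + 1 then
        X 1 ^ (cornerDegree L a + 1 - cornerDegree L (a + 1))
        else if b = a then -X 0 else 0) + C (pointArray L p a b) *
          X 1 ^ (cornerDegree L a + 1 - cornerDegree L b)) * signedMinor p b)] at h2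
  simp only [add_mul, Finset.sum_add_distrib] at h2
  have h3 : ∑ b ∈ Finset.range (expT L + 1), C (pointArray L p a b) *
      X 1 ^ (cornerDegree L a + 1 - cornerDegree L b) * signedMinor p b =
      ∑ b ∈ Finset.range (a + 1), C (pointArray L p a b) *
        X 1 ^ (cornerDegree L a + 1 - cornerDegree L b) * signedMinor p b := by
    refine (Finset.sum_subset (Finset.range_mono (by omega)) fun b _ hb => ?_).symm
    have : pointArray L p a b = 0 := by
      by_contra h
      have := (isCellArray_pointArray hL hfin p _ _ h).1
      rw [Finset.mem_range] at hb
      omega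
    rw [this, C_0, zero_mul, zero_mul]
  have h4 : ∑ b ∈ Finset.range (expT L + 1), (if b = a + 1 then
        X 1 ^ (cornerDegree L a + 1 - cornerDegree L (a + 1))
        else if b = a then -X 0 else 0) * signedMinor p b =
      X 1 ^ (cornerDegree L a + 1 - cornerDegree L (a + 1)) * signedMinor p (a + 1) -
        X 0 * signedMinor p a := by
    rw [← Finset.sum_subset (s₁ := {a, a + 1})]
    · rw [Finset.sum_pair (by omega), if_neg (by omega), if_pos rfl, if_pos rfl]
      ring
    · intro b hb
      simp only [Finset.mem_insert, Finset.mem_singleton] at hb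
      rw [Finset.mem_range]
      omega
    · intro b _ hb
      simp only [Finset.mem_insert, Finset.mem_singleton, not_or] at hb
      rw [if_neg hb.2, if_neg hb.1, zero_mul]
  rw [h3, h4] at h2
  linear_combination h2

/-- Both sides obey the same recursion once the power of `y` in front of the next minor is
cancelled. Where `P a b ≠ 0`, the bound `δ b ≤ δ a + 1` keeps the natural-number exponent from being
truncated. -/
theorem signedMinor_eq_rehom (p : ParamIndex L → K) (b : ℕ) (hb : b ≤ expT L) :
    signedMinor p b = rehom (cornerDegree L b) (hessSeq (pointArray L p) b) := by
  have hδ := cornerDegree_of_le hL hfin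
  have hδ' := cornerDegree_succ_le hL hfin
  have hle : ∀ b, (hessSeq (pointArray L p) b).natDegree ≤ cornerDegree L b := fun b =>
    (Polynomial.natDegree_hessSeq _ b).le.trans (Polynomial.le_of_corner hδ hδ' b)
  induction b using Nat.strong_induction_on with
  | _ b ih =>
    cases b with
    | zero =>
      rw [signedMinor_zero hL hfin, Polynomial.hessSeq_zero, ← Polynomial.monomial_zero_one,
        rehom_monomial, monomial_biexp]
      simp
    | succ a =>
      have h1 := signedMinor_succ hL hfin p (a := a) (by omega)
      have hX : (X 1 : MvPolynomial (Fin 2) K) ^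
          (cornerDegree L a + 1 - cornerDegree L (a + 1)) ≠ 0 := pow_ne_zero _ (X_ne_zero _)
      apply mul_left_cancel₀ hX
      have hd := hδ' a (by omega)
      rw [h1, X_one_pow_mul_rehom (hle _), show cornerDegree L (a + 1) +
        (cornerDegree L a + 1 - cornerDegree L (a + 1)) = cornerDegree L a + 1 by omega,
        Polynomial.hessSeq_succ, map_sub, map_sum, ih a (by omega) (by omega),
        X_zero_mul_rehom (hle a)]
      congr 1
      refine Finset.sum_congr rfl fun b hb => ?_
      rw [Finset.mem_range] at hb
      by_cases h0 : pointArray L p a b = 0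
      · rw [h0, C_0, zero_mul, zero_mul, zero_smul, map_zero]
      · have := (isCellArray_pointArray hL hfin p _ _ h0).2.2.2
        rw [ih b (by omega) (by omega), mul_assoc, X_one_pow_mul_rehom (hle _), map_smul,
          smul_eq_C_mul, show cornerDegree L b +
          (cornerDegree L a + 1 - cornerDegree L b) = cornerDegree L a + 1 by omega]

theorem paramIdeal_eq_cellIdeal (p : ParamIndex L → K) :
    paramIdeal L p = cellIdeal (cornerDegree L) (expT L) (pointArray L p) := by
  rw [paramIdeal_eq_span_signedMinor, cellIdeal]
  congr 1
  exact Set.image_congr fun b hb => signedMinor_eq_rehom hL hfin p b hb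

theorem paramIdeal_bijOn :
    Set.BijOn (paramIdeal L (A := K)) Set.univ (groebnerCell (cornerIdeal K (cornerDegree L))) := by
  have hδ := cornerDegree_of_le hL hfin
  have hδ' := cornerDegree_succ_le hL hfin
  refine ⟨fun p _ => ?_, fun p _ p' _ h => ?_, fun I hI => ?_⟩
  · rw [paramIdeal_eq_cellIdeal hL hfin]
    exact cellIdeal_mem_groebnerCell hδ hδ' (isCellArray_pointArray hL hfin p)
  · rw [paramIdeal_eq_cellIdeal hL hfin, paramIdeal_eq_cellIdeal hL hfin] at h
    exact pointArray_injective (cellIdeal_injective hδ hδ' (isCellArray_pointArray hL hfin p)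
      (isCellArray_pointArray hL hfin p') h)
  · obtain ⟨P, hP, rfl⟩ := exists_eq_cellIdeal hδ hδ' hI
    obtain ⟨p, rfl⟩ := exists_pointArray_eq hL hfin hP
    exact ⟨p, trivial, paramIdeal_eq_cellIdeal hL hfin p⟩

end Minors

end

/-! ### Degree strands of the Hilbert-Burch matrix. -/

noncomputable section
open MvPolynomial
open Polynomial (hessSeq cellPiece hessBasis IsCellArray)

namespace Polynomial

variable {K : Type*} [Field K] {δ : ℕ → ℕ} {t : ℕ} {P : ℕ → ℕ → K}

theorem hessBasis_repr_X_mul_hessSeq (hP : IsCellArray δ t P) (a b : ℕ) :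
    (hessBasis P).repr (X * hessSeq P a) b = (if b = a + 1 then 1 else 0) + P a b := by
  rw [X_mul_hessSeq]
  simp only [map_add, map_sum, map_smul, hessBasis_repr_hessSeq, Finsupp.add_apply,
    Finsupp.finsetSum_apply, Finsupp.smul_apply, smul_eq_mul, Finsupp.single_apply]
  congr 1
  · exact if_congr eq_comm rfl rfl
  · simp only [mul_ite, mul_one, mul_zero, Finset.sum_ite_eq', Finset.mem_range]
    split_ifs with h
    · rfl
    · by_contra h'
      have := (hP a b (Ne.symm h')).1
      omega

theorem corner_antitone (hδ' : ∀ a < t, δ (a + 1) ≤ δ a) {a b : ℕ} (hab : a ≤ b) (hb : b ≤ t) :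
    δ b ≤ δ a := by
  induction b, hab using Nat.le_induction with
  | base => exact le_rfl
  | succ b hab ih => exact (hδ' b (by omega)).trans (ih (by omega))

end Polynomial

section Strand

variable {k : Type*} [Field k] {L : Ideal (MvPolynomial (Fin 2) k)}
  (hL : IsLexSegment L) (hfin : Module.Finite k (MvPolynomial (Fin 2) k ⧸ L))

theorem RowIndex.cornerDegree_eq {j : ℤ} (r : RowIndex L j) :
    (cornerDegree L (expT L - r.1) : ℤ) = j := by
  rw [← genDegree_eq (r := r.1) (by omega), r.2]

theorem ColIndex.cornerDegree_eq {j : ℤ} (c : ColIndex L j) :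
    (cornerDegree L (expT L - 1 - c.1) : ℤ) + 1 = j := by
  rw [← relDegree_eq (c := c.1) (by omega), c.2]

include hL hfin

/-- Equal row and column degrees mean entry degree `0`, and `d_{c+1} ≥ 1`. A position with `r ≤ c`
would give `j = δ (t - r) ≤ δ (t - 1 - c) = j - 1`, since `δ` decreases weakly up to `t`. -/
theorem strandMatrix_position {j : ℤ} (r : RowIndex L j) (c : ColIndex L j) :
    (c.1 : ℕ) < r.1 ∧ 0 ≤ entryDegree L r.1 c.1 ∧ entryDegree L r.1 c.1 < expD L c.1 := by
  have hr : (r.1 : ℕ) + (expT L - r.1) = expT L := by omega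
  have hc : (c.1 : ℕ) + (expT L - 1 - c.1) + 1 = expT L := by omega
  have h1 := r.cornerDegree_eq
  have h2 := c.cornerDegree_eq
  have h3 := cornerDegree_succ_le hL hfin (expT L - 1 - c.1) (by omega)
  rw [paramIndex_iff hL hfin hr hc]
  refine ⟨?_, by omega, by omega⟩
  by_contra h
  have := Polynomial.corner_antitone (cornerDegree_succ_le hL hfin)
    (a := expT L - 1 - c.1) (b := expT L - r.1) (by omega) (by omega)
  omega

/-- The coordinate of the parameter space in a given position of a strand. -/
def strandParam (j : ℤ) (rc : RowIndex L j × ColIndex L j) : ParamIndex L :=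
  ⟨(rc.1.1, rc.2.1), strandMatrix_position hL hfin rc.1 rc.2⟩

theorem strandParam_injective (j : ℤ) : Function.Injective (strandParam hL hfin j) := by
  intro a b h
  have h1 := congrArg (fun s => s.1.1) h
  have h2 := congrArg (fun s => s.1.2) h
  exact Prod.ext (Subtype.ext h1) (Subtype.ext h2)

theorem strandMatrix_apply {A : Type*} [CommRing A] (p : ParamIndex L → A) {j : ℤ}
    (r : RowIndex L j) (c : ColIndex L j) :
    strandMatrix L p j r c = p (strandParam hL hfin j (r, c)) := by
  have hpos := strandMatrix_position hL hfin r c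
  have hr : (r.1 : ℕ) + (expT L - r.1) = expT L := by omega
  have hc : (c.1 : ℕ) + (expT L - 1 - c.1) + 1 = expT L := by omega
  have h1 := r.cornerDegree_eq
  have h2 := c.cornerDegree_eq
  have he : entryDegree L r.1 c.1 = 0 := by
    rw [entryDegree_eq hr hc]
    omega
  rw [strandMatrix, hilbertBurch, dif_pos hpos, map_add, he, if_neg (by omega)]
  have h0 : constantCoeff (if (r.1 : ℕ) = c.1 + 1 then -X 0 else 0 : MvPolynomial (Fin 2) A) = 0 := by
    split_ifs <;> simp
  rw [h0]
  simp [strandParam]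

end Strand

end

/-! ### The Betti number `β_{0,j}` as a corank. -/

noncomputable section
open MvPolynomial
open Polynomial (hessSeq cellPiece hessBasis IsCellArray)

section BettiZero

variable {k K : Type*} [Field k] [Field K] {L : Ideal (MvPolynomial (Fin 2) k)}

/-- The coordinates of a polynomial at the generators of degree `j` of the ideal of a point. -/
def strandCoords (p : ParamIndex L → K) (j : ℤ) : Polynomial K →ₗ[K] (RowIndex L j → K) :=
  LinearMap.pi fun r =>
    Finsupp.lapply (expT L - r.1) ∘ₗ ((hessBasis (pointArray L p)).repr : Polynomial K →ₗ[K] ℕ →₀ K)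

theorem strandCoords_apply (p : ParamIndex L → K) (j : ℤ) (g : Polynomial K) (r : RowIndex L j) :
    strandCoords p j g r = (hessBasis (pointArray L p)).repr g (expT L - r.1) := rfl

theorem strandCoords_eq_zero (p : ParamIndex L → K) {j : ℤ} {g : Polynomial K}
    (hg : g ∈ cellPiece (cornerDegree L) (pointArray L p) (j - 1)) : strandCoords p j g = 0 := by
  funext r
  rw [strandCoords_apply, Pi.zero_apply]
  by_contra h
  have := Polynomial.mem_cellPiece_iff.1 hg _ h
  rw [r.cornerDegree_eq] at this
  omega

theorem strandCoords_hessSeq (p : ParamIndex L → K) {j : ℤ} (r : RowIndex L j) :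
    strandCoords p j (hessSeq (pointArray L p) (expT L - r.1)) = Pi.single r 1 := by
  funext r'
  rw [strandCoords_apply, Polynomial.hessBasis_repr_hessSeq, Finsupp.single_apply, Pi.single_apply]
  refine if_congr ⟨fun h => Subtype.ext (Fin.ext (by omega)), fun h => by rw [h]⟩ rfl rfl

variable (hL : IsLexSegment L) (hfin : Module.Finite k (MvPolynomial (Fin 2) k ⧸ L))
include hL hfin

theorem strandMatrix_eq_pointArray (p : ParamIndex L → K) {j : ℤ}
    (r : RowIndex L j) (c : ColIndex L j) :
    strandMatrix L p j r c = pointArray L p (expT L - 1 - c.1) (expT L - r.1) := by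
  rw [strandMatrix_apply hL hfin, pointArray_apply (s := strandParam hL hfin j (r, c))]
  · change (r.1 : ℕ) + _ = _
    omega
  · change (c.1 : ℕ) + _ + 1 = _
    omega

theorem strandCoords_X_mul_hessSeq (p : ParamIndex L → K) {j : ℤ} (c : ColIndex L j) :
    strandCoords p j (Polynomial.X * hessSeq (pointArray L p) (expT L - 1 - c.1)) =
      (strandMatrix L p j).mulVecLin (Pi.single c 1) := by
  funext r
  rw [strandCoords_apply, Polynomial.hessBasis_repr_X_mul_hessSeq
    (isCellArray_pointArray hL hfin p), Matrix.mulVecLin_apply, Matrix.mulVec_single_one,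
    Matrix.col_apply, strandMatrix_eq_pointArray hL hfin]
  have h1 := (strandMatrix_position hL hfin r c).1
  rw [if_neg (by omega), zero_add]

/-- For `δ a = j - 1` and `a < t`, multiplying `η_a` by `X` produces a column of `M(p)_j`. Every
other `η_a` of level at most `j - 1` contributes nothing to the rows of degree `j`. -/
theorem strandCoords_X_mul_mem (p : ParamIndex L → K) {j : ℤ} {g : Polynomial K}
    (hg : g ∈ cellPiece (cornerDegree L) (pointArray L p) (j - 1)) :
    strandCoords p j (Polynomial.X * g) ∈ LinearMap.range (strandMatrix L p j).mulVecLin := by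
  have hP := isCellArray_pointArray hL hfin p
  have hle : cellPiece (cornerDegree L) (pointArray L p) (j - 1) ≤
      (LinearMap.range (strandMatrix L p j).mulVecLin).comap
        (strandCoords p j ∘ₗ LinearMap.mulLeft K Polynomial.X) := by
    rw [cellPiece, Submodule.span_le]
    rintro _ ⟨a, ha, rfl⟩
    have ha : (cornerDegree L a : ℤ) ≤ j - 1 := ha
    rw [Polynomial.hessBasis_apply]
    change strandCoords p j (Polynomial.X * _) ∈ LinearMap.range (strandMatrix L p j).mulVecLin
    by_cases h : a < expT L ∧ (cornerDegree L a : ℤ) + 1 = j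
    · let c : ColIndex L j := ⟨⟨expT L - 1 - a, by omega⟩, by
        rw [relDegree_eq (a := a) (by simp only; omega), h.2]⟩
      have hc : a = expT L - 1 - c.1 := by simp only [c]; omega
      rw [hc, strandCoords_X_mul_hessSeq hL hfin]
      exact LinearMap.mem_range_self _ _
    · suffices h0 : strandCoords p j (Polynomial.X * hessSeq (pointArray L p) a) = 0 by
        rw [h0]
        exact zero_mem _
      funext r
      rw [strandCoords_apply, Polynomial.hessBasis_repr_X_mul_hessSeq hP, Pi.zero_apply]
      have hr := r.cornerDegree_eq
      have h1 : pointArray L p a (expT L - r.1) = 0 := by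
        by_contra h0
        have := hP _ _ h0
        omega
      rw [h1, if_neg, zero_add]
      intro h2
      rw [h2] at hr
      have := cornerDegree_succ_le hL hfin a (by omega)
      omega
  exact hle hg

/-- The left side is membership in the degree `j` part of `𝔪 I` at `y = 1`. Modulo lower levels, the
only relations among the generators of degree `j` come from the columns of the strand. -/
theorem mem_X_mul_cellPiece_sup_iff (p : ParamIndex L → K) {j : ℤ} {g : Polynomial K}
    (hg : g ∈ cellPiece (cornerDegree L) (pointArray L p) j) :
    (∃ g' ∈ cellPiece (cornerDegree L) (pointArray L p) (j - 1),
      ∃ h ∈ cellPiece (cornerDegree L) (pointArray L p) (j - 1), g = Polynomial.X * g' + h) ↔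
    strandCoords p j g ∈ LinearMap.range (strandMatrix L p j).mulVecLin := by
  have hP := isCellArray_pointArray hL hfin p
  constructor
  · rintro ⟨g', hg', h, hh, rfl⟩
    rw [map_add, strandCoords_eq_zero p hh, add_zero]
    exact strandCoords_X_mul_mem hL hfin p hg'
  · rintro ⟨v, hv⟩
    -- Lift of the column combination `v`: subtracting `X * h` from `g` cancels its coordinates at
    -- the rows of degree `j`.
    let h := ∑ c, v c • hessSeq (pointArray L p) (expT L - 1 - c.1)
    have hh : h ∈ cellPiece (cornerDegree L) (pointArray L p) (j - 1) := by
      refine sum_mem fun c _ => Submodule.smul_mem _ _ (Polynomial.hessSeq_mem_cellPiece _ ?_)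
      have := c.cornerDegree_eq
      omega
    have hXh : Polynomial.X * h ∈ cellPiece (cornerDegree L) (pointArray L p) j := by
      have := Polynomial.X_mul_mem_cellPiece (cornerDegree_of_le hL hfin)
        (cornerDegree_succ_le hL hfin) hP hh
      rwa [sub_add_cancel] at this
    have hcoord : strandCoords p j (g - Polynomial.X * h) = 0 := by
      rw [map_sub, ← hv, sub_eq_zero]
      simp only [h, Finset.mul_sum, mul_smul_comm, map_sum, map_smul,
        strandCoords_X_mul_hessSeq hL hfin]
      conv_lhs => rw [pi_eq_sum_univ' v]
      simp only [map_sum, map_smul]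
    have hmem : g - Polynomial.X * h ∈
        (cellPiece (cornerDegree L) (pointArray L p) (j - 1)).map
          (LinearMap.mulLeft K Polynomial.X) ⊔
        cellPiece (cornerDegree L) (pointArray L p) (j - 1) := by
      rw [← (hessBasis (pointArray L p)).linearCombination_repr (g - Polynomial.X * h),
        Finsupp.linearCombination_apply]
      refine sum_mem fun b hb => Submodule.smul_mem _ _ ?_
      rw [Finsupp.mem_support_iff] at hb
      rw [Polynomial.hessBasis_apply]
      have hb' := Polynomial.mem_cellPiece_iff.1 (sub_mem hg hXh) b hb
      rcases lt_or_eq_of_le hb' with hlt | heq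
      · exact Submodule.mem_sup_right (Polynomial.hessSeq_mem_cellPiece _ (by omega))
      · rcases le_or_gt b (expT L) with hbt | hbt
        · have := congrFun hcoord ⟨⟨expT L - b, by omega⟩, by
            rw [genDegree_eq (b := b) (by simp only; omega), heq]⟩
          rw [strandCoords_apply, Pi.zero_apply, show expT L - (expT L - b) = b by omega] at this
          exact absurd this hb
        -- Beyond index `t` an element of level `j` is no new generator: it is `X η_a` with `η_a` at
        -- level `j - 1`.
        · obtain ⟨a, rfl⟩ : ∃ a, b = a + 1 := ⟨b - 1, by omega⟩
          rw [cornerDegree_of_le hL hfin _ hbt.le] at heq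
          have ha := cornerDegree_of_le hL hfin a (by omega)
          refine Submodule.mem_sup_left ⟨hessSeq (pointArray L p) a,
            Polynomial.hessSeq_mem_cellPiece _ (by omega), ?_⟩
          rw [LinearMap.mulLeft_apply, Polynomial.X_mul_hessSeq, Finset.sum_eq_zero, add_zero]
          intro b _
          rw [eq_zero_of_isCellArray hP (by omega), zero_smul]
    obtain ⟨_, ⟨g₁, hg₁, rfl⟩, g₂, hg₂, he⟩ := Submodule.mem_sup.1 hmem
    refine ⟨g₁ + h, add_mem hg₁ hh, g₂, hg₂, ?_⟩
    rw [LinearMap.mulLeft_apply] at he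
    linear_combination -he

/-- The coordinate map from `I_j` onto the cokernel of `M(p)_j` has kernel `(𝔪 I)_j`, and the
cokernel has dimension the number of rows minus the rank. -/
theorem betti0_add_rank (p : ParamIndex L → K) (j : ℤ) :
    betti0 (paramIdeal L p) j + (strandMatrix L p j).rank = Fintype.card (RowIndex L j) := by
  have hP := isCellArray_pointArray hL hfin p
  have hδ := cornerDegree_of_le hL hfin
  have hδ' := cornerDegree_succ_le hL hfin
  have hpiece := dehomPiece_cellIdeal hδ hδ' hP
  rw [paramIdeal_eq_cellIdeal hL hfin, betti0]
  set I := cellIdeal (cornerDegree L) (expT L) (pointArray L p) with hI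
  let R := LinearMap.range (strandMatrix L p j).mulVecLin
  let Φ : gradedPart I j →ₗ[K] ((RowIndex L j → K) ⧸ R) :=
    (R.mkQ ∘ₗ strandCoords p j ∘ₗ dehom.toLinearMap).domRestrict (gradedPart I j)
  have hker : LinearMap.ker Φ =
      (gradedPart (Ideal.span {X 0, X 1} * I) j).submoduleOf (gradedPart I j) := by
    ext ⟨f, hf⟩
    have hf' : dehom f ∈ cellPiece (cornerDegree L) (pointArray L p) j := by
      rw [← hpiece]
      exact ⟨f, hf, rfl⟩
    have h1 : Φ ⟨f, hf⟩ = 0 ↔ strandCoords p j (dehom f) ∈ R := Submodule.Quotient.mk_eq_zero _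
    rw [LinearMap.mem_ker, h1, ← mem_X_mul_cellPiece_sup_iff hL hfin p hf', ← hpiece,
      ← mem_mul_iff (cellIdeal_homogeneous hδ hδ' hP) hf]
    exact ⟨fun h => ⟨h, hf.2⟩, fun h => h.1⟩
  have hsurj : Function.Surjective Φ := by
    intro w
    obtain ⟨w, rfl⟩ := R.mkQ_surjective w
    have h1 : ∑ r, w r • hessSeq (pointArray L p) (expT L - r.1) ∈ dehomPiece I j := by
      rw [hpiece]
      exact sum_mem fun r _ => Submodule.smul_mem _ _
        (Polynomial.hessSeq_mem_cellPiece _ r.cornerDegree_eq.le)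
    obtain ⟨f, hf, he⟩ := h1
    have he : dehom f = _ := he
    refine ⟨⟨f, hf⟩, ?_⟩
    change R.mkQ (strandCoords p j (dehom f)) = _
    rw [he, map_sum]
    simp only [map_smul, strandCoords_hessSeq]
    conv_rhs => rw [pi_eq_sum_univ' w]
  rw [← hker, (Φ.quotKerEquivOfSurjective hsurj).finrank_eq, Matrix.rank]
  have := R.finrank_quotient_add_finrank
  rwa [Module.finrank_fintype_fun_eq_card] at this

theorem eq_paramIdeal_zero : paramIdeal L (0 : ParamIndex L → k) = L := by
  have h0 : pointArray L (0 : ParamIndex L → k) = 0 := by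
    funext a b
    rw [pointArray]
    split_ifs <;> rfl
  rw [paramIdeal_eq_cellIdeal hL hfin, h0, cellIdeal_zero (cornerDegree_of_le hL hfin)
    (cornerDegree_succ_le hL hfin), ← eq_cornerIdeal hL hfin]

theorem card_rowIndex (j : ℤ) : Fintype.card (RowIndex L j) = betti0 L j := by
  have h1 := betti0_add_rank hL hfin (0 : ParamIndex L → k) j
  have h2 : strandMatrix L (0 : ParamIndex L → k) j = 0 := by
    ext r c
    rw [strandMatrix_apply hL hfin]
    rfl
  rw [eq_paramIdeal_zero hL hfin, h2, Matrix.rank_zero, add_zero] at h1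
  exact h1.symm

end BettiZero

end

/-! ### The Betti number `β_{1,j}` from the Koszul Euler characteristic. -/

noncomputable section
open MvPolynomial
open Polynomial (hessSeq cellPiece hessBasis IsCellArray)

section Euler

variable {K : Type*} [Field K] {I : Ideal (MvPolynomial (Fin 2) K)}

/-- Dehomogenization identifies the elements of degree `D` of `I` with a space of polynomials. -/
def gradedPartEquiv (I : Ideal (MvPolynomial (Fin 2) K)) (D : ℤ) :
    gradedPart I D ≃ₗ[K] dehomPiece I D :=
  (LinearEquiv.ofInjective (dehom.toLinearMap.domRestrict (gradedPart I D)) fun f f' h =>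
    Subtype.ext (dehom_injOn_gradedPart f.2 f'.2 h)).trans
    (LinearEquiv.ofEq _ _ (LinearMap.range_domRestrict _ _))

theorem gradedPart_mono {I J : Ideal (MvPolynomial (Fin 2) K)} (h : I ≤ J) (D : ℤ) :
    gradedPart I D ≤ gradedPart J D := fun _ hf => ⟨h hf.1, hf.2⟩

theorem mem_gradedPart_mul_iff (hI : ∀ f ∈ I, ∀ d : ℕ, homogeneousComponent d f ∈ I) {D : ℤ}
    {f : MvPolynomial (Fin 2) K} :
    f ∈ gradedPart (Ideal.span {X 0, X 1} * I) D ↔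
      ∃ a ∈ gradedPart I (D - 1), ∃ b ∈ gradedPart I (D - 1), X 0 * a + X 1 * b = f := by
  have key : ∀ a ∈ gradedPart I (D - 1), ∀ b ∈ gradedPart I (D - 1),
      X 0 * a + X 1 * b ∈ gradedPart I D := by
    intro a ha b hb
    have h1 := mul_X_mem_gradedPart ha 0
    have h2 := mul_X_mem_gradedPart hb 1
    rw [sub_add_cancel] at h1 h2
    exact add_mem h1 h2
  constructor
  · intro hf
    have hf' : f ∈ gradedPart I D := gradedPart_mono Ideal.mul_le_right D hf
    obtain ⟨_, ⟨a, ha, rfl⟩, _, ⟨b, hb, rfl⟩, he⟩ := (mem_mul_iff hI hf').1 hf.1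
    refine ⟨a, ha, b, hb, dehom_injOn_gradedPart (key a ha b hb) hf' ?_⟩
    simpa [dehom_X_zero, dehom_X_one] using he.symm
  · rintro ⟨a, ha, b, hb, rfl⟩
    refine ⟨?_, (key a ha b hb).2⟩
    have h0 : ∀ i, X i ∈ Ideal.span {(X 0 : MvPolynomial (Fin 2) K), X 1} := fun i =>
      Ideal.subset_span (by fin_cases i <;> simp)
    exact add_mem (Ideal.mul_mem_mul (h0 0) ha.1) (Ideal.mul_mem_mul (h0 1) hb.1)

theorem koszulBoundaries_le_koszulCycles (j : ℤ) : koszulBoundaries I j ≤ koszulCycles I j := by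
  rintro _ ⟨c, hc, rfl⟩
  have h : ∀ i, X i * c ∈ gradedPart I (j - 1) := fun i => by
    have := mul_X_mem_gradedPart hc i
    rwa [show j - 2 + 1 = j - 1 by ring] at this
  refine ⟨⟨?_, h 0⟩, ?_⟩
  · change -X 1 * c ∈ _
    rw [neg_mul]
    exact neg_mem (h 1)
  · rw [SetLike.mem_coe, LinearMap.mem_ker]
    change X 0 * (-X 1 * c) + X 1 * (X 0 * c) = 0
    ring

/-- Dimension count in `I_{j-2} → I_{j-1} ⊕ I_{j-1} → I_j`: the first map is injective and the image
of the second is `(𝔪 I)_j`. -/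
theorem betti_euler_characteristic (hI : ∀ f ∈ I, ∀ d : ℕ, homogeneousComponent d f ∈ I)
    (hfd : ∀ D, FiniteDimensional K (gradedPart I D)) (j : ℤ) :
    betti1 I j + Module.finrank K (gradedPart I (j - 2)) + Module.finrank K (gradedPart I j) =
      2 * Module.finrank K (gradedPart I (j - 1)) + betti0 I j := by
  let V := (gradedPart I (j - 1)).prod (gradedPart I (j - 1))
  let φ := (LinearMap.mulLeft K (X 0 : MvPolynomial (Fin 2) K)).coprod (LinearMap.mulLeft K (X 1))
  let B := gradedPart (Ideal.span {X 0, X 1} * I) j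
  have hVe : V ≃ₗ[K] gradedPart I (j - 1) × gradedPart I (j - 1) := 
    { toFun := fun x => (⟨x.1.1, x.2.1⟩, ⟨x.1.2, x.2.2⟩)
      invFun := fun y => ⟨(y.1, y.2), y.1.2, y.2.2⟩
      map_add' := fun _ _ => rfl
      map_smul' := fun _ _ => rfl }
  have hV : Module.finrank K V = 2 * Module.finrank K (gradedPart I (j - 1)) := by
    rw [hVe.finrank_eq, Module.finrank_prod, two_mul]
  have : FiniteDimensional K V := Module.Finite.equiv hVe.symm
  have hrange : LinearMap.range (φ.domRestrict V) = B := by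
    rw [LinearMap.range_domRestrict]
    ext f
    rw [mem_gradedPart_mul_iff hI]
    constructor
    · rintro ⟨⟨a, b⟩, ⟨ha, hb⟩, rfl⟩
      exact ⟨a, ha, b, hb, rfl⟩
    · rintro ⟨a, ha, b, hb, rfl⟩
      exact ⟨(a, b), ⟨ha, hb⟩, rfl⟩
  have hker : Module.finrank K (LinearMap.ker (φ.domRestrict V)) =
      Module.finrank K (koszulCycles I j) := by
    have : koszulCycles I j = (LinearMap.ker (φ.domRestrict V)).map V.subtype := by
      rw [LinearMap.ker_domRestrict, Submodule.map_comap_subtype]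
      rfl
    rw [this, LinearEquiv.finrank_eq (Submodule.equivMapOfInjective _ V.injective_subtype _)]
  have h1 := LinearMap.finrank_range_add_finrank_ker (φ.domRestrict V)
  rw [hrange, hker, hV] at h1
  have hB : B ≤ gradedPart I j := gradedPart_mono Ideal.mul_le_right j
  have h2 := (B.submoduleOf (gradedPart I j)).finrank_quotient_add_finrank
  rw [(Submodule.submoduleOfEquivOfLe hB).finrank_eq] at h2
  have : FiniteDimensional K (koszulCycles I j) :=
    Module.Finite.of_injective (Submodule.inclusion (inf_le_left : koszulCycles I j ≤ V))
      (Submodule.inclusion_injective _)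
  have h3 := ((koszulBoundaries I j).submoduleOf (koszulCycles I j)).finrank_quotient_add_finrank
  have hbd : Module.finrank K (koszulBoundaries I j) = Module.finrank K (gradedPart I (j - 2)) := by
    refine (LinearEquiv.finrank_eq (Submodule.equivMapOfInjective _ ?_ _)).symm
    intro c c' h
    exact mul_left_cancel₀ (X_ne_zero 0) (congrArg Prod.snd h)
  rw [(Submodule.submoduleOfEquivOfLe (koszulBoundaries_le_koszulCycles j)).finrank_eq, hbd] at h3
  change betti0 I j + _ = _ at h2
  change betti1 I j + _ = _ at h3
  omega

end Euler

theorem Polynomial.finrank_cellPiece {K : Type*} [Field K] (δ : ℕ → ℕ) (P : ℕ → ℕ → K) {D : ℤ}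
    (s : Finset ℕ) (hs : ∀ a, a ∈ s ↔ (δ a : ℤ) ≤ D) :
    Module.finrank K (cellPiece δ P D) = s.card ∧ FiniteDimensional K (cellPiece δ P D) := by
  have h : cellPiece δ P D = Submodule.span K (Set.range fun a : s => hessBasis P a) := by
    rw [cellPiece, Set.image_eq_range]
    congr 1
    ext g
    simp [hs]
  rw [h]
  refine ⟨?_, FiniteDimensional.span_of_finite K (Set.finite_range _)⟩
  rw [finrank_span_eq_card, Fintype.card_coe]
  exact (hessBasis P).linearIndependent.comp _ Subtype.val_injective

section BettiOne

variable {k : Type*} [Field k] {L : Ideal (MvPolynomial (Fin 2) k)}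

theorem card_rowIndex_eq_card_filter {j : ℤ} {M : ℕ} (hM : expT L < M) :
    Fintype.card (RowIndex L j) = ((Finset.range M).filter fun b =>
      b ≤ expT L ∧ (cornerDegree L b : ℤ) = j).card := by
  rw [← Finset.card_univ]
  refine Finset.card_bij (fun r _ => expT L - r.1) (fun r _ => ?_) (fun r _ r' _ h => ?_)
    fun b hb => ?_
  · have := r.cornerDegree_eq
    simp only [Finset.mem_filter, Finset.mem_range]
    omega
  · exact Subtype.ext (Fin.ext (by omega))
  · simp only [Finset.mem_filter, Finset.mem_range] at hb
    refine ⟨⟨⟨expT L - b, by omega⟩, ?_⟩, Finset.mem_univ _, ?_⟩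
    · rw [genDegree_eq (b := b) (by simp only; omega), hb.2.2]
    · simp only
      omega

theorem card_colIndex_eq_card_filter {j : ℤ} {M : ℕ} (hM : expT L < M) :
    Fintype.card (ColIndex L j) = ((Finset.range M).filter fun a =>
      a < expT L ∧ (cornerDegree L a : ℤ) + 1 = j).card := by
  rw [← Finset.card_univ]
  refine Finset.card_bij (fun c _ => expT L - 1 - c.1) (fun c _ => ?_) (fun c _ c' _ h => ?_)
    fun a ha => ?_
  · have := c.cornerDegree_eq
    simp only [Finset.mem_filter, Finset.mem_range]
    omega
  · exact Subtype.ext (Fin.ext (by omega))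
  · simp only [Finset.mem_filter, Finset.mem_range] at ha
    refine ⟨⟨⟨expT L - 1 - a, by omega⟩, ?_⟩, Finset.mem_univ _, ?_⟩
    · rw [relDegree_eq (a := a) (by simp only; omega), ha.2.2]
    · simp only
      omega

variable (hL : IsLexSegment L) (hfin : Module.Finite k (MvPolynomial (Fin 2) k ⧸ L))
include hL hfin

theorem finrank_gradedPart {D : ℤ} {M : ℕ} (hM : D < M) :
    Module.finrank k (gradedPart L D) =
      ((Finset.range M).filter fun a => (cornerDegree L a : ℤ) ≤ D).card ∧
    FiniteDimensional k (gradedPart L D) := by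
  have hδ := cornerDegree_of_le hL hfin
  have hδ' := cornerDegree_succ_le hL hfin
  have hP := isCellArray_pointArray hL hfin (0 : ParamIndex L → k)
  have h1 : dehomPiece L D = cellPiece (cornerDegree L) (pointArray L (0 : ParamIndex L → k)) D := by
    rw [← dehomPiece_cellIdeal hδ hδ' hP, ← paramIdeal_eq_cellIdeal hL hfin,
      eq_paramIdeal_zero hL hfin]
  have h2 := Polynomial.finrank_cellPiece (cornerDegree L) (pointArray L (0 : ParamIndex L → k))
    (D := D) ((Finset.range M).filter fun a => (cornerDegree L a : ℤ) ≤ D) fun a => by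
      have := Polynomial.le_of_corner hδ hδ' a
      simp only [Finset.mem_filter, Finset.mem_range]
      omega
  rw [← h1] at h2
  have := h2.2
  exact ⟨by rw [(gradedPartEquiv L D).finrank_eq, h2.1],
    Module.Finite.equiv (gradedPartEquiv L D).symm⟩

/-- The dimension of `L_D` counts the `a` with `δ a ≤ D`; its second difference counts `δ a = j`
minus `δ a = j - 1`. With the rows already identified with `β_{0,j}`, the Euler characteristic
leaves the columns. -/
theorem card_colIndex (j : ℤ) : Fintype.card (ColIndex L j) = betti1 L j := by
  have hhom : ∀ f ∈ L, ∀ d : ℕ, homogeneousComponent d f ∈ L := by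
    rw [← eq_paramIdeal_zero hL hfin, paramIdeal_eq_cellIdeal hL hfin]
    exact cellIdeal_homogeneous (cornerDegree_of_le hL hfin) (cornerDegree_succ_le hL hfin)
      (isCellArray_pointArray hL hfin _)
  -- Since `a ≤ δ a`, this range contains every `a` with `δ a ≤ j`, and also every `a ≤ t`.
  let M := j.toNat + expT L + 1
  have h := betti_euler_characteristic hhom
    (fun D => (finrank_gradedPart hL hfin (M := D.toNat + 1) (by omega)).2) j
  rw [(finrank_gradedPart hL hfin (M := M) (by omega)).1,
    (finrank_gradedPart hL hfin (M := M) (by omega)).1,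
    (finrank_gradedPart hL hfin (M := M) (by omega)).1, ← card_rowIndex hL hfin,
    card_rowIndex_eq_card_filter (M := M) (by omega)] at h
  rw [card_colIndex_eq_card_filter (M := M) (by omega)]
  -- Past `t`, where `δ a = a`, the indices belong to no row or column; the two tails cancel after a
  -- shift by one.
  have h1 : ((Finset.range M).filter fun a : ℕ => expT L ≤ a ∧ (a : ℤ) + 1 = j).card =
      ((Finset.range M).filter fun a : ℕ => expT L < a ∧ (a : ℤ) = j).card := by
    refine Finset.card_nbij' (· + 1) (· - 1) ?_ ?_ ?_ ?_ <;> intro a ha <;>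
      simp only [Finset.coe_filter, Finset.mem_range, Set.mem_ofPred_eq] at * <;> omega
  have h2 : ∑ a ∈ Finset.range M, ((if (cornerDegree L a : ℤ) ≤ j then 1 else 0) +
      (if (cornerDegree L a : ℤ) ≤ j - 2 then 1 else 0) +
      (if a < expT L ∧ (cornerDegree L a : ℤ) + 1 = j then 1 else 0) +
      (if expT L ≤ a ∧ (a : ℤ) + 1 = j then 1 else 0)) =
      ∑ a ∈ Finset.range M, (2 * (if (cornerDegree L a : ℤ) ≤ j - 1 then 1 else 0) +
      (if a ≤ expT L ∧ (cornerDegree L a : ℤ) = j then 1 else 0) +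
      (if expT L < a ∧ (a : ℤ) = j then 1 else 0)) := by
    refine Finset.sum_congr rfl fun a _ => ?_
    have := cornerDegree_of_le hL hfin a
    split_ifs <;> omega
  simp only [Finset.sum_add_distrib, ← Finset.mul_sum, ← Finset.card_filter] at h2
  omega

end BettiOne

end

/-! ### Betti strata as rank loci. -/

noncomputable section
open MvPolynomial

namespace Matrix

theorem exists_rank_eq (K : Type*) [Field K] {W V : Type*} [Fintype W] [Fintype V] {r : ℕ}
    (hW : r ≤ Fintype.card W) (hV : r ≤ Fintype.card V) :
    ∃ N : Matrix W V K, N.rank = r := by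
  classical
  obtain ⟨e⟩ := Function.Embedding.nonempty_of_card_le (α := Fin r) (β := W) (by simpa using hW)
  obtain ⟨f⟩ := Function.Embedding.nonempty_of_card_le (α := Fin r) (β := V) (by simpa using hV)
  let A : Matrix W (Fin r) K := of fun i a => if e a = i then 1 else 0
  let B : Matrix (Fin r) V K := of fun a j => if f a = j then 1 else 0
  refine ⟨A * B, le_antisymm ?_ ?_⟩
  · simpa using rank_mul_le_card A B
  · have h : (A * B).submatrix e f = 1 := by
      ext a b
      simp [A, B, mul_apply, one_apply, eq_comm]
    simpa using (A * B).le_rank_of_submatrix_det_ne_zero e f (by rw [h]; simp)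

end Matrix

section Strata

variable {k K : Type*} [Field k] [Field K] {L : Ideal (MvPolynomial (Fin 2) k)}
  (hL : IsLexSegment L) (hfin : Module.Finite k (MvPolynomial (Fin 2) k ⧸ L))
include hL hfin

theorem betti0_paramIdeal_add_rank (p : ParamIndex L → K) (j : ℤ) :
    betti0 (paramIdeal L p) j + (strandMatrix L p j).rank = betti0 L j := by
  rw [betti0_add_rank hL hfin, card_rowIndex hL hfin]

theorem paramIdeal_mem_bettiStratumGE_iff (p : ParamIndex L → K) (j : ℤ) (u : ℕ) :
    paramIdeal L p ∈ bettiStratumGE (cornerIdeal K (cornerDegree L)) j u ↔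
      (strandMatrix L p j).rank + u ≤ betti0 L j := by
  have h := betti0_paramIdeal_add_rank hL hfin p j
  have h1 := (paramIdeal_bijOn hL hfin (K := K)).mapsTo (Set.mem_univ p)
  constructor
  · rintro ⟨-, h2⟩
    omega
  · exact fun h2 => ⟨h1, by omega⟩

theorem paramIdeal_mem_bettiStratum_iff (p : ParamIndex L → K) (j : ℤ) (u : ℕ) :
    paramIdeal L p ∈ bettiStratum (cornerIdeal K (cornerDegree L)) j u ↔
      (strandMatrix L p j).rank + u = betti0 L j := by
  have h := betti0_paramIdeal_add_rank hL hfin p j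
  have h1 := (paramIdeal_bijOn hL hfin (K := K)).mapsTo (Set.mem_univ p)
  constructor
  · rintro ⟨-, h2⟩
    omega
  · exact fun h2 => ⟨h1, by omega⟩

/-- The corner degrees do not change under field extension, so the parametrization and the rank
formula apply verbatim over the residue field. -/
theorem baseChangeAt_eq_cornerIdeal (q : PrimeSpectrum (MvPolynomial (ParamIndex L) k)) :
    baseChangeAt L q = cornerIdeal q.asIdeal.ResidueField (cornerDegree L) := by
  rw [baseChangeAt]
  conv_lhs =>
    arg 2
    rw [eq_cornerIdeal hL hfin]
  rw [cornerIdeal, cornerIdeal, Ideal.map_span, Set.image_image]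
  simp only [map_monomial, map_one]

theorem strandMatrix_eq_variableMatrix_map {A : Type*} [CommRing A] (j : ℤ)
    (φ : MvPolynomial (ParamIndex L) k → A) :
    strandMatrix L (fun s => φ (X s)) j =
      (variableMatrix k (strandParam hL hfin j)).map φ := by
  ext r c
  rw [strandMatrix_apply hL hfin]
  rfl

theorem specStratumGE_eq (j : ℤ) (u : ℕ) :
    specStratumGE L j u = {q | (strandMatrix L (coordsAt L q) j).rank + u ≤ betti0 L j} := by
  ext q
  rw [specStratumGE, Set.mem_ofPred_eq, baseChangeAt_eq_cornerIdeal hL hfin,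
    paramIdeal_mem_bettiStratumGE_iff hL hfin, Set.mem_ofPred_eq]

theorem strandMatrix_rank_le (p : ParamIndex L → K) (j : ℤ) :
    (strandMatrix L p j).rank ≤ betti1 L j :=
  (Matrix.rank_le_card_width _).trans (card_colIndex hL hfin j).le

theorem specStratumGE_eq_specRankLE {j : ℤ} {u : ℕ} (hu : u ≤ betti0 L j) :
    specStratumGE L j u =
      specRankLE k (strandParam hL hfin j) (min (betti0 L j - u) (betti1 L j)) := by
  ext q
  have h := strandMatrix_rank_le hL hfin (coordsAt L q) j
  rw [specStratumGE_eq hL hfin, specRankLE, Set.mem_ofPred_eq, Set.mem_ofPred_eq,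
    ← strandMatrix_eq_variableMatrix_map hL hfin]
  change _ ↔ (strandMatrix L (coordsAt L q) j).rank ≤ _
  omega

theorem specStratum_eq_specRankEQ {j : ℤ} {u : ℕ} (hu : u ≤ betti0 L j) :
    specStratum L j u = specRankEQ k (strandParam hL hfin j) (betti0 L j - u) := by
  ext q
  rw [specStratum, specRankEQ, Set.mem_ofPred_eq, Set.mem_ofPred_eq,
    ← strandMatrix_eq_variableMatrix_map hL hfin, baseChangeAt_eq_cornerIdeal hL hfin,
    paramIdeal_mem_bettiStratum_iff hL hfin]
  change _ ↔ (strandMatrix L (coordsAt L q) j).rank = _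
  omega

theorem mem_pointStratumGE_iff {j : ℤ} {u : ℕ} {p : ParamIndex L → k} :
    p ∈ pointStratumGE L j u ↔ (strandMatrix L p j).rank + u ≤ betti0 L j := by
  rw [← paramIdeal_mem_bettiStratumGE_iff hL hfin, ← eq_cornerIdeal hL hfin]
  rfl

theorem mem_pointStratum_iff {j : ℤ} {u : ℕ} {p : ParamIndex L → k} :
    p ∈ pointStratum L j u ↔ (strandMatrix L p j).rank + u = betti0 L j := by
  rw [← paramIdeal_mem_bettiStratum_iff hL hfin, ← eq_cornerIdeal hL hfin]
  rfl

theorem strandMatrix_eq_eval (p : ParamIndex L → k) (j : ℤ) :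
    strandMatrix L p j = (variableMatrix k (strandParam hL hfin j)).map (eval p) := by
  rw [← strandMatrix_eq_variableMatrix_map hL hfin]
  simp only [eval_X]

theorem pointStratumGE_eq_pointRankLE {j : ℤ} {u : ℕ} (hu : u ≤ betti0 L j) :
    pointStratumGE L j u =
      pointRankLE k (strandParam hL hfin j) (min (betti0 L j - u) (betti1 L j)) := by
  ext p
  have h := strandMatrix_rank_le hL hfin p j
  rw [mem_pointStratumGE_iff hL hfin, pointRankLE, Set.mem_ofPred_eq,
    ← strandMatrix_eq_eval hL hfin]
  omega

theorem pointStratum_eq_pointRankEQ {j : ℤ} {u : ℕ} (hu : u ≤ betti0 L j) :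
    pointStratum L j u = pointRankEQ k (strandParam hL hfin j) (betti0 L j - u) := by
  ext p
  rw [mem_pointStratum_iff hL hfin, pointRankEQ, Set.mem_ofPred_eq,
    ← strandMatrix_eq_eval hL hfin]
  omega

theorem paramIdeal_bijOn_groebnerCell :
    Set.BijOn (paramIdeal L (A := k)) Set.univ (groebnerCell L) := by
  have h := paramIdeal_bijOn hL hfin (K := k)
  rwa [← eq_cornerIdeal hL hfin] at h

theorem bettiStratumGE_eq_image (j : ℤ) (u : ℕ) :
    bettiStratumGE L j u = paramIdeal L '' pointStratumGE L j u := by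
  ext I
  constructor
  · intro h
    obtain ⟨p, -, rfl⟩ := (paramIdeal_bijOn_groebnerCell hL hfin).surjOn h.1
    exact ⟨p, h, rfl⟩
  · rintro ⟨p, h, rfl⟩
    exact h

theorem bettiStratum_eq_image (j : ℤ) (u : ℕ) :
    bettiStratum L j u = paramIdeal L '' pointStratum L j u := by
  ext I
  constructor
  · intro h
    obtain ⟨p, -, rfl⟩ := (paramIdeal_bijOn_groebnerCell hL hfin).surjOn h.1
    exact ⟨p, h, rfl⟩
  · rintro ⟨p, h, rfl⟩
    exact h

/-- The entries of the strand are distinct coordinates, so any matrix of its size, in particular one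
of rank `β_{0,j}(L) - u`, occurs at a rational point, over any field. -/
theorem pointStratum_nonempty {j : ℤ} {u : ℕ} (h : betti0 L j ≤ betti1 L j + u)
    (hu : u ≤ betti0 L j) : (pointStratum L j u).Nonempty := by
  obtain ⟨N, hN⟩ := Matrix.exists_rank_eq k (W := RowIndex L j) (V := ColIndex L j)
    (r := betti0 L j - u) (by rw [card_rowIndex hL hfin]; omega)
    (by rw [card_colIndex hL hfin]; omega)
  obtain ⟨p, hp⟩ := exists_eval_variableMatrix (strandParam_injective hL hfin j) N
  refine ⟨p, ?_⟩
  rw [pointStratum_eq_pointRankEQ hL hfin hu, pointRankEQ, Set.mem_ofPred_eq, hp, hN]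

theorem bettiStratumGE_nonempty_iff (j : ℤ) (u : ℕ) :
    (bettiStratumGE L j u).Nonempty ↔ u ≤ betti0 L j := by
  rw [bettiStratumGE_eq_image hL hfin, Set.image_nonempty]
  constructor
  · rintro ⟨p, hp⟩
    rw [mem_pointStratumGE_iff hL hfin] at hp
    omega
  · intro h
    obtain ⟨p, hp⟩ := pointStratum_nonempty hL hfin (j := j) (u := betti0 L j) (by omega) le_rfl
    refine ⟨p, (mem_pointStratumGE_iff hL hfin).2 ?_⟩
    rw [mem_pointStratum_iff hL hfin] at hp
    omega

theorem bettiStratum_nonempty_iff (j : ℤ) (u : ℕ) :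
    (bettiStratum L j u).Nonempty ↔ betti0 L j ≤ betti1 L j + u ∧ u ≤ betti0 L j := by
  rw [bettiStratum_eq_image hL hfin, Set.image_nonempty]
  constructor
  · rintro ⟨p, hp⟩
    rw [mem_pointStratum_iff hL hfin] at hp
    have := strandMatrix_rank_le hL hfin p j
    omega
  · exact fun h => pointStratum_nonempty hL hfin h.1 h.2

theorem isIrreducible_specStratumGE {j : ℤ} {u : ℕ} (hu : u ≤ betti0 L j) :
    IsIrreducible (specStratumGE L j u) := by
  rw [specStratumGE_eq_specRankLE hL hfin hu]
  exact isIrreducible_specRankLE (strandParam_injective hL hfin j)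

theorem specStratumGE_nonempty_iff (j : ℤ) (u : ℕ) :
    (specStratumGE L j u).Nonempty ↔ u ≤ betti0 L j := by
  constructor
  · rintro ⟨q, hq⟩
    rw [specStratumGE_eq hL hfin, Set.mem_ofPred_eq] at hq
    omega
  · exact fun h => (isIrreducible_specStratumGE hL hfin h).nonempty

theorem specStratum_nonempty_iff (j : ℤ) (u : ℕ) :
    (specStratum L j u).Nonempty ↔ betti0 L j ≤ betti1 L j + u ∧ u ≤ betti0 L j := by
  constructor
  · rintro ⟨q, hq⟩
    rw [specStratum, Set.mem_ofPred_eq, baseChangeAt_eq_cornerIdeal hL hfin,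
      paramIdeal_mem_bettiStratum_iff hL hfin] at hq
    have := strandMatrix_rank_le hL hfin (coordsAt L q) j
    omega
  · rintro ⟨h, hu⟩
    rw [specStratum_eq_specRankEQ hL hfin hu]
    exact ⟨_, genericPoint_mem_specRankEQ (strandParam_injective hL hfin j)
      (by rw [card_rowIndex hL hfin]; omega) (by rw [card_colIndex hL hfin]; omega)⟩

/-- For `r = β_{0,j} - u` the corank factors are `β_{0,j} - r = u` and `β_{1,j} - r = β_{1,j} + u -
β_{0,j}`; the hypotheses keep both subtractions exact. -/
theorem height_rankIdeal_strandParam {j : ℤ} {u : ℕ} (h : betti0 L j ≤ betti1 L j + u)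
    (hu : u ≤ betti0 L j) :
    (rankIdeal k (strandParam hL hfin j) (Fin (betti0 L j - u))).height =
      (((betti1 L j + u - betti0 L j) * u : ℕ) : ℕ∞) := by
  rw [height_rankIdeal (strandParam_injective hL hfin j)
    (by rw [card_rowIndex hL hfin]; omega) (by rw [card_colIndex hL hfin]; omega),
    card_rowIndex hL hfin, card_colIndex hL hfin, mul_comm]
  congr 2 <;> omega

theorem closure_specStratum {j : ℤ} {u : ℕ} (h : betti0 L j ≤ betti1 L j + u)
    (hu : u ≤ betti0 L j) : closure (specStratum L j u) = specStratumGE L j u := by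
  rw [specStratum_eq_specRankEQ hL hfin hu, specStratumGE_eq_specRankLE hL hfin hu,
    min_eq_left (by omega)]
  exact closure_specRankEQ (strandParam_injective hL hfin j)
    (by rw [card_rowIndex hL hfin]; omega) (by rw [card_colIndex hL hfin]; omega)

theorem height_vanishingIdeal_specStratumGE {j : ℤ} {u : ℕ} (h : betti0 L j ≤ betti1 L j + u)
    (hu : u ≤ betti0 L j) : (PrimeSpectrum.vanishingIdeal (specStratumGE L j u)).height =
      (((betti1 L j + u - betti0 L j) * u : ℕ) : ℕ∞) := by
  rw [specStratumGE_eq_specRankLE hL hfin hu,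
    vanishingIdeal_specRankLE (strandParam_injective hL hfin j), min_eq_left (by omega),
    height_rankIdeal_strandParam hL hfin h hu]

theorem isIrreducible_pointStratumGE [Infinite k] {j : ℤ} {u : ℕ} (hu : u ≤ betti0 L j) :
    @IsIrreducible _ (zariskiTopology k (ParamIndex L)) (pointStratumGE L j u) := by
  apply isIrreducible_zariskiTopology_of_isPrime
  rw [pointStratumGE_eq_pointRankLE hL hfin hu,
    vanishingIdeal_pointRankLE (strandParam_injective hL hfin j)]
  infer_instance

theorem closure_pointStratum [Infinite k] {j : ℤ} {u : ℕ} (h : betti0 L j ≤ betti1 L j + u)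
    (hu : u ≤ betti0 L j) :
    @closure _ (zariskiTopology k (ParamIndex L)) (pointStratum L j u) = pointStratumGE L j u := by
  rw [closure_zariskiTopology, pointStratum_eq_pointRankEQ hL hfin hu,
    pointStratumGE_eq_pointRankLE hL hfin hu, min_eq_left (by omega),
    vanishingIdeal_pointRankEQ (strandParam_injective hL hfin j)
      (by rw [card_rowIndex hL hfin]; omega) (by rw [card_colIndex hL hfin]; omega),
    pointRankLE_eq_zeroLocus (strandParam_injective hL hfin j)]

theorem height_vanishingIdeal_pointStratumGE [Infinite k] {j : ℤ} {u : ℕ}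
    (h : betti0 L j ≤ betti1 L j + u) (hu : u ≤ betti0 L j) :
    (MvPolynomial.vanishingIdeal k (pointStratumGE L j u)).height =
      (((betti1 L j + u - betti0 L j) * u : ℕ) : ℕ∞) := by
  rw [pointStratumGE_eq_pointRankLE hL hfin hu,
    vanishingIdeal_pointRankLE (strandParam_injective hL hfin j), min_eq_left (by omega),
    height_rankIdeal_strandParam hL hfin h hu]

end Strata

end

theorem mainTheorem5 {k : Type*} [Field k] (L : Ideal (MvPolynomial (Fin 2) k))
    (hL : IsLexSegment L) (hfin : Module.Finite k (MvPolynomial (Fin 2) k ⧸ L)) (j : ℤ) :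
    -- the points of affine space correspond to the ideals in `V(L)`
    Set.BijOn (paramIdeal L (A := k)) Set.univ (groebnerCell L) ∧
    -- `M(p)_j` is a matrix of distinct variables of size `β_{0,j}(L) × β_{1,j}(L)`
    Fintype.card (RowIndex L j) = betti0 L j ∧
    Fintype.card (ColIndex L j) = betti1 L j ∧
    (∀ (r : RowIndex L j) (c : ColIndex L j), ∃ s : ParamIndex L, s.1 = (r.1, c.1) ∧
      strandMatrix L (MvPolynomial.X (R := k)) j r c = MvPolynomial.X s) ∧
    ∀ u : ℕ,
      -- `V(L,j,≥u)` is defined by the rank condition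
      bettiStratumGE L j u =
        paramIdeal L '' {p : ParamIndex L → k | (strandMatrix L p j).rank + u ≤ betti0 L j} ∧
      specStratumGE L j u =
        {q | (strandMatrix L (coordsAt L q) j).rank + u ≤ betti0 L j} ∧
      -- when the strata are nonempty
      ((bettiStratumGE L j u).Nonempty ↔ u ≤ betti0 L j) ∧
      ((specStratumGE L j u).Nonempty ↔ u ≤ betti0 L j) ∧
      ((bettiStratum L j u).Nonempty ↔ betti0 L j ≤ betti1 L j + u ∧ u ≤ betti0 L j) ∧
      ((specStratum L j u).Nonempty ↔ betti0 L j ≤ betti1 L j + u ∧ u ≤ betti0 L j) ∧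
      -- irreducibility, closure and codimension in the scheme `Spec k[p]`
      (u ≤ betti0 L j → IsIrreducible (specStratumGE L j u)) ∧
      (betti0 L j ≤ betti1 L j + u → u ≤ betti0 L j →
        specStratumGE L j u = closure (specStratum L j u) ∧
        (PrimeSpectrum.vanishingIdeal (specStratumGE L j u)).height =
          (((betti1 L j + u - betti0 L j) * u : ℕ) : ℕ∞)) ∧
      -- the same for the sets of rational points, over an infinite field
      (Infinite k →
        (u ≤ betti0 L j →
          @IsIrreducible _ (zariskiTopology k (ParamIndex L)) (pointStratumGE L j u)) ∧
        (betti0 L j ≤ betti1 L j + u → u ≤ betti0 L j →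
          pointStratumGE L j u =
            @closure _ (zariskiTopology k (ParamIndex L)) (pointStratum L j u) ∧
          (MvPolynomial.vanishingIdeal k (pointStratumGE L j u)).height =
            (((betti1 L j + u - betti0 L j) * u : ℕ) : ℕ∞))) := by
  refine ⟨paramIdeal_bijOn_groebnerCell hL hfin, card_rowIndex hL hfin j, card_colIndex hL hfin j,
    fun r c => ⟨strandParam hL hfin j (r, c), rfl, strandMatrix_apply hL hfin _ r c⟩, fun u =>
    ⟨?_, specStratumGE_eq hL hfin j u, bettiStratumGE_nonempty_iff hL hfin j u,
      specStratumGE_nonempty_iff hL hfin j u, bettiStratum_nonempty_iff hL hfin j u,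
      specStratum_nonempty_iff hL hfin j u, isIrreducible_specStratumGE hL hfin,
      fun h hu => ⟨(closure_specStratum hL hfin h hu).symm,
        height_vanishingIdeal_specStratumGE hL hfin h hu⟩,
      fun _ => ⟨isIrreducible_pointStratumGE hL hfin,
        fun h hu => ⟨(closure_pointStratum hL hfin h hu).symm,
          height_vanishingIdeal_pointStratumGE hL hfin h hu⟩⟩⟩⟩
  rw [bettiStratumGE_eq_image hL hfin]
  congr 1
  ext p
  exact mem_pointStratumGE_iff hL hfin
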